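/- Let $d\ge 1$ be an integer. For $s\in\mathbb R$ let $\dot H^s(\mathbb R^d)$ be the space of tempered distributions $f$ whose Fourier transform $\widehat f$ is a locally integrable function with $\|f\|_{\dot H^s}^2=\int_{\mathbb R^d}|\xi|^{2s}|\widehat f(\xi)|^2\,d\xi<\infty$. Fix a radial function $\chi\in C_c^\infty(\mathbb R^d)$ with $\chi(\xi)=1$ for $|\xi|\le 1$ and $\chi(\xi)=0$ for $|\xi|>2$. For $\ell\in\mathbb Z$ let $S_\ell=S_\ell^\chi$ be the Fourier multiplier with symbol $\chi(2^{-\ell}\xi)$, and put $\Delta_\ell=S_{\ell+1}-S_\ell$. For $\sigma<d/2$, a tempered distribution $f$ belongs to $\dot B^{\sigma}_{2,1}(\mathbb R^d)$ if $\sum_{\ell=-m}^{m}\Delta_\ell f\to f$ in $\mathcal S'(\mathbb R^d)$ as $m\to\infty$ and $\|f\|_{\dot B^\sigma_{2,1}}=\sum_{\ell\in\mathbb Z}2^{\ell\sigma}\|\Delta_\ell f\|_{L^2}<\infty$. All functions and distributions are complex valued. (i) For every $s>0$ there is a constant $C=C(d,s)$ such that for all $a\in\dot H^{\frac{d-1}2}(\mathbb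 R^d)\cap\dot H^s(\mathbb R^d)$ and all $b\in L^\infty(\mathbb R^d)\cap\dot H^{s+\frac12}(\mathbb R^d)$, the distribution $a$ is a locally integrable function, the pointwise product $ab$ is a tempered distribution that belongs to $\dot H^s(\mathbb R^d)$, and $$\|ab\|_{\dot H^s}\le C\bigl(\|a\|_{\dot H^{\frac{d-1}2}}\|b\|_{\dot H^{s+\frac12}}+\|a\|_{\dot H^s}\|b\|_{L^\infty}\bigr).$$ (ii) For all real $s_1,s_2$ with $s_1+s_2>0$, $s_1<\frac d2$ and $s_2<\frac d2$ there is a constant $C=C(d,s_1,s_2,\chi)$ such that for all $a\in\dot H^{s_1}(\mathbb R^d)$ and $b\in\dot H^{s_2}(\mathbb R^d)$ the product $ab=\lim_{m\to\infty}(S_m^\theta a)(S_m^\theta b)$ exists in $\mathcal S'(\mathbb R^d)$ for every cut-off function $\theta$ with the properties required of $\chi$, does not depend on $\theta$, belongs to $\dot B^{s_1+s_2-\frac d2}_{2,1}(\mathbb R^d)$, and satisfies $$\|ab\|_{\dot B^{s_1+s_2-\frac d2}_{2,1}}\le C\,\|a\|_{\dot H^{s_1}}\|b\|_{\dot H^{s_2}}.$$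 -/

import Mathlib

open MeasureTheory Filter Topology FourierTransform TemperedDistribution
open scoped SchwartzMap ENNReal NNReal ContDiff

noncomputable section

namespace ProductLaws

/-- Euclidean space `ℝ^d`. -/
abbrev Eu (d : ℕ) : Type := EuclideanSpace ℝ (Fin d)

variable {d : ℕ}

/-- The tempered distribution `T` is (given by integration against) the locally integrable
function `g`. -/
def IsGivenBy (T : 𝓢'(Eu d, ℂ)) (g : Eu d → ℂ) : Prop :=
  LocallyIntegrable g volume ∧
    ∀ ψ : 𝓢(Eu d, ℂ), Integrable (fun x => ψ x * g x) volume ∧ T ψ = ∫ x, ψ x * g x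

/-- The `L^2` norm of a tempered distribution, `∞` if it does not belong to `L^2`. -/
def l2Norm (T : 𝓢'(Eu d, ℂ)) : ℝ≥0∞ :=
  ⨅ (g : Lp ℂ 2 (volume : Measure (Eu d))) (_ : (g : 𝓢'(Eu d, ℂ)) = T), ‖g‖ₑ

/-! ### Homogeneous Sobolev spaces -/

/-- The norm of `f` in the homogeneous Sobolev space `Ḣ^s(ℝ^d)`: if the Fourier transform of `f`
is a locally integrable function `g` (unique almost everywhere), it is
`(∫ |ξ|^(2s) |g(ξ)|^2 dξ)^(1/2)`; otherwise it is `∞`.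
(If `g` is locally integrable with this integral finite, then `ψ * g` is integrable for each
Schwartz function `ψ`, so the integrability clause in `IsGivenBy` is no restriction here.) -/
def sobolevNorm (s : ℝ) (f : 𝓢'(Eu d, ℂ)) : ℝ≥0∞ :=
  ⨅ (g : Eu d → ℂ) (_ : IsGivenBy (𝓕 f) g),
    eLpNorm (fun ξ => ((‖ξ‖ ^ s : ℝ) : ℂ) * g ξ) 2 volume

/-- Membership in `Ḣ^s(ℝ^d)`: the Fourier transform of `f` is a locally integrable function,
square integrable with respect to the weight `|ξ|^(2s)`. -/
def MemSobolevHom (s : ℝ) (f : 𝓢'(Eu d, ℂ)) : Prop :=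
  ∃ g : Eu d → ℂ, IsGivenBy (𝓕 f) g ∧
    MemLp (fun ξ => ((‖ξ‖ ^ s : ℝ) : ℂ) * g ξ) 2 volume

/-! ### Littlewood-Paley operators and homogeneous Besov spaces -/

/-- `χ` (the Fourier transform of the kernel `φ`) is a radial test function equal to `1` on the
unit ball and to `0` outside the ball of radius `2`. -/
structure IsCutoff (χ : Eu d → ℂ) : Prop where
  contDiff : ContDiff ℝ ∞ χ
  radial : ∀ ξ η, ‖ξ‖ = ‖η‖ → χ ξ = χ η
  eq_one : ∀ ξ, ‖ξ‖ ≤ 1 → χ ξ = 1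
  eq_zero : ∀ ξ, 2 < ‖ξ‖ → χ ξ = 0

/-- The low frequency cut-off `S_ℓ`, convolution with `2^(dℓ) φ(2^ℓ x)`, that is the Fourier
multiplier with symbol `χ(2^(-ℓ) ξ)`. -/
def lowFreq (χ : Eu d → ℂ) (l : ℤ) : 𝓢'(Eu d, ℂ) →L[ℂ] 𝓢'(Eu d, ℂ) :=
  fourierMultiplierCLM ℂ (fun ξ => χ (((2 : ℝ) ^ (-l)) • ξ))

/-- The dyadic block `Δ_ℓ = S_{ℓ+1} - S_ℓ`. -/
def dyadicBlock (χ : Eu d → ℂ) (l : ℤ) : 𝓢'(Eu d, ℂ) →L[ℂ] 𝓢'(Eu d, ℂ) :=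
  lowFreq χ (l + 1) - lowFreq χ l

/-- The norm of `Ḃ^s_{2,1}(ℝ^d)`: the sum over `ℓ ∈ ℤ` of `2^(ℓ s) ‖Δ_ℓ f‖_{L^2}`. -/
def besovNorm (χ : Eu d → ℂ) (s : ℝ) (f : 𝓢'(Eu d, ℂ)) : ℝ≥0∞ :=
  ∑' l : ℤ, (2 : ℝ≥0∞) ^ ((l : ℝ) * s) * l2Norm (dyadicBlock χ l f)

/-- Membership in `Ḃ^s_{2,1}(ℝ^d)` (for `s < d/2`): the partial sums of `∑ Δ_ℓ f` converge to `f`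
in the sense of tempered distributions, and the sequence `2^(ℓ s) ‖Δ_ℓ f‖_{L^2}` is summable. -/
def MemBesov (χ : Eu d → ℂ) (s : ℝ) (f : 𝓢'(Eu d, ℂ)) : Prop :=
  Tendsto (fun m : ℕ => ∑ l ∈ Finset.Icc (-(m : ℤ)) (m : ℤ), dyadicBlock χ l f) atTop (𝓝 f) ∧
    besovNorm χ s f < ⊤

/-! ### Products -/

/-- The distributions `a` and `b` are functions, and `c` is their pointwise product. -/
def IsPointwiseProduct (a b c : 𝓢'(Eu d, ℂ)) : Prop :=
  ∃ f g : Eu d → ℂ, IsGivenBy a f ∧ IsGivenBy b g ∧ IsGivenBy c (fun x => f x * g x)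

/-- The product of two tempered distributions in the sense of Littlewood-Paley theory:
`c = lim_{m → ∞} (S_m a) (S_m b)` in the sense of tempered distributions, for every choice of the
cut-off. Here `S_m a` and `S_m b` are smooth functions, multiplied pointwise; for distributions
that are the sums of their dyadic blocks, `(S_m a) (S_m b)` is the sum of the products
`Δ_j a Δ_k b` over `j, k < m`, which Bony's decomposition rearranges. -/
def IsProduct (a b c : 𝓢'(Eu d, ℂ)) : Prop :=
  ∀ χ : Eu d → ℂ, IsCutoff χ → ∃ P : ℕ → 𝓢'(Eu d, ℂ),
    (∀ m : ℕ, IsPointwiseProduct (lowFreq χ m a) (lowFreq χ m b) (P m)) ∧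
      Tendsto P atTop (𝓝 c)

end ProductLaws

end

open MeasureTheory Filter Topology FourierTransform TemperedDistribution
open scoped SchwartzMap ENNReal NNReal ContDiff

noncomputable section

namespace ProductLaws

variable {d : ℕ}

/-! ### Cauchy-Schwarz and convolution inequalities for nonnegative functions -/

/-! Everything happens on the Fourier side: if `A` and `B` are the transforms of `a` and `b`, the
transform of the product is the convolution `conv A B`, and the norms are weighted `L^2` norms of
`A`, `B` and `conv A B`. Apart from one term in (i), only absolute values matter, so the estimates
are about nonnegative functions.

The core is `exists_tsum_paraConv_le`, for the part of the convolution where the frequency `z - y`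
of the first factor is at most `8` times the frequency `y` of the second. Let `|z| ~ 2^l`. If `|y| ≤
2|z|`, then `|y| ~ 2^l` and `|z - y| ≲ 2^l`; Young's inequality `L^1 * L^2 → L^2`, with `L^1`
controlled by a weighted `L^2` norm because `s₁ < d/2`, bounds the block. If `|y| > 2|z|`, both
frequencies are comparable and at least `2^l`; Cauchy-Schwarz and the volume of the annulus bound
the block, and `s₁ + s₂ > 0` makes the sum over `l` converge. In both cases the square of the block
is at most a product `a_l b_l` of summable sequences, so Cauchy-Schwarz in `l` gives an `ℓ^1` bound,
which is where the third Besov index `1` comes from. No upper bound on `s₂` enters.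

For (ii), the two parts, with the roles of the factors exchanged, cover the convolution. The
resulting bound also shows that the double integral of `|A|` and `|B|` converges against a power
weight (`TemperedPair`). Hence the convolution is a tempered distribution, and dominated convergence
identifies its inverse transform with the limit of the products of low frequency cut-offs, for any
cut-off.

For (i), the core estimate with `s₁ = (d-1)/2` and `s₂ = s + 1/2` controls the part where the
frequency of `b` is not much smaller. What remains is a sum of terms `Δ_j a · S_{j-2} b`, with sharp
shells in place of smooth blocks. The operators `S_l` are uniformly bounded on `L^∞`
(`exists_norm_lowFreq_le`), so Plancherel bounds each term in `L^2` by `‖b‖_∞` times the `L^2` norm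
of the shell of `A` (`eLpNorm_conv_le`), and the terms live in boundedly overlapping annuli
(`lintegral_sq_tsum_le`). The convolution theorem `TemperedPair.isGivenBy_conv` links both parts to
actual products. -/

theorem sq_lintegral_mul_le {α : Type*} [MeasurableSpace α] (μ : Measure α) {f g : α → ℝ≥0∞}
    (hf : AEMeasurable f μ) (hg : AEMeasurable g μ) :
    (∫⁻ x, f x * g x ∂μ) ^ 2 ≤ (∫⁻ x, f x ^ 2 ∂μ) * ∫⁻ x, g x ^ 2 ∂μ := by
  have h := ENNReal.lintegral_mul_le_Lp_mul_Lq μ Real.HolderConjugate.two_two hf hg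
  have h2 := pow_le_pow_left' h 2
  rw [mul_pow, ← ENNReal.rpow_natCast, ← ENNReal.rpow_natCast, ← ENNReal.rpow_natCast,
    ← ENNReal.rpow_mul, ← ENNReal.rpow_mul] at h2
  simpa using h2

/-- Cauchy-Schwarz for the counting measure. It turns block bounds by two `ℓ^1` sequences into `ℓ^1`
summability of the blocks. -/
theorem tsum_le_of_sq_le_mul {ι : Type*} {T a b : ι → ℝ≥0∞} (h : ∀ i, T i ^ 2 ≤ a i * b i) :
    (∑' i, T i) ^ 2 ≤ (∑' i, a i) * ∑' i, b i := by
  let : MeasurableSpace ι := ⊤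
  have key := sq_lintegral_mul_le (Measure.count : Measure ι)
    (f := fun i => a i ^ (1 / 2 : ℝ)) (g := fun i => b i ^ (1 / 2 : ℝ))
    (measurable_from_top.aemeasurable) (measurable_from_top.aemeasurable)
  have hs : ∀ x : ℝ≥0∞, (x ^ (1 / 2 : ℝ)) ^ 2 = x := fun x => by
    rw [← ENNReal.rpow_natCast, ← ENNReal.rpow_mul]; simp
  simp only [lintegral_count, hs] at key
  refine le_trans (pow_le_pow_left' (ENNReal.tsum_le_tsum fun i => ?_) 2) key
  rw [← ENNReal.mul_rpow_of_nonneg _ _ (by norm_num)]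
  calc T i = (T i ^ 2) ^ (1 / 2 : ℝ) := by
        rw [← ENNReal.rpow_natCast, ← ENNReal.rpow_mul]; simp
    _ ≤ _ := ENNReal.rpow_le_rpow (h i) (by norm_num)

/-- Young's inequality `L^1 * L^2 → L^2`: Cauchy-Schwarz for `F^(1/2) · (F^(1/2) G)`, then Tonelli
and translation invariance. -/
theorem lintegral_conv_sq_le {F G : Eu d → ℝ≥0∞} (hF : Measurable F) (hG : Measurable G) :
    ∫⁻ z, (∫⁻ y, F (z - y) * G y) ^ 2 ≤ (∫⁻ x, F x) ^ 2 * ∫⁻ y, G y ^ 2 := by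
  have hs : ∀ x : ℝ≥0∞, (x ^ (1 / 2 : ℝ)) ^ 2 = x := fun x => by
    rw [← ENNReal.rpow_natCast, ← ENNReal.rpow_mul]; simp
  have hmul : ∀ x : ℝ≥0∞, x ^ (1 / 2 : ℝ) * x ^ (1 / 2 : ℝ) = x := fun x => by
    rw [← sq, hs]
  have hm : Measurable fun p : Eu d × Eu d => F (p.1 - p.2) * G p.2 ^ 2 := by fun_prop
  calc ∫⁻ z, (∫⁻ y, F (z - y) * G y) ^ 2
      ≤ ∫⁻ z, (∫⁻ x, F x) * ∫⁻ y, F (z - y) * G y ^ 2 := by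
        refine lintegral_mono fun z => ?_
        have h := sq_lintegral_mul_le volume (f := fun y => F (z - y) ^ (1 / 2 : ℝ))
          (g := fun y => F (z - y) ^ (1 / 2 : ℝ) * G y) (by fun_prop) (by fun_prop)
        simp only [← mul_assoc, hmul, mul_pow, hs] at h
        rwa [lintegral_sub_left_eq_self F z] at h
    _ = (∫⁻ x, F x) * ∫⁻ y, ∫⁻ z, F (z - y) * G y ^ 2 := by
        rw [lintegral_const_mul _ (hm.lintegral_prod_right'),
          lintegral_lintegral_swap hm.aemeasurable]
    _ = _ := by
        have : ∀ y : Eu d, ∫⁻ z, F (z - y) * G y ^ 2 = (∫⁻ x, F x) * G y ^ 2 := fun y => by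
          rw [lintegral_mul_const _ (by fun_prop), lintegral_sub_right_eq_self F y]
        simp only [this]
        rw [lintegral_const_mul _ (by fun_prop), sq, mul_assoc]

theorem sq_conv_le {F G : Eu d → ℝ≥0∞} (hF : Measurable F) (hG : Measurable G) (z : Eu d) :
    (∫⁻ y, F (z - y) * G y) ^ 2 ≤ (∫⁻ x, F x ^ 2) * ∫⁻ y, G y ^ 2 := by
  have h := sq_lintegral_mul_le volume (f := fun y => F (z - y)) (g := G)
    (by fun_prop) (by fun_prop)
  rwa [lintegral_sub_left_eq_self (fun x => F x ^ 2) z] at h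

/-! ### Dyadic sums of powers -/

/-- Allows a power weight of either sign to be exchanged between comparable frequencies; the upper
comparison serves `p ≥ 0`, the lower one `p ≤ 0`. -/
theorem rpow_le_of_comparable {x y c : ℝ≥0∞} (h1 : x ≤ c * y) (h2 : y ≤ c * x) (hc : c ≠ ⊤)
    (hc0 : c ≠ 0) (p : ℝ) : x ^ p ≤ c ^ |p| * y ^ p := by
  rcases le_total 0 p with hp | hp
  · rw [abs_of_nonneg hp, ← ENNReal.mul_rpow_of_nonneg _ _ hp]
    exact ENNReal.rpow_le_rpow h1 hp
  · rw [abs_of_nonpos hp]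
    obtain ⟨q, rfl⟩ : ∃ q, p = -q := ⟨-p, by ring⟩
    have hq : 0 ≤ q := by linarith
    have h3 := ENNReal.rpow_le_rpow h2 hq
    rw [ENNReal.mul_rpow_of_nonneg _ _ hq] at h3
    rw [neg_neg, ENNReal.rpow_neg, ENNReal.rpow_neg]
    have hcq0 : c ^ q ≠ 0 := by
      intro h; rcases ENNReal.rpow_eq_zero_iff.1 h with h | h
      · exact hc0 h.1
      · exact hc h.1
    have hcq : c ^ q ≠ ⊤ := ENNReal.rpow_ne_top_of_nonneg hq hc
    calc (x ^ q)⁻¹ = c ^ q * (c ^ q * x ^ q)⁻¹ := by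
          rw [ENNReal.mul_inv (Or.inl hcq0) (Or.inl hcq), ← mul_assoc,
            ENNReal.mul_inv_cancel hcq0 hcq, one_mul]
      _ ≤ _ := by gcongr

theorem exists_tsum_dyadic_le {δ : ℝ} (hδ : 0 < δ) : ∃ C : ℝ≥0∞, C ≠ ⊤ ∧ ∀ r : ℝ≥0∞,
    ∑' l : ℤ, (if (2 : ℝ≥0∞) ^ l ≤ r then ((2 : ℝ≥0∞) ^ l) ^ δ else 0) ≤ C * r ^ δ := by
  have hlt : (2 : ℝ≥0∞) ^ (-δ) < 1 := ENNReal.rpow_lt_one_of_one_lt_of_neg (by norm_num) (by linarith)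
  have hpos : 1 - (2 : ℝ≥0∞) ^ (-δ) ≠ 0 := (tsub_pos_of_lt hlt).ne'
  refine ⟨(1 - (2 : ℝ≥0∞) ^ (-δ))⁻¹, ENNReal.inv_ne_top.2 hpos, fun r => ?_⟩
  rcases eq_or_ne r 0 with rfl | hr0
  · have : ∀ l : ℤ, ¬ ((2 : ℝ≥0∞) ^ l ≤ 0) := fun l => by
      simpa using (ENNReal.zpow_pos (by norm_num) (by norm_num) l).ne'
    simp [this]
  rcases eq_or_ne r ⊤ with rfl | hrt
  · rw [ENNReal.top_rpow_of_pos hδ, ENNReal.mul_top (ENNReal.inv_ne_zero.2 (by finiteness))]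
    exact le_top
  obtain ⟨n, hn1, hn2⟩ := ENNReal.exists_mem_Ico_zpow hr0 hrt (y := 2) (by norm_num) (by norm_num)
  -- With `2^n ≤ r < 2^(n+1)` only the indices `l = n - m`, `m ≥ 0`, contribute, which leaves a
  -- geometric series of ratio `2^(-δ)`.
  have hinj : Function.Injective fun m : ℕ => n - (m : ℤ) := fun a b h => by
    simpa using h
  rw [← hinj.tsum_eq]
  · calc ∑' m : ℕ, (if (2 : ℝ≥0∞) ^ (n - (m : ℤ)) ≤ r then ((2 : ℝ≥0∞) ^ (n - (m : ℤ))) ^ δ else 0)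
        ≤ ∑' m : ℕ, ((2 : ℝ≥0∞) ^ n) ^ δ * ((2 : ℝ≥0∞) ^ (-δ)) ^ m := by
          refine ENNReal.tsum_le_tsum fun m => ?_
          split_ifs
          · refine le_of_eq ?_
            rw [← ENNReal.rpow_intCast, ← ENNReal.rpow_intCast, ← ENNReal.rpow_natCast,
              ← ENNReal.rpow_mul, ← ENNReal.rpow_mul, ← ENNReal.rpow_mul,
              ← ENNReal.rpow_add _ _ (by norm_num) (by norm_num)]
            congr 1; push_cast; ring
          · exact zero_le
      _ = ((2 : ℝ≥0∞) ^ n) ^ δ * (1 - (2 : ℝ≥0∞) ^ (-δ))⁻¹ := by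
          rw [ENNReal.tsum_mul_left, ENNReal.tsum_geometric]
      _ ≤ _ := by
          rw [mul_comm]; gcongr
  · intro l hl
    have h1 : (2 : ℝ≥0∞) ^ l ≤ r := by
      by_contra h; simp [h] at hl
    have h2 : l < n + 1 := by
      by_contra! h
      exact absurd (lt_of_lt_of_le hn2 (ENNReal.zpow_le_of_le (by norm_num) h)) (not_lt.2 h1)
    exact ⟨(n - l).toNat, by simp; omega⟩

theorem exists_tsum_dyadic_neg_le {δ : ℝ} (hδ : 0 < δ) : ∃ C : ℝ≥0∞, C ≠ ⊤ ∧ ∀ r : ℝ≥0∞,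
    ∑' l : ℤ, (if r ≤ (2 : ℝ≥0∞) ^ l then ((2 : ℝ≥0∞) ^ l) ^ (-δ) else 0) ≤ C * r ^ (-δ) := by
  obtain ⟨C, hC, h⟩ := exists_tsum_dyadic_le hδ
  refine ⟨C, hC, fun r => ?_⟩
  have h1 := h r⁻¹
  rw [← (Equiv.neg ℤ).tsum_eq] at h1
  have e : ∀ l : ℤ, (2 : ℝ≥0∞) ^ (-l) = ((2 : ℝ≥0∞) ^ l)⁻¹ := fun l => ENNReal.zpow_neg _ _
  simp only [Equiv.neg_apply, e, ENNReal.inv_le_inv, ENNReal.inv_rpow, ← ENNReal.rpow_neg] at h1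
  exact h1

/-! ### Power weights -/

theorem two_zpow_ne_zero (l : ℤ) : (2 : ℝ≥0∞) ^ l ≠ 0 :=
  (ENNReal.zpow_pos (by norm_num) (by norm_num) l).ne'

theorem two_zpow_ne_top (l : ℤ) : (2 : ℝ≥0∞) ^ l ≠ ⊤ :=
  ENNReal.zpow_ne_top (by norm_num) (by norm_num) l

theorem two_zpow_add (l k : ℤ) : (2 : ℝ≥0∞) ^ (l + k) = 2 ^ l * 2 ^ k :=
  ENNReal.zpow_add (by norm_num) (by norm_num) l k

theorem two_zpow_eq_ofReal (k : ℤ) : (2 : ℝ≥0∞) ^ k = ENNReal.ofReal ((2 : ℝ) ^ k) := by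
  rw [← ENNReal.rpow_intCast, ← Real.rpow_intCast, ← ENNReal.ofReal_rpow_of_pos (by norm_num)]
  norm_num

theorem rpow_mul_rpow_neg {x : ℝ≥0∞} (h0 : x ≠ 0) (ht : x ≠ ⊤) (p : ℝ) :
    x ^ p * x ^ (-p) = 1 := by
  rw [← ENNReal.rpow_add _ _ h0 ht]; simp

theorem ae_enorm_ne_zero (hd : 1 ≤ d) : ∀ᵐ x : Eu d, ‖x‖ₑ ≠ 0 := by
  have : Nonempty (Fin d) := ⟨⟨0, hd⟩⟩
  have : ∀ᵐ x : Eu d, x ≠ 0 := by simp [ae_iff]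
  filter_upwards [this] with x hx
  simpa using hx

theorem measurableSet_enorm_le (r : ℝ≥0∞) : MeasurableSet {x : Eu d | ‖x‖ₑ ≤ r} :=
  measurableSet_le (by fun_prop) (by fun_prop)

theorem measurableSet_le_enorm (r : ℝ≥0∞) : MeasurableSet {x : Eu d | r ≤ ‖x‖ₑ} :=
  measurableSet_le (by fun_prop) (by fun_prop)

/-- By Tonelli the sum may be taken at fixed `x`, where it runs over `2^(l+k) ≥ |x|`; this geometric
series is `≲ |x|^(-δ)` and cancels the surplus weight. The shift `k` is a change of index. -/
theorem exists_tsum_low_le (hd : 1 ≤ d) {δ : ℝ} (hδ : 0 < δ) (p : ℝ) : ∃ C : ℝ≥0∞, C ≠ ⊤ ∧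
    ∀ k : ℤ, ∀ H : Eu d → ℝ≥0∞, Measurable H →
    ∑' l : ℤ, ((2 : ℝ≥0∞) ^ (l + k)) ^ (-δ) *
        ∫⁻ x, {x : Eu d | ‖x‖ₑ ≤ 2 ^ (l + k)}.indicator (fun x => ‖x‖ₑ ^ (p + δ) * H x) x
      ≤ C * ∫⁻ x, ‖x‖ₑ ^ p * H x := by
  obtain ⟨C, hC, h⟩ := exists_tsum_dyadic_neg_le hδ
  refine ⟨C, hC, fun k H hH => ?_⟩
  refine le_trans (le_of_eq ((Equiv.addRight k).tsum_eq (fun l : ℤ => ((2 : ℝ≥0∞) ^ l) ^ (-δ) *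
        ∫⁻ x, {x : Eu d | ‖x‖ₑ ≤ 2 ^ l}.indicator (fun x => ‖x‖ₑ ^ (p + δ) * H x) x))) ?_
  have hm2 : ∀ l : ℤ, Measurable
      ({x : Eu d | ‖x‖ₑ ≤ 2 ^ l}.indicator (fun x => ‖x‖ₑ ^ (p + δ) * H x)) := fun l =>
    Measurable.indicator (by fun_prop) (measurableSet_enorm_le _)
  simp only [← lintegral_const_mul _ (hm2 _)]
  rw [← lintegral_tsum (fun l => ((hm2 l).const_mul _).aemeasurable),
    ← lintegral_const_mul _ (by fun_prop)]
  refine lintegral_mono_ae ?_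
  filter_upwards [ae_enorm_ne_zero hd] with x hx
  calc _ = ∑' l : ℤ, (if ‖x‖ₑ ≤ (2 : ℝ≥0∞) ^ l then ((2 : ℝ≥0∞) ^ l) ^ (-δ) else 0) *
        (‖x‖ₑ ^ (p + δ) * H x) := by
        refine tsum_congr fun l => ?_
        by_cases hl : ‖x‖ₑ ≤ (2 : ℝ≥0∞) ^ l <;> simp [Set.indicator, hl]
    _ ≤ C * ‖x‖ₑ ^ (-δ) * (‖x‖ₑ ^ (p + δ) * H x) := by
        rw [ENNReal.tsum_mul_right]; gcongr; exact h _
    _ = C * (‖x‖ₑ ^ p * H x) := by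
        rw [ENNReal.rpow_add _ _ hx (by simp)]
        calc _ = C * ((‖x‖ₑ ^ δ * ‖x‖ₑ ^ (-δ)) * (‖x‖ₑ ^ p * H x)) := by ring
          _ = _ := by rw [rpow_mul_rpow_neg hx (by simp), one_mul]

theorem exists_tsum_high_le (hd : 1 ≤ d) {δ : ℝ} (hδ : 0 < δ) (p : ℝ) : ∃ C : ℝ≥0∞, C ≠ ⊤ ∧
    ∀ H : Eu d → ℝ≥0∞, Measurable H →
    ∑' l : ℤ, ((2 : ℝ≥0∞) ^ l) ^ δ *
        ∫⁻ x, {x : Eu d | 2 ^ l ≤ ‖x‖ₑ}.indicator (fun x => ‖x‖ₑ ^ (p - δ) * H x) x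
      ≤ C * ∫⁻ x, ‖x‖ₑ ^ p * H x := by
  obtain ⟨C, hC, h⟩ := exists_tsum_dyadic_le hδ
  refine ⟨C, hC, fun H hH => ?_⟩
  have hm2 : ∀ l : ℤ, Measurable
      ({x : Eu d | 2 ^ l ≤ ‖x‖ₑ}.indicator (fun x => ‖x‖ₑ ^ (p - δ) * H x)) := fun l =>
    Measurable.indicator (by fun_prop) (measurableSet_le_enorm _)
  simp only [← lintegral_const_mul _ (hm2 _)]
  rw [← lintegral_tsum (fun l => ((hm2 l).const_mul _).aemeasurable),
    ← lintegral_const_mul _ (by fun_prop)]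
  refine lintegral_mono_ae ?_
  filter_upwards [ae_enorm_ne_zero hd] with x hx
  calc _ = ∑' l : ℤ, (if (2 : ℝ≥0∞) ^ l ≤ ‖x‖ₑ then ((2 : ℝ≥0∞) ^ l) ^ δ else 0) *
        (‖x‖ₑ ^ (p - δ) * H x) := by
        refine tsum_congr fun l => ?_
        by_cases hl : (2 : ℝ≥0∞) ^ l ≤ ‖x‖ₑ <;> simp [Set.indicator, hl]
    _ ≤ C * ‖x‖ₑ ^ δ * (‖x‖ₑ ^ (p - δ) * H x) := by
        rw [ENNReal.tsum_mul_right]; gcongr; exact h _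
    _ = C * (‖x‖ₑ ^ p * H x) := by
        rw [sub_eq_add_neg, ENNReal.rpow_add _ _ hx (by simp)]
        calc _ = C * ((‖x‖ₑ ^ δ * ‖x‖ₑ ^ (-δ)) * (‖x‖ₑ ^ p * H x)) := by ring
          _ = _ := by rw [rpow_mul_rpow_neg hx (by simp), one_mul]

theorem exists_volume_ball_le : ∃ C : ℝ≥0∞, C ≠ ⊤ ∧ ∀ r : ℝ≥0∞, r ≠ ⊤ →
    volume {x : Eu d | ‖x‖ₑ ≤ r} ≤ C * r ^ (d : ℝ) := by
  refine ⟨volume (Metric.ball (0 : Eu d) 1), measure_ball_lt_top.ne, fun r hr => ?_⟩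
  lift r to ℝ≥0 using hr
  have : {x : Eu d | ‖x‖ₑ ≤ r} = Metric.closedBall 0 (r : ℝ) := by
    ext x
    simp [enorm_le_coe, ← NNReal.coe_le_coe]
  rw [this, Measure.addHaar_closedBall (volume : Measure (Eu d)) 0 (NNReal.coe_nonneg r), mul_comm]
  simp [ENNReal.ofReal_pow]

/-- The weight is essentially constant on dyadic shells of volume `≲ 2^(ld)`, so the integral is a
geometric series of rate `p + d`, convergent at the origin even for negative `p > -d`. -/
theorem exists_lintegral_low_rpow_le (hd : 1 ≤ d) {p : ℝ} (hp : 0 < p + d) :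
    ∃ C : ℝ≥0∞, C ≠ ⊤ ∧ ∀ r : ℝ≥0∞,
      ∫⁻ x, {x : Eu d | ‖x‖ₑ ≤ r}.indicator (fun x => ‖x‖ₑ ^ p) x ≤ C * r ^ (p + d) := by
  obtain ⟨C₁, hC₁, h₁⟩ := exists_tsum_dyadic_le hp
  obtain ⟨C₂, hC₂, h₂⟩ := exists_volume_ball_le (d := d)
  refine ⟨C₁ * (2 ^ |p| * C₂ * 2 ^ (d : ℝ)), by finiteness, fun r => ?_⟩
  calc ∫⁻ x, {x : Eu d | ‖x‖ₑ ≤ r}.indicator (fun x => ‖x‖ₑ ^ p) x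
      ≤ ∫⁻ x, ∑' l : ℤ, {x : Eu d | ‖x‖ₑ ≤ 2 ^ (l + 1)}.indicator
          (fun _ => if (2 : ℝ≥0∞) ^ l ≤ r then 2 ^ |p| * ((2 : ℝ≥0∞) ^ l) ^ p else 0) x := by
        refine lintegral_mono_ae ?_
        filter_upwards [ae_enorm_ne_zero hd] with x hx
        obtain ⟨n, hn1, hn2⟩ := ENNReal.exists_mem_Ico_zpow hx enorm_ne_top (y := 2)
          (by norm_num) (by norm_num)
        refine le_trans ?_ (ENNReal.le_tsum n)
        by_cases hxr : ‖x‖ₑ ≤ r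
        · have hmem : x ∈ {x : Eu d | ‖x‖ₑ ≤ 2 ^ (n + 1)} := hn2.le
          rw [Set.indicator_of_mem (show x ∈ {x : Eu d | ‖x‖ₑ ≤ r} from hxr),
            Set.indicator_of_mem hmem, if_pos (hn1.trans hxr)]
          refine rpow_le_of_comparable ?_ ?_ (by norm_num) (by norm_num) p
          · rw [two_zpow_add, zpow_one, mul_comm] at hn2
            exact hn2.le
          · exact hn1.trans (le_mul_of_one_le_left zero_le (by norm_num))
        · simp [Set.indicator, hxr]
    _ = ∑' l : ℤ, (if (2 : ℝ≥0∞) ^ l ≤ r then 2 ^ |p| * ((2 : ℝ≥0∞) ^ l) ^ p else 0) *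
          volume {x : Eu d | ‖x‖ₑ ≤ 2 ^ (l + 1)} := by
        rw [lintegral_tsum fun l => (measurable_const.indicator
          (measurableSet_enorm_le _)).aemeasurable]
        refine tsum_congr fun l => ?_
        rw [lintegral_indicator (measurableSet_enorm_le _)]
        simp
    _ ≤ ∑' l : ℤ, (if (2 : ℝ≥0∞) ^ l ≤ r then ((2 : ℝ≥0∞) ^ l) ^ (p + d) else 0) *
          (2 ^ |p| * C₂ * 2 ^ (d : ℝ)) := by
        refine ENNReal.tsum_le_tsum fun l => ?_
        split_ifs
        · calc _ ≤ 2 ^ |p| * ((2 : ℝ≥0∞) ^ l) ^ p * (C₂ * (2 ^ (l + 1)) ^ (d : ℝ)) := by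
                gcongr; exact h₂ _ (two_zpow_ne_top _)
            _ = _ := by
                rw [two_zpow_add, zpow_one, ENNReal.mul_rpow_of_nonneg _ _ (by positivity),
                  ENNReal.rpow_add _ _ (two_zpow_ne_zero l) (two_zpow_ne_top l)]
                ring
        · simp
    _ ≤ _ := by
        rw [ENNReal.tsum_mul_right]
        calc _ ≤ C₁ * r ^ (p + d) * (2 ^ |p| * C₂ * 2 ^ (d : ℝ)) := by gcongr; exact h₁ r
          _ = _ := by ring

/-! ### Convolutions in which the second frequency dominates -/

/-- The annulus `2^l ≤ |ξ| ≤ 2^(l+2)` that carries the symbol of a dyadic block. -/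
def annulus (l : ℤ) : Set (Eu d) := {x | (2 : ℝ≥0∞) ^ l ≤ ‖x‖ₑ ∧ ‖x‖ₑ ≤ 2 ^ (l + 2)}

/-- The part of the convolution of `F` and `G` in which the frequency of `F` is at most `8` times
that of `G`. -/
def paraConv (F G : Eu d → ℝ≥0∞) (z : Eu d) : ℝ≥0∞ :=
  ∫⁻ y, if ‖z - y‖ₑ ≤ 8 * ‖y‖ₑ then F (z - y) * G y else 0

theorem measurableSet_annulus (l : ℤ) : MeasurableSet (annulus l : Set (Eu d)) :=
  (measurableSet_le_enorm _).inter (measurableSet_enorm_le _)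

theorem measurableSet_near (l : ℤ) :
    MeasurableSet {x : Eu d | (2 : ℝ≥0∞) ^ l ≤ 16 * ‖x‖ₑ ∧ ‖x‖ₑ ≤ 2 ^ (l + 3)} :=
  (measurableSet_le (f := fun _ => (2 : ℝ≥0∞) ^ l) (g := fun x : Eu d => 16 * ‖x‖ₑ)
    (by fun_prop) (by fun_prop)).inter (measurableSet_enorm_le (2 ^ (l + 3)))

theorem sq_rpow_half {x : ℝ≥0∞} (q : ℝ) : (x ^ (q / 2)) ^ 2 = x ^ q := by
  rw [← ENNReal.rpow_natCast, ← ENNReal.rpow_mul]; congr 1; push_cast; ring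

/-- Cauchy-Schwarz for `|x|^(-q/2) · |x|^(q/2) F`; the first factor is square integrable near the
origin because `q < d`. -/
theorem sq_lintegral_low_le (hd : 1 ≤ d) {q : ℝ} (hq : 0 < -q + d) : ∃ C : ℝ≥0∞, C ≠ ⊤ ∧
    ∀ F : Eu d → ℝ≥0∞, Measurable F → ∀ r : ℝ≥0∞,
    (∫⁻ x, {x : Eu d | ‖x‖ₑ ≤ r}.indicator F x) ^ 2 ≤ C * r ^ (-q + d) *
      ∫⁻ x, {x : Eu d | ‖x‖ₑ ≤ r}.indicator (fun x => ‖x‖ₑ ^ q * F x ^ 2) x := by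
  obtain ⟨C, hC, h⟩ := exists_lintegral_low_rpow_le hd hq
  refine ⟨C, hC, fun F hF r => ?_⟩
  have hms := measurableSet_enorm_le (d := d) r
  have key := sq_lintegral_mul_le volume
    (f := {x : Eu d | ‖x‖ₑ ≤ r}.indicator fun x => ‖x‖ₑ ^ (-q / 2))
    (g := {x : Eu d | ‖x‖ₑ ≤ r}.indicator fun x => ‖x‖ₑ ^ (q / 2) * F x)
    (Measurable.indicator (by fun_prop) hms).aemeasurable
    (Measurable.indicator (by fun_prop) hms).aemeasurable
  have e1 : ∀ x : Eu d, ({x : Eu d | ‖x‖ₑ ≤ r}.indicator (fun x => ‖x‖ₑ ^ (-q / 2)) x) ^ 2 =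
      {x : Eu d | ‖x‖ₑ ≤ r}.indicator (fun x => ‖x‖ₑ ^ (-q)) x := fun x => by
    by_cases hx : ‖x‖ₑ ≤ r <;> simp [Set.indicator, hx, sq_rpow_half]
  have e2 : ∀ x : Eu d, ({x : Eu d | ‖x‖ₑ ≤ r}.indicator (fun x => ‖x‖ₑ ^ (q / 2) * F x) x) ^ 2 =
      {x : Eu d | ‖x‖ₑ ≤ r}.indicator (fun x => ‖x‖ₑ ^ q * F x ^ 2) x := fun x => by
    by_cases hx : ‖x‖ₑ ≤ r <;> simp [Set.indicator, hx, mul_pow, sq_rpow_half]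
  have e3 : ∫⁻ x, {x : Eu d | ‖x‖ₑ ≤ r}.indicator F x =
      ∫⁻ x, {x : Eu d | ‖x‖ₑ ≤ r}.indicator (fun x => ‖x‖ₑ ^ (-q / 2)) x *
        {x : Eu d | ‖x‖ₑ ≤ r}.indicator (fun x => ‖x‖ₑ ^ (q / 2) * F x) x := by
    refine lintegral_congr_ae ?_
    filter_upwards [ae_enorm_ne_zero hd] with x hx
    by_cases hxr : ‖x‖ₑ ≤ r
    · simp only [Set.indicator, Set.mem_ofPred_eq, hxr, if_true]
      rw [← mul_assoc, mul_comm (‖x‖ₑ ^ (-q / 2)), neg_div,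
        rpow_mul_rpow_neg hx enorm_ne_top, one_mul]
    · simp [Set.indicator, hxr]
  simp only [e1, e2] at key
  rw [e3]
  exact key.trans (by gcongr; exact h r)

/-- Young's inequality with the low frequencies of `F` in `L^1` and a dyadic piece of `G` in `L^2`.
The right side has the form summed by `exists_tsum_low_le`. The exponent `1` attached to `G` could
be any positive number, since `G` is localised at `|y| ~ 2^l`. -/
theorem lintegral_near_le (hd : 1 ≤ d) {s₁ : ℝ} (s₂ : ℝ) (h₁ : s₁ < (d : ℝ) / 2) :
    ∃ C : ℝ≥0∞, C ≠ ⊤ ∧ ∀ F G : Eu d → ℝ≥0∞, Measurable F → Measurable G → ∀ l : ℤ,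
    ((2 : ℝ≥0∞) ^ l) ^ (2 * (s₁ + s₂ - d / 2)) *
      ∫⁻ z, (∫⁻ y, {x : Eu d | ‖x‖ₑ ≤ 2 ^ (l + 6)}.indicator F (z - y) *
        {x : Eu d | 2 ^ l ≤ 16 * ‖x‖ₑ ∧ ‖x‖ₑ ≤ 2 ^ (l + 3)}.indicator G y) ^ 2 ≤
    C * ((((2 : ℝ≥0∞) ^ (l + 6)) ^ (-(d / 2 - s₁)) *
        ∫⁻ x, {x : Eu d | ‖x‖ₑ ≤ 2 ^ (l + 6)}.indicator
          (fun x => ‖x‖ₑ ^ (2 * s₁ + (d / 2 - s₁)) * F x ^ 2) x) *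
      (((2 : ℝ≥0∞) ^ (l + 3)) ^ (-1 : ℝ) *
        ∫⁻ x, {x : Eu d | ‖x‖ₑ ≤ 2 ^ (l + 3)}.indicator
          (fun x => ‖x‖ₑ ^ (2 * s₂ + 1) * G x ^ 2) x)) := by
  obtain ⟨e, he⟩ : ∃ e : ℝ, e = d / 2 - s₁ := ⟨_, rfl⟩
  have he0 : 0 < e := by linarith
  -- The gap `d - 2 s₁ = 2e` is shared: one `e` raises the weight on `F`, which makes the sum over
  -- `l` geometric, and the other keeps `q = 2 s₁ + e` below `d`.
  obtain ⟨C, hC, h⟩ := sq_lintegral_low_le (d := d) hd (q := 2 * s₁ + e) (by linarith)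
  refine ⟨C * (2 ^ (6 : ℤ)) ^ (2 * e) * (16 ^ |-(2 * s₂ + 1)| * 8), by finiteness,
    fun F G hF hG l => ?_⟩
  rw [← he]
  have hexp : -(2 * s₁ + e) + d = e := by linarith
  rw [hexp] at h
  set X := ∫⁻ x, {x : Eu d | ‖x‖ₑ ≤ 2 ^ (l + 6)}.indicator
    (fun x => ‖x‖ₑ ^ (2 * s₁ + e) * F x ^ 2) x
  set Y := ∫⁻ x, {x : Eu d | ‖x‖ₑ ≤ 2 ^ (l + 3)}.indicator
    (fun x => ‖x‖ₑ ^ (2 * s₂ + 1) * G x ^ 2) x with hY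
  have hms : MeasurableSet {x : Eu d | (2 : ℝ≥0∞) ^ l ≤ 16 * ‖x‖ₑ ∧ ‖x‖ₑ ≤ 2 ^ (l + 3)} :=
    measurableSet_near l
  have hG2 : ∫⁻ x, ({x : Eu d | 2 ^ l ≤ 16 * ‖x‖ₑ ∧ ‖x‖ₑ ≤ 2 ^ (l + 3)}.indicator G x) ^ 2 ≤
      16 ^ |-(2 * s₂ + 1)| * ((2 : ℝ≥0∞) ^ l) ^ (-(2 * s₂ + 1)) * Y := by
    rw [hY, ← lintegral_const_mul _ (Measurable.indicator (by fun_prop) (measurableSet_enorm_le _))]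
    refine lintegral_mono_ae ?_
    filter_upwards [ae_enorm_ne_zero hd] with x hx
    by_cases hxl : (2 : ℝ≥0∞) ^ l ≤ 16 * ‖x‖ₑ ∧ ‖x‖ₑ ≤ 2 ^ (l + 3)
    · simp only [Set.indicator, Set.mem_ofPred_eq, hxl, and_self, if_true]
      have h16 : ‖x‖ₑ ≤ 16 * 2 ^ l := by
        refine hxl.2.trans ?_
        rw [two_zpow_add, mul_comm]
        gcongr
        rw [← ENNReal.rpow_intCast]; norm_num
      calc G x ^ 2 = ‖x‖ₑ ^ (-(2 * s₂ + 1)) * (‖x‖ₑ ^ (2 * s₂ + 1) * G x ^ 2) := by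
            rw [← mul_assoc, mul_comm (‖x‖ₑ ^ _), rpow_mul_rpow_neg hx enorm_ne_top, one_mul]
        _ ≤ _ := by
            gcongr
            exact rpow_le_of_comparable h16 hxl.1 (by norm_num) (by norm_num) _
    · simp [Set.indicator, hxl]
  have ht0 := two_zpow_ne_zero l
  have htt := two_zpow_ne_top l
  have h6 : ((2 : ℝ≥0∞) ^ (l + 6)) ^ e =
      (2 ^ (6 : ℤ)) ^ (2 * e) * ((2 : ℝ≥0∞) ^ l) ^ (2 * e) * ((2 : ℝ≥0∞) ^ (l + 6)) ^ (-e) := by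
    rw [← ENNReal.mul_rpow_of_nonneg _ _ (by linarith), mul_comm (2 ^ (6 : ℤ)), ← two_zpow_add,
      ← ENNReal.rpow_add _ _ (two_zpow_ne_zero _) (two_zpow_ne_top _)]
    congr 1; ring
  have h3 : ((2 : ℝ≥0∞) ^ l) ^ (-1 : ℝ) = 8 * ((2 : ℝ≥0∞) ^ (l + 3)) ^ (-1 : ℝ) := by
    rw [two_zpow_add, ENNReal.rpow_neg_one, ENNReal.rpow_neg_one,
      ENNReal.mul_inv (Or.inl ht0) (Or.inl htt), mul_left_comm]
    have : (8 : ℝ≥0∞) * (2 ^ (3 : ℤ))⁻¹ = 1 := by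
      have : (2 : ℝ≥0∞) ^ (3 : ℤ) = 8 := by rw [← ENNReal.rpow_intCast]; norm_num
      rw [this]; exact ENNReal.mul_inv_cancel (by norm_num) (by norm_num)
    rw [this, mul_one]
  have ht : ((2 : ℝ≥0∞) ^ l) ^ (2 * (s₁ + s₂ - d / 2)) * ((2 : ℝ≥0∞) ^ l) ^ (2 * e) *
      ((2 : ℝ≥0∞) ^ l) ^ (-(2 * s₂ + 1)) = ((2 : ℝ≥0∞) ^ l) ^ (-1 : ℝ) := by
    rw [← ENNReal.rpow_add _ _ ht0 htt, ← ENNReal.rpow_add _ _ ht0 htt]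
    congr 1; rw [he]; ring
  calc _ ≤ ((2 : ℝ≥0∞) ^ l) ^ (2 * (s₁ + s₂ - d / 2)) *
        ((C * ((2 : ℝ≥0∞) ^ (l + 6)) ^ e * X) *
          (16 ^ |-(2 * s₂ + 1)| * ((2 : ℝ≥0∞) ^ l) ^ (-(2 * s₂ + 1)) * Y)) := by
        gcongr
        refine (lintegral_conv_sq_le (hF.indicator (measurableSet_enorm_le _))
          (hG.indicator hms)).trans ?_
        gcongr
        exact h F hF _
    _ = C * (2 ^ (6 : ℤ)) ^ (2 * e) * 16 ^ |-(2 * s₂ + 1)| *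
          (((2 : ℝ≥0∞) ^ l) ^ (2 * (s₁ + s₂ - d / 2)) * ((2 : ℝ≥0∞) ^ l) ^ (2 * e) *
            ((2 : ℝ≥0∞) ^ l) ^ (-(2 * s₂ + 1))) * (((2 : ℝ≥0∞) ^ (l + 6)) ^ (-e) * X) * Y := by
        rw [h6]; ring
    _ = _ := by rw [ht, h3]; ring

/-- Cauchy-Schwarz bounds the inner integral uniformly in `z`, and the annulus has volume `≲
2^(ld)`. The opposite weights `±(s₁ - s₂)/2` balance the two factors, so that both series acquire
the rate `s₁ + s₂` required by `exists_tsum_high_le`. -/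
theorem lintegral_far_le (s₁ s₂ : ℝ) :
    ∃ C : ℝ≥0∞, C ≠ ⊤ ∧ ∀ F G : Eu d → ℝ≥0∞, Measurable F → Measurable G → ∀ l : ℤ,
    ((2 : ℝ≥0∞) ^ l) ^ (2 * (s₁ + s₂ - d / 2)) *
      ∫⁻ z in annulus l,
        (∫⁻ y, {x : Eu d | 2 ^ l ≤ ‖x‖ₑ}.indicator (fun x => ‖x‖ₑ ^ ((s₁ - s₂) / 2) * F x) (z - y) *
        {x : Eu d | 2 ^ l ≤ ‖x‖ₑ}.indicator (fun x => ‖x‖ₑ ^ ((s₂ - s₁) / 2) * G x) y) ^ 2 ≤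
    C * ((((2 : ℝ≥0∞) ^ l) ^ (s₁ + s₂) *
        ∫⁻ x, {x : Eu d | 2 ^ l ≤ ‖x‖ₑ}.indicator
          (fun x => ‖x‖ₑ ^ (2 * s₁ - (s₁ + s₂)) * F x ^ 2) x) *
      (((2 : ℝ≥0∞) ^ l) ^ (s₁ + s₂) *
        ∫⁻ x, {x : Eu d | 2 ^ l ≤ ‖x‖ₑ}.indicator
          (fun x => ‖x‖ₑ ^ (2 * s₂ - (s₁ + s₂)) * G x ^ 2) x)) := by
  obtain ⟨C, hC, h⟩ := exists_volume_ball_le (d := d)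
  refine ⟨C * (2 ^ (2 : ℤ)) ^ (d : ℝ), by finiteness, fun F G hF hG l => ?_⟩
  have hsq : ∀ (p : ℝ) (H : Eu d → ℝ≥0∞) (x : Eu d),
      ({x : Eu d | 2 ^ l ≤ ‖x‖ₑ}.indicator (fun x => ‖x‖ₑ ^ (p / 2) * H x) x) ^ 2 =
      {x : Eu d | 2 ^ l ≤ ‖x‖ₑ}.indicator (fun x => ‖x‖ₑ ^ p * H x ^ 2) x := fun p H x => by
    by_cases hx : 2 ^ l ≤ ‖x‖ₑ <;> simp [Set.indicator, hx, mul_pow, sq_rpow_half]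
  have hm : ∀ (p : ℝ) (H : Eu d → ℝ≥0∞), Measurable H → Measurable
      ({x : Eu d | 2 ^ l ≤ ‖x‖ₑ}.indicator (fun x => ‖x‖ₑ ^ p * H x)) := fun p H hH =>
    Measurable.indicator (by fun_prop) (measurableSet_le_enorm _)
  have e1 : 2 * s₁ - (s₁ + s₂) = s₁ - s₂ := by ring
  have e2 : 2 * s₂ - (s₁ + s₂) = s₂ - s₁ := by ring
  rw [e1, e2]
  have ht0 := two_zpow_ne_zero l
  have htt := two_zpow_ne_top l
  set X := ∫⁻ x, {x : Eu d | 2 ^ l ≤ ‖x‖ₑ}.indicator (fun x => ‖x‖ₑ ^ (s₁ - s₂) * F x ^ 2) x with hX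
  set Y := ∫⁻ x, {x : Eu d | 2 ^ l ≤ ‖x‖ₑ}.indicator (fun x => ‖x‖ₑ ^ (s₂ - s₁) * G x ^ 2) x with hY
  have ht : ((2 : ℝ≥0∞) ^ l) ^ (2 * (s₁ + s₂ - d / 2)) * ((2 : ℝ≥0∞) ^ l) ^ (d : ℝ) =
      ((2 : ℝ≥0∞) ^ l) ^ (s₁ + s₂) * ((2 : ℝ≥0∞) ^ l) ^ (s₁ + s₂) := by
    rw [← ENNReal.rpow_add _ _ ht0 htt, ← ENNReal.rpow_add _ _ ht0 htt]
    congr 1; ring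
  calc _ ≤ ((2 : ℝ≥0∞) ^ l) ^ (2 * (s₁ + s₂ - d / 2)) * ∫⁻ z in annulus (d := d) l, X * Y := by
        gcongr with z
        refine (sq_conv_le (hm _ F hF) (hm _ G hG) z).trans (le_of_eq ?_)
        simp only [hsq]
        rfl
    _ ≤ ((2 : ℝ≥0∞) ^ l) ^ (2 * (s₁ + s₂ - d / 2)) *
          (X * Y * (C * ((2 : ℝ≥0∞) ^ (l + 2)) ^ (d : ℝ))) := by
        rw [setLIntegral_const]
        gcongr
        exact (measure_mono fun x hx => hx.2).trans (h _ (two_zpow_ne_top _))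
    _ = C * (2 ^ (2 : ℤ)) ^ (d : ℝ) * (((2 : ℝ≥0∞) ^ l) ^ (2 * (s₁ + s₂ - d / 2)) *
          ((2 : ℝ≥0∞) ^ l) ^ (d : ℝ)) * (X * Y) := by
        rw [two_zpow_add, ENNReal.mul_rpow_of_nonneg _ _ (by positivity)]; ring
    _ = _ := by rw [ht]; ring

theorem paraConv_le (s₁ s₂ : ℝ) (F G : Eu d → ℝ≥0∞) (hF : Measurable F) (hG : Measurable G) (l : ℤ)
    {z : Eu d} (hz : z ∈ annulus l) :
    paraConv F G z ≤ (∫⁻ y, {x : Eu d | ‖x‖ₑ ≤ 2 ^ (l + 6)}.indicator F (z - y) *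
        {x : Eu d | 2 ^ l ≤ 16 * ‖x‖ₑ ∧ ‖x‖ₑ ≤ 2 ^ (l + 3)}.indicator G y) +
      8 ^ |(s₂ - s₁) / 2| *
        ∫⁻ y, {x : Eu d | 2 ^ l ≤ ‖x‖ₑ}.indicator (fun x => ‖x‖ₑ ^ ((s₁ - s₂) / 2) * F x) (z - y) *
          {x : Eu d | 2 ^ l ≤ ‖x‖ₑ}.indicator (fun x => ‖x‖ₑ ^ ((s₂ - s₁) / 2) * G x) y := by
  have hms : MeasurableSet {x : Eu d | (2 : ℝ≥0∞) ^ l ≤ 16 * ‖x‖ₑ ∧ ‖x‖ₑ ≤ 2 ^ (l + 3)} :=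
    measurableSet_near l
  have hm1 := (hF.indicator (measurableSet_enorm_le (d := d) (2 ^ (l + 6))))
  have hm2 := hG.indicator hms
  have hm : ∀ (p : ℝ) (H : Eu d → ℝ≥0∞), Measurable H → Measurable
      ({x : Eu d | 2 ^ l ≤ ‖x‖ₑ}.indicator (fun x => ‖x‖ₑ ^ p * H x)) := fun p H hH =>
    Measurable.indicator (by fun_prop) (measurableSet_le_enorm _)
  have hm3 := hm ((s₁ - s₂) / 2) F hF
  have hm4 := hm ((s₂ - s₁) / 2) G hG
  rw [← lintegral_const_mul _ (by fun_prop), ← lintegral_add_left (by fun_prop)]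
  refine lintegral_mono fun y => ?_
  obtain ⟨hz1, hz2⟩ := hz
  by_cases h8 : ‖z - y‖ₑ ≤ 8 * ‖y‖ₑ
  swap
  · simp [h8]
  rw [if_pos h8]
  have hzy : ‖z‖ₑ ≤ ‖z - y‖ₑ + ‖y‖ₑ := by
    simpa using enorm_add_le (z - y) y
  have hyz : ‖y‖ₑ ≤ ‖z‖ₑ + ‖z - y‖ₑ := by
    have := enorm_sub_le (a := z) (b := z - y)
    simpa using this
  have p6 : (2 : ℝ≥0∞) ^ (l + 6) = 64 * 2 ^ l := by
    rw [two_zpow_add, mul_comm]; congr 1; rw [← ENNReal.rpow_intCast]; norm_num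
  have p3 : (2 : ℝ≥0∞) ^ (l + 3) = 8 * 2 ^ l := by
    rw [two_zpow_add, mul_comm]; congr 1; rw [← ENNReal.rpow_intCast]; norm_num
  have p2 : (2 : ℝ≥0∞) ^ (l + 2) = 4 * 2 ^ l := by
    rw [two_zpow_add, mul_comm]; congr 1; rw [← ENNReal.rpow_intCast]; norm_num
  rw [p2] at hz2
  have htt := two_zpow_ne_top l
  have htp := two_zpow_ne_zero l
  -- Pass to real numbers for the linear comparisons.
  generalize hT : (2 : ℝ≥0∞) ^ l = T at *
  have hxr : ‖z - y‖ₑ ≠ ⊤ := enorm_ne_top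
  have hyr : ‖y‖ₑ ≠ ⊤ := enorm_ne_top
  have hzr : ‖z‖ₑ ≠ ⊤ := enorm_ne_top
  -- The near case has `|z - y| ≤ 8|y| ≤ 8·2·4·2^l = 2^(l+6)`, while `2^l ≤ |z| ≤ 9|y|` gives the
  -- lower bound on `|y|`.
  by_cases hcase : ‖y‖ₑ ≤ 2 * ‖z‖ₑ
  · refine le_add_right ?_
    have a1 : ‖z - y‖ₑ ≤ 2 ^ (l + 6) := by
      rw [p6]
      calc _ ≤ 8 * (2 * (4 * T)) := h8.trans (by gcongr; exact hcase.trans (by gcongr))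
        _ = _ := by ring
    have a2 : ‖y‖ₑ ≤ 2 ^ (l + 3) := by
      rw [p3]
      calc _ ≤ 2 * (4 * T) := hcase.trans (by gcongr)
        _ = _ := by ring
    have a3 : T ≤ 16 * ‖y‖ₑ := by
      calc T ≤ 8 * ‖y‖ₑ + ‖y‖ₑ := hz1.trans (hzy.trans (by gcongr))
        _ = 9 * ‖y‖ₑ := by ring
        _ ≤ _ := by gcongr; norm_num
    rw [Set.indicator_of_mem (show z - y ∈ {x : Eu d | ‖x‖ₑ ≤ 2 ^ (l + 6)} from a1),
      Set.indicator_of_mem (show y ∈ {x : Eu d | T ≤ 16 * ‖x‖ₑ ∧ ‖x‖ₑ ≤ 2 ^ (l + 3)} from ⟨a3, a2⟩)]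
  · push Not at hcase
    refine le_add_left ?_
    -- From `|y| > 2|z|` one gets `|z - y| ≥ |y| - |z| > |y|/2 > |z| ≥ 2^l`; the two frequencies are
    -- then comparable and weights can be moved between them.
    have b0 : ‖y‖ₑ ≤ 2 * ‖z - y‖ₑ ∧ T ≤ ‖z - y‖ₑ ∧ T ≤ ‖y‖ₑ := by
      lift T to ℝ≥0 using htt
      generalize ‖z - y‖ₑ = x at *
      generalize ‖y‖ₑ = y' at *
      generalize ‖z‖ₑ = z' at *
      lift x to ℝ≥0 using hxr
      lift y' to ℝ≥0 using hyr
      lift z' to ℝ≥0 using hzr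
      norm_cast at *
      have q1 : (T : ℝ) ≤ z' := hz1
      have q2 : (y' : ℝ) ≤ z' + x := hyz
      have q3 : 2 * (z' : ℝ) < y' := hcase
      refine ⟨?_, ?_, ?_⟩ <;> rw [← NNReal.coe_le_coe] <;> push_cast <;>
        linarith [T.2, x.2, y'.2, z'.2]
    have hx0 : ‖z - y‖ₑ ≠ 0 := (lt_of_lt_of_le (pos_iff_ne_zero.2 htp) b0.2.1).ne'
    rw [Set.indicator_of_mem (show z - y ∈ {x : Eu d | T ≤ ‖x‖ₑ} from b0.2.1),
      Set.indicator_of_mem (show y ∈ {x : Eu d | T ≤ ‖x‖ₑ} from b0.2.2)]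
    have hcmp := rpow_le_of_comparable h8 (b0.1.trans (by gcongr; norm_num))
      (by norm_num) (by norm_num) ((s₂ - s₁) / 2)
    calc F (z - y) * G y = (‖z - y‖ₑ ^ ((s₁ - s₂) / 2) * ‖z - y‖ₑ ^ ((s₂ - s₁) / 2)) *
          (F (z - y) * G y) := by
          rw [show (s₂ - s₁) / 2 = -((s₁ - s₂) / 2) by ring, rpow_mul_rpow_neg hx0 hxr, one_mul]
      _ ≤ (‖z - y‖ₑ ^ ((s₁ - s₂) / 2) * (8 ^ |(s₂ - s₁) / 2| * ‖y‖ₑ ^ ((s₂ - s₁) / 2))) *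
          (F (z - y) * G y) := by gcongr
      _ = _ := by ring

theorem measurable_conv {F G : Eu d → ℝ≥0∞} (hF : Measurable F) (hG : Measurable G) :
    Measurable fun z => ∫⁻ y, F (z - y) * G y := by
  have : Measurable fun p : Eu d × Eu d => F (p.1 - p.2) * G p.2 := by fun_prop
  exact this.lintegral_prod_right'

theorem measurable_paraConv {F G : Eu d → ℝ≥0∞} (hF : Measurable F) (hG : Measurable G) :
    Measurable (paraConv F G) := by
  have : Measurable fun p : Eu d × Eu d =>
      if ‖p.1 - p.2‖ₑ ≤ 8 * ‖p.2‖ₑ then F (p.1 - p.2) * G p.2 else 0 :=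
    Measurable.ite (measurableSet_le (by fun_prop) (by fun_prop)) (by fun_prop) (by fun_prop)
  exact this.lintegral_prod_right'

theorem tsum_sqrt_le {ι : Type*} {t A a b : ι → ℝ≥0∞} {σ : ℝ} {C A' B' : ℝ≥0∞}
    (h : ∀ i, t i ^ (2 * σ) * A i ≤ C * (a i * b i)) (ha : ∑' i, a i ≤ A') (hb : ∑' i, b i ≤ B') :
    ∑' i, t i ^ σ * A i ^ (1 / 2 : ℝ) ≤ (C * A' * B') ^ (1 / 2 : ℝ) := by
  have hs : ∀ x : ℝ≥0∞, (x ^ 2) ^ (1 / 2 : ℝ) = x := fun x => by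
    rw [← ENNReal.rpow_natCast, ← ENNReal.rpow_mul]; simp
  have key := tsum_le_of_sq_le_mul (T := fun i => t i ^ σ * A i ^ (1 / 2 : ℝ))
    (a := fun i => C * a i) (b := b) (fun i => by
      rw [mul_pow, ← ENNReal.rpow_natCast, ← ENNReal.rpow_natCast, ← ENNReal.rpow_mul,
        ← ENNReal.rpow_mul, mul_assoc]
      refine le_trans (le_of_eq ?_) (h i)
      congr 1
      · congr 1; push_cast; ring
      · norm_num)
  rw [ENNReal.tsum_mul_left] at key
  rw [← hs (∑' i, t i ^ σ * A i ^ (1 / 2 : ℝ))]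
  refine ENNReal.rpow_le_rpow (key.trans (by gcongr)) (by norm_num)

/-- The dyadic `ℓ^1(L^2)` estimate for the part of a convolution in which the second frequency
dominates. -/
theorem exists_tsum_paraConv_le (hd : 1 ≤ d) {s₁ s₂ : ℝ} (h₁ : s₁ < (d : ℝ) / 2)
    (h₁₂ : 0 < s₁ + s₂) : ∃ C : ℝ≥0∞, C ≠ ⊤ ∧ ∀ F G : Eu d → ℝ≥0∞, Measurable F → Measurable G →
    ∑' l : ℤ, ((2 : ℝ≥0∞) ^ l) ^ (s₁ + s₂ - d / 2) *
        (∫⁻ z in annulus l, paraConv F G z ^ 2) ^ (1 / 2 : ℝ) ≤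
      C * ((∫⁻ x, ‖x‖ₑ ^ (2 * s₁) * F x ^ 2) ^ (1 / 2 : ℝ) *
        (∫⁻ x, ‖x‖ₑ ^ (2 * s₂) * G x ^ 2) ^ (1 / 2 : ℝ)) := by
  obtain ⟨C₁, hC₁, h1⟩ := lintegral_near_le (d := d) hd s₂ h₁
  obtain ⟨C₂, hC₂, h2⟩ := lintegral_far_le (d := d) s₁ s₂
  obtain ⟨C₃, hC₃, h3⟩ := exists_tsum_low_le (d := d) hd (δ := d / 2 - s₁) (by linarith) (2 * s₁)
  obtain ⟨C₄, hC₄, h4⟩ := exists_tsum_low_le (d := d) hd (δ := 1) (by norm_num) (2 * s₂)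
  obtain ⟨C₅, hC₅, h5⟩ := exists_tsum_high_le (d := d) hd h₁₂ (2 * s₁)
  obtain ⟨C₆, hC₆, h6⟩ := exists_tsum_high_le (d := d) hd h₁₂ (2 * s₂)
  refine ⟨(C₁ * C₃ * C₄) ^ (1 / 2 : ℝ) + 8 ^ |(s₂ - s₁) / 2| * (C₂ * C₅ * C₆) ^ (1 / 2 : ℝ),
    by finiteness, fun F G hF hG => ?_⟩
  set X := ∫⁻ x, ‖x‖ₑ ^ (2 * s₁) * F x ^ 2
  set Y := ∫⁻ x, ‖x‖ₑ ^ (2 * s₂) * G x ^ 2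
  have near := tsum_sqrt_le (h1 F G hF hG) (h3 6 (fun x => F x ^ 2) (by fun_prop))
    (h4 3 (fun x => G x ^ 2) (by fun_prop))
  have far := tsum_sqrt_le (h2 F G hF hG) (h5 (fun x => F x ^ 2) (by fun_prop))
    (h6 (fun x => G x ^ 2) (by fun_prop))
  set N : ℤ → Eu d → ℝ≥0∞ := fun l z => ∫⁻ y, {x : Eu d | ‖x‖ₑ ≤ 2 ^ (l + 6)}.indicator F (z - y) *
        {x : Eu d | 2 ^ l ≤ 16 * ‖x‖ₑ ∧ ‖x‖ₑ ≤ 2 ^ (l + 3)}.indicator G y with hN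
  set R : ℤ → Eu d → ℝ≥0∞ := fun l z =>
    ∫⁻ y, {x : Eu d | 2 ^ l ≤ ‖x‖ₑ}.indicator (fun x => ‖x‖ₑ ^ ((s₁ - s₂) / 2) * F x) (z - y) *
          {x : Eu d | 2 ^ l ≤ ‖x‖ₑ}.indicator (fun x => ‖x‖ₑ ^ ((s₂ - s₁) / 2) * G x) y with hR
  have hNm : ∀ l, Measurable (N l) := fun l =>
    measurable_conv (hF.indicator (measurableSet_enorm_le _)) (hG.indicator (measurableSet_near l))
  have hRm : ∀ l, Measurable (R l) := fun l =>
    measurable_conv (Measurable.indicator (by fun_prop) (measurableSet_le_enorm _))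
      (Measurable.indicator (by fun_prop) (measurableSet_le_enorm _))
  set κ : ℝ≥0∞ := 8 ^ |(s₂ - s₁) / 2|
  have hκ : κ ≠ ⊤ := by finiteness
  have key : ∀ l, (∫⁻ z in annulus l, paraConv F G z ^ 2) ^ (1 / 2 : ℝ) ≤
      (∫⁻ z, N l z ^ 2) ^ (1 / 2 : ℝ) + κ * (∫⁻ z in annulus l, R l z ^ 2) ^ (1 / 2 : ℝ) := by
    intro l
    calc (∫⁻ z in annulus l, paraConv F G z ^ 2) ^ (1 / 2 : ℝ)
        ≤ (∫⁻ z in annulus l, (N l z + κ * R l z) ^ 2) ^ (1 / 2 : ℝ) := by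
          refine ENNReal.rpow_le_rpow ?_ (by norm_num)
          refine setLIntegral_mono' (measurableSet_annulus l) fun z hz => ?_
          exact pow_le_pow_left' (paraConv_le s₁ s₂ F G hF hG l hz) 2
      _ ≤ (∫⁻ z in annulus l, N l z ^ 2) ^ (1 / 2 : ℝ) +
          (∫⁻ z in annulus l, (κ * R l z) ^ 2) ^ (1 / 2 : ℝ) := by
          have := ENNReal.lintegral_Lp_add_le (μ := volume.restrict (annulus l)) (p := 2)
            (f := N l) (g := fun z => κ * R l z) (hNm l).aemeasurable
            ((hRm l).const_mul _).aemeasurable (by norm_num)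
          simpa only [ENNReal.rpow_two, Pi.add_apply] using this
      _ ≤ _ := by
          gcongr
          · exact Measure.restrict_le_self
          · simp only [mul_pow]
            rw [lintegral_const_mul _ ((hRm l).pow_const 2),
              ENNReal.mul_rpow_of_nonneg _ _ (by norm_num), ← ENNReal.rpow_natCast κ,
              ← ENNReal.rpow_mul]
            simp
  calc _ ≤ ∑' l : ℤ, (((2 : ℝ≥0∞) ^ l) ^ (s₁ + s₂ - d / 2) * (∫⁻ z, N l z ^ 2) ^ (1 / 2 : ℝ) +
        κ * (((2 : ℝ≥0∞) ^ l) ^ (s₁ + s₂ - d / 2) *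
          (∫⁻ z in annulus l, R l z ^ 2) ^ (1 / 2 : ℝ))) := by
        refine ENNReal.tsum_le_tsum fun l => ?_
        refine (mul_le_mul_right (key l) _).trans (le_of_eq ?_)
        ring
    _ ≤ (C₁ * (C₃ * X) * (C₄ * Y)) ^ (1 / 2 : ℝ) + κ * (C₂ * (C₅ * X) * (C₆ * Y)) ^ (1 / 2 : ℝ) := by
        rw [ENNReal.tsum_add, ENNReal.tsum_mul_left]
        gcongr
    _ = _ := by
        rw [show C₁ * (C₃ * X) * (C₄ * Y) = (C₁ * C₃ * C₄) * (X * Y) by ring,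
          show C₂ * (C₅ * X) * (C₆ * Y) = (C₂ * C₅ * C₆) * (X * Y) by ring,
          ENNReal.mul_rpow_of_nonneg _ _ (by norm_num : (0 : ℝ) ≤ 1 / 2),
          ENNReal.mul_rpow_of_nonneg (C₂ * C₅ * C₆) _ (by norm_num : (0 : ℝ) ≤ 1 / 2),
          ENNReal.mul_rpow_of_nonneg X _ (by norm_num : (0 : ℝ) ≤ 1 / 2)]
        ring

/-! ### Distributions given by functions -/

theorem IsGivenBy.ae_eq {T : 𝓢'(Eu d, ℂ)} {g g' : Eu d → ℂ} (h : IsGivenBy T g)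
    (h' : IsGivenBy T g') : g =ᵐ[volume] g' := by
  refine ae_eq_of_integral_contDiff_smul_eq h.1 h'.1 fun φ hφ hc => ?_
  have hc' : HasCompactSupport fun x => (φ x : ℂ) := hc.comp_left (g := Complex.ofReal) rfl
  have hφ' : ContDiff ℝ ∞ fun x => (φ x : ℂ) := Complex.ofRealCLM.contDiff.comp hφ
  have e1 := (h.2 (hc'.toSchwartzMap hφ')).2
  have e2 := (h'.2 (hc'.toSchwartzMap hφ')).2
  simpa [Complex.real_smul] using e1.symm.trans e2

theorem IsGivenBy.congr {T : 𝓢'(Eu d, ℂ)} {g g' : Eu d → ℂ} (h : IsGivenBy T g)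
    (hg : g =ᵐ[volume] g') : IsGivenBy T g' := by
  refine ⟨h.1.congr hg, fun ψ => ?_⟩
  have e : (fun x => ψ x * g x) =ᵐ[volume] fun x => ψ x * g' x := by
    filter_upwards [hg] with x hx; rw [hx]
  exact ⟨(h.2 ψ).1.congr e, (h.2 ψ).2.trans (integral_congr_ae e)⟩

theorem IsGivenBy.eq_of {T T' : 𝓢'(Eu d, ℂ)} {g : Eu d → ℂ} (h : IsGivenBy T g)
    (h' : IsGivenBy T' g) : T = T' := by
  ext ψ
  rw [(h.2 ψ).2, (h'.2 ψ).2]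

theorem sobolevNorm_eq {f : 𝓢'(Eu d, ℂ)} {g : Eu d → ℂ} (h : IsGivenBy (𝓕 f) g) (s : ℝ) :
    sobolevNorm s f = eLpNorm (fun ξ => ((‖ξ‖ ^ s : ℝ) : ℂ) * g ξ) 2 volume := by
  refine le_antisymm (iInf₂_le g h) (le_iInf₂ fun g' h' => le_of_eq ?_)
  refine eLpNorm_congr_ae ?_
  filter_upwards [h.ae_eq h'] with x hx
  rw [hx]

theorem IsGivenBy.add {T T' : 𝓢'(Eu d, ℂ)} {g g' : Eu d → ℂ} (h : IsGivenBy T g)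
    (h' : IsGivenBy T' g') : IsGivenBy (T + T') (fun x => g x + g' x) := by
  refine ⟨h.1.add h'.1, fun ψ => ⟨?_, ?_⟩⟩
  · simp only [mul_add]; exact (h.2 ψ).1.add (h'.2 ψ).1
  · simp only [mul_add]
    rw [integral_add (h.2 ψ).1 (h'.2 ψ).1, ← (h.2 ψ).2, ← (h'.2 ψ).2]
    rfl

theorem IsGivenBy.smulLeft {T : 𝓢'(Eu d, ℂ)} {g h : Eu d → ℂ} (hT : IsGivenBy T g)
    (hh : h.HasTemperateGrowth) : IsGivenBy (smulLeftCLM ℂ h T) (fun x => h x * g x) := by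
  refine ⟨?_, fun ψ => ?_⟩
  · have := hT.1.locallyIntegrableOn Set.univ
    have h2 := this.continuousOn_mul hh.1.continuous.continuousOn isOpen_univ.isLocallyClosed
    exact locallyIntegrableOn_univ.1 h2
  · have h1 := hT.2 (SchwartzMap.smulLeftCLM ℂ h ψ)
    have e : (fun x => SchwartzMap.smulLeftCLM ℂ h ψ x * g x) = fun x => ψ x * (h x * g x) := by
      ext x; rw [SchwartzMap.smulLeftCLM_apply hh]; simp; ring
    rw [e] at h1
    exact ⟨h1.1, by rw [smulLeftCLM_apply_apply]; exact h1.2⟩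

theorem fourier_fourierMultiplier (h : Eu d → ℂ) (f : 𝓢'(Eu d, ℂ)) :
    𝓕 (fourierMultiplierCLM ℂ h f) = smulLeftCLM ℂ h (𝓕 f) := by
  rw [fourierMultiplierCLM_apply, fourier_fourierInv_eq]

theorem IsGivenBy.fourierMultiplier {f : 𝓢'(Eu d, ℂ)} {g h : Eu d → ℂ} (hf : IsGivenBy (𝓕 f) g)
    (hh : h.HasTemperateGrowth) :
    IsGivenBy (𝓕 (fourierMultiplierCLM ℂ h f)) (fun x => h x * g x) := by
  rw [fourier_fourierMultiplier]
  exact hf.smulLeft hh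

/-! ### Functions of moderate growth -/

/-- `g` is integrable against some negative power of `1 + |x|^2`. -/
def Moderate (g : Eu d → ℂ) : Prop :=
  ∃ N : ℝ, Integrable (fun x => (((1 + ‖x‖ ^ 2) ^ (-N) : ℝ) : ℂ) * g x) volume

theorem hasTemperateGrowth_japanese (r : ℝ) :
    (fun x : Eu d => (((1 + ‖x‖ ^ 2) ^ r : ℝ) : ℂ)).HasTemperateGrowth :=
  Function.Complex.hasTemperateGrowth_ofReal.comp (Function.hasTemperateGrowth_one_add_norm_sq_rpow (Eu d) r)

theorem isGivenBy_of_integrable {g : Eu d → ℂ} (hg : Integrable g) :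
    IsGivenBy ((memLp_one_iff_integrable.2 hg).toLp g : 𝓢'(Eu d, ℂ)) g := by
  refine ⟨hg.locallyIntegrable, fun ψ => ⟨?_, ?_⟩⟩
  · refine hg.bdd_mul (c := SchwartzMap.seminorm ℂ 0 0 ψ) ψ.continuous.aestronglyMeasurable
      (Eventually.of_forall fun x => ?_)
    exact SchwartzMap.norm_le_seminorm ℂ ψ x
  · rw [Lp.toTemperedDistribution_apply]
    refine integral_congr_ae ?_
    filter_upwards [(memLp_one_iff_integrable.2 hg).coeFn_toLp] with x hx
    rw [hx]; rfl

/-- The weighted function is integrable, hence a tempered distribution, and the inverse weight is a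
smooth multiplier of temperate growth. -/
theorem Moderate.exists_isGivenBy {g : Eu d → ℂ} (hg : Moderate g) :
    ∃ T : 𝓢'(Eu d, ℂ), IsGivenBy T g := by
  obtain ⟨N, hN⟩ := hg
  refine ⟨_, ((isGivenBy_of_integrable hN).smulLeft (hasTemperateGrowth_japanese N)).congr
    (Eventually.of_forall fun x => ?_)⟩
  have h0 : (0 : ℝ) < 1 + ‖x‖ ^ 2 := by positivity
  simp only [← mul_assoc, ← Complex.ofReal_mul, ← Real.rpow_add h0]
  simp

theorem integrable_japanese : Integrable (fun x : Eu d => ((1 + ‖x‖ ^ 2) ^ (-(d + 1 : ℝ)) : ℝ)) := by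
  have := integrable_rpow_neg_one_add_norm_sq (E := Eu d) (μ := volume) (r := 2 * (d + 1)) (by
    simp; linarith)
  simpa [neg_div] using this

theorem moderate_of_bounded {g : Eu d → ℂ} (hg : AEStronglyMeasurable g volume) {M : ℝ}
    (hM : ∀ᵐ x, ‖g x‖ ≤ M) : Moderate g :=
  ⟨d + 1, (integrable_japanese.ofReal (𝕜 := ℂ)).mul_bdd (c := M) hg hM⟩

theorem moderate_of_memLp_two {g : Eu d → ℂ} (hg : MemLp g 2 volume) : Moderate g := by
  refine ⟨(d + 1) / 2, ?_⟩
  have hc := (hasTemperateGrowth_japanese (d := d) (-((d + 1) / 2 : ℝ))).1.continuous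
  have h1 : MemLp (fun x : Eu d => (((1 + ‖x‖ ^ 2) ^ (-((d + 1) / 2 : ℝ)) : ℝ) : ℂ)) 2 volume := by
    rw [memLp_two_iff_integrable_sq_norm hc.aestronglyMeasurable]
    refine integrable_japanese.congr (Eventually.of_forall fun x => ?_)
    have h0 : (0 : ℝ) < 1 + ‖x‖ ^ 2 := by positivity
    simp only [Complex.norm_real, Real.norm_eq_abs, sq_abs]
    rw [← Real.rpow_natCast (_ ^ _) 2, ← Real.rpow_mul h0.le]
    congr 1; push_cast; ring
  exact h1.integrable_mul hg

/-! ### Fourier inversion -/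

theorem integral_fourierInv_mul_eq {A h : Eu d → ℂ} (hA : Integrable A) (hh : Integrable h) :
    ∫ x, 𝓕⁻ A x * h x = ∫ x, A x * 𝓕⁻ h x := by
  -- The inverse transform is the Fourier integral for the negated inner product, so
  -- self-adjointness comes from the general Fubini identity.
  have key := VectorFourier.integral_fourierIntegral_smul_eq_flip (L := -innerₗ (Eu d))
    (e := Real.fourierChar) (μ := volume) (ν := volume) Real.continuous_fourierChar
    (continuous_inner.neg) hA hh
  have e1 : ∀ f : Eu d → ℂ, VectorFourier.fourierIntegral Real.fourierChar volume
      (-innerₗ (Eu d)) f = 𝓕⁻ f := fun f => by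
    ext w
    simp [VectorFourier.fourierIntegral, Real.fourierInv_eq]
  have e2 : (-innerₗ (Eu d)).flip = -innerₗ (Eu d) := by
    ext v w
    simp [real_inner_comm]
  rw [e2, e1, e1] at key
  simpa using key

theorem continuous_fourierInv {A : Eu d → ℂ} (hA : Integrable A) : Continuous (𝓕⁻ A) := by
  have := VectorFourier.fourierIntegral_continuous (L := innerₗ (Eu d)) (μ := volume)
    Real.continuous_fourierChar continuous_inner hA
  rw [funext (Real.fourierInv_eq_fourier_neg A)]
  exact this.comp continuous_neg

theorem norm_fourierInv_le (A : Eu d → ℂ) (x : Eu d) : ‖𝓕⁻ A x‖ ≤ ∫ ξ, ‖A ξ‖ := by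
  rw [Real.fourierInv_eq]
  refine (norm_integral_le_integral_norm _).trans (le_of_eq ?_)
  simp [Circle.norm_smul]

theorem moderate_fourierInv {A : Eu d → ℂ} (hA : Integrable A) : Moderate (𝓕⁻ A) :=
  moderate_of_bounded (continuous_fourierInv hA).aestronglyMeasurable
    (Eventually.of_forall (norm_fourierInv_le A))

theorem isGivenBy_fourierInv {a : 𝓢'(Eu d, ℂ)} {A : Eu d → ℂ} (ha : IsGivenBy (𝓕 a) A)
    (hA : Integrable A) : IsGivenBy a (𝓕⁻ A) := by
  obtain ⟨T, hT⟩ := (moderate_fourierInv hA).exists_isGivenBy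
  convert hT
  ext ψ
  have h1 : a ψ = 𝓕 a (𝓕⁻ ψ) := by
    rw [TemperedDistribution.fourier_apply, fourier_fourierInv_eq]
  rw [h1, (ha.2 _).2, (hT.2 ψ).2]
  have := integral_fourierInv_mul_eq hA (ψ.integrable (μ := volume))
  simp only [mul_comm (ψ _), this, SchwartzMap.fourierInv_coe]
  simp only [mul_comm]

/-! ### Plancherel -/

theorem isGivenBy_Lp {p : ℝ≥0∞} [Fact (1 ≤ p)] (u : Lp ℂ p (volume : Measure (Eu d))) :
    IsGivenBy (u : 𝓢'(Eu d, ℂ)) u := by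
  refine ⟨(Lp.memLp u).locallyIntegrable Fact.out, fun ψ => ⟨?_, ?_⟩⟩
  · have := ENNReal.HolderConjugate.inv_one_sub_inv' (Fact.out : (1 : ℝ≥0∞) ≤ p)
    exact MemLp.integrable_mul (p := (1 - p⁻¹)⁻¹) (q := p) (ψ.memLp _ volume) (Lp.memLp u)
  · rw [Lp.toTemperedDistribution_apply]; rfl

theorem l2Norm_le {f : 𝓢'(Eu d, ℂ)} {g : Eu d → ℂ} (hf : IsGivenBy (𝓕 f) g)
    (hg : MemLp g 2 volume) : l2Norm f ≤ eLpNorm g 2 volume := by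
  have h1 : (hg.toLp g : 𝓢'(Eu d, ℂ)) = 𝓕 f :=
    ((isGivenBy_Lp _).congr hg.coeFn_toLp).eq_of hf
  have h2 : ((𝓕⁻ (hg.toLp g) : Lp ℂ 2 (volume : Measure (Eu d))) : 𝓢'(Eu d, ℂ)) = f := by
    rw [← Lp.fourierInv_toTemperedDistribution_eq, h1, fourierInv_fourier_eq]
  refine le_trans (b := ‖(𝓕⁻ (hg.toLp g) : Lp ℂ 2 (volume : Measure (Eu d)))‖ₑ)
    (iInf₂_le (f := fun (u : Lp ℂ 2 (volume : Measure (Eu d))) (_ : (u : 𝓢'(Eu d, ℂ)) = f) => ‖u‖ₑ)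
      _ h2) (le_of_eq ?_)
  have h3 : ‖(𝓕⁻ (hg.toLp g) : Lp ℂ 2 (volume : Measure (Eu d)))‖ = ‖hg.toLp g‖ := by
    rw [← Lp.norm_fourier_eq, fourier_fourierInv_eq]
  rw [enorm_eq_iff_norm_eq.2 h3, Lp.enorm_toLp]

/-- The integral against a square integrable function, in Fourier variables. -/
theorem integral_Lp_fourierInv_mul (u v : Lp ℂ 2 (volume : Measure (Eu d))) :
    ∫ x, (𝓕⁻ u : Lp ℂ 2 (volume : Measure (Eu d))) x * v x =
      ∫ x, u x * (𝓕⁻ v : Lp ℂ 2 (volume : Measure (Eu d))) x := by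
  have hpair : ∀ u v : Lp ℂ 2 (volume : Measure (Eu d)),
      ∫ x, u x * v x = (ContinuousLinearMap.mul ℂ ℂ).lpPairing volume 2 2 u v := fun u v => by
    rw [ContinuousLinearMap.lpPairing_eq_integral]; rfl
  rw [hpair, hpair]
  -- Both sides are continuous in `v`, so `v` may be taken Schwartz; the identity is then the
  -- definition of the inverse transform of the tempered distribution `u`.
  refine DenseRange.induction_on (SchwartzMap.denseRange_toLpCLM (p := 2) (F := ℂ)
    ENNReal.ofNat_ne_top) v (isClosed_eq ?_ ?_) fun φ => ?_
  · exact ContinuousLinearMap.continuous _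
  · exact (ContinuousLinearMap.continuous _).comp (ContinuousFourierInv.continuous_fourierInv)
  · rw [SchwartzMap.toLpCLM_apply, SchwartzMap.toLp_fourierInv_eq, ← hpair, ← hpair]
    have e := congrArg (fun T : 𝓢'(Eu d, ℂ) => T φ) (Lp.fourierInv_toTemperedDistribution_eq u)
    simp only [TemperedDistribution.fourierInv_apply, Lp.toTemperedDistribution_apply] at e
    refine Eq.trans ?_ (e.symm.trans ?_)
    · refine integral_congr_ae ?_
      filter_upwards [φ.coeFn_toLp 2 volume] with x hx
      rw [hx, smul_eq_mul, mul_comm]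
    · refine integral_congr_ae ?_
      filter_upwards [(𝓕⁻ φ).coeFn_toLp 2 volume] with x hx
      rw [hx, smul_eq_mul, mul_comm]

/-! ### Products and convolutions -/

/-- The `L^2` extension and the integral formula represent the same tempered distribution. -/
theorem fourierInv_toLp_ae_eq {h : Eu d → ℂ} (h1 : Integrable h) (h2 : MemLp h 2 volume) :
    (𝓕⁻ (h2.toLp h) : Lp ℂ 2 (volume : Measure (Eu d))) =ᵐ[volume] 𝓕⁻ h := by
  have e1 : IsGivenBy (𝓕 (𝓕⁻ (h2.toLp h : 𝓢'(Eu d, ℂ)))) h := by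
    rw [fourier_fourierInv_eq]
    exact (isGivenBy_Lp _).congr h2.coeFn_toLp
  have e2 := isGivenBy_fourierInv e1 h1
  rw [Lp.fourierInv_toTemperedDistribution_eq] at e2
  exact (isGivenBy_Lp _).ae_eq e2

theorem integral_Lp_fourierInv_mul_eq {A h : Eu d → ℂ} (hA : MemLp A 2 volume) (h1 : Integrable h)
    (h2 : MemLp h 2 volume) :
    ∫ x, (𝓕⁻ (hA.toLp A) : Lp ℂ 2 (volume : Measure (Eu d))) x * h x = ∫ x, A x * 𝓕⁻ h x := by
  have key := integral_Lp_fourierInv_mul (hA.toLp A) (h2.toLp h)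
  refine Eq.trans (integral_congr_ae ?_) (key.trans (integral_congr_ae ?_))
  · filter_upwards [h2.coeFn_toLp] with x hx; rw [hx]
  · filter_upwards [hA.coeFn_toLp, fourierInv_toLp_ae_eq h1 h2] with x hx hx'; rw [hx, hx']

/-- `∫ f h = ∫ A 𝓕⁻ h` for `h` in `L^1 ∩ L^2`, which says that `f` is the inverse Fourier
transform of `A`. -/
def IsInverseTransform (f A : Eu d → ℂ) : Prop :=
  ∀ h : Eu d → ℂ, Integrable h → MemLp h 2 volume →
    Integrable (fun x => f x * h x) ∧ Integrable (fun x => A x * 𝓕⁻ h x) ∧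
    ∫ x, f x * h x = ∫ x, A x * 𝓕⁻ h x

theorem isInverseTransform_of_integrable {A : Eu d → ℂ} (hA : Integrable A) :
    IsInverseTransform (𝓕⁻ A) A := fun h h1 _ =>
  ⟨h1.bdd_mul (continuous_fourierInv hA).aestronglyMeasurable
      (Eventually.of_forall (norm_fourierInv_le A)),
    hA.mul_bdd (continuous_fourierInv h1).aestronglyMeasurable
      (Eventually.of_forall (norm_fourierInv_le h)), integral_fourierInv_mul_eq hA h1⟩

theorem isInverseTransform_of_memLp {A : Eu d → ℂ} (hA : MemLp A 2 volume) :
    IsInverseTransform (𝓕⁻ (hA.toLp A) : Lp ℂ 2 (volume : Measure (Eu d))) A := fun _ h1 h2 =>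
  ⟨(Lp.memLp _).integrable_mul h2,
    hA.integrable_mul ((memLp_congr_ae (fourierInv_toLp_ae_eq h1 h2)).1 (Lp.memLp _)),
    integral_Lp_fourierInv_mul_eq hA h1 h2⟩

theorem IsInverseTransform.add {f f' A A' : Eu d → ℂ} (h : IsInverseTransform f A)
    (h' : IsInverseTransform f' A') :
    IsInverseTransform (fun x => f x + f' x) (fun x => A x + A' x) := fun u h1 h2 => by
  obtain ⟨a1, a2, a3⟩ := h u h1 h2
  obtain ⟨b1, b2, b3⟩ := h' u h1 h2
  simp only [add_mul]
  exact ⟨a1.add b1, a2.add b2, by rw [integral_add a1 b1, integral_add a2 b2, a3, b3]⟩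

theorem fourier_compSubConst (ψ : 𝓢(Eu d, ℂ)) (ξ x : Eu d) :
    𝓕 (ψ.compSubConstCLM ℂ (-ξ)) x = Real.fourierChar (inner ℝ x ξ) • 𝓕 ψ x := by
  rw [SchwartzMap.fourier_coe, SchwartzMap.fourier_coe]
  have := congrFun (VectorFourier.fourierIntegral_comp_add_right (E := ℂ) Real.fourierChar
    (volume : Measure (Eu d)) (innerₗ (Eu d)) ψ ξ) x
  have e : (⇑(ψ.compSubConstCLM ℂ (-ξ)) : Eu d → ℂ) = ⇑ψ ∘ fun v => v + ξ := by
    ext v; simp [SchwartzMap.compSubConstCLM_apply]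
  rw [e]
  refine this.trans ?_
  simp only [innerₗ_apply_apply, real_inner_comm]
  rfl

/-- Translating `ψ` by `ξ` modulates its transform, so pairing `b` with the modulated transform
computes the inverse Fourier integral at `ξ`. -/
theorem fourierInv_mul_fourier {b : 𝓢'(Eu d, ℂ)} {g B : Eu d → ℂ} (hb : IsGivenBy b g)
    (hB : IsGivenBy (𝓕 b) B) (ψ : 𝓢(Eu d, ℂ)) (ξ : Eu d) :
    𝓕⁻ (fun x => g x * 𝓕 ψ x) ξ = ∫ η, ψ (ξ + η) * B η := by
  have h1 : 𝓕 b (ψ.compSubConstCLM ℂ (-ξ)) = b (𝓕 (ψ.compSubConstCLM ℂ (-ξ))) := rfl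
  rw [(hB.2 _).2, (hb.2 _).2] at h1
  rw [Real.fourierInv_eq]
  refine Eq.trans ?_ (h1.symm.trans ?_)
  · refine integral_congr_ae (Eventually.of_forall fun x => ?_)
    simp only [fourier_compSubConst, Circle.smul_def, smul_eq_mul]
    ring
  · simp [SchwartzMap.compSubConstCLM_apply, add_comm]

/-- The bounded factor `g` is absorbed into the test function: `g · 𝓕 ψ` lies in `L^1 ∩ L^2`, the
class on which `IsInverseTransform` moves the transform from `f` to `A`. -/
theorem fourier_product_apply {b T : 𝓢'(Eu d, ℂ)} {f g A B : Eu d → ℂ} (hf : IsInverseTransform f A)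
    (hb : IsGivenBy b g) (hB : IsGivenBy (𝓕 b) B) {M : ℝ} (hM : ∀ᵐ x, ‖g x‖ ≤ M)
    (hT : IsGivenBy T (fun x => f x * g x)) (ψ : 𝓢(Eu d, ℂ)) :
    𝓕 T ψ = ∫ ξ, A ξ * ∫ η, ψ (ξ + η) * B η := by
  have hg : AEStronglyMeasurable g volume := hb.1.aestronglyMeasurable
  have h1 : Integrable (fun x => g x * 𝓕 ψ x) :=
    ((𝓕 ψ).integrable (μ := volume)).bdd_mul hg hM
  have h2 : MemLp (fun x => g x * 𝓕 ψ x) 2 volume := by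
    refine ((𝓕 ψ).memLp 2 volume).of_le_mul (c := M) h1.1 ?_
    filter_upwards [hM] with x hx
    rw [norm_mul]; gcongr
  rw [TemperedDistribution.fourier_apply, (hT.2 _).2]
  refine Eq.trans ?_ ((hf _ h1 h2).2.2.trans ?_)
  · refine integral_congr_ae (Eventually.of_forall fun x => ?_)
    simp only; ring
  · simp only [fourierInv_mul_fourier hb hB]

/-- The convolution of `A` and `B`. -/
def conv (A B : Eu d → ℂ) (z : Eu d) : ℂ := ∫ y, A (z - y) * B y

/-- The convolution of `|A|` and `|B|` is integrable against a power of `1 + |x|^2`. -/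
def TemperedPair (A B : Eu d → ℂ) : Prop :=
  ∃ N : ℝ, ∫⁻ z, ENNReal.ofReal ((1 + ‖z‖ ^ 2) ^ (-N)) * ∫⁻ y, ‖A (z - y)‖ₑ * ‖B y‖ₑ < ⊤

theorem TemperedPair.integrable_weight {A B : Eu d → ℂ} (hA : Measurable A) (hB : Measurable B)
    (h : TemperedPair A B) : ∃ N : ℝ, Integrable (fun p : Eu d × Eu d =>
      (((1 + ‖p.1‖ ^ 2) ^ (-N) : ℝ) : ℂ) * (A (p.1 - p.2) * B p.2)) (volume.prod volume) := by
  obtain ⟨N, hN⟩ := h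
  have hc := (hasTemperateGrowth_japanese (d := d) (-N)).1.continuous.measurable
  refine ⟨N, ?_, ?_⟩
  · exact ((hc.comp measurable_fst).mul (by fun_prop)).aestronglyMeasurable
  · rw [hasFiniteIntegral_iff_enorm, lintegral_prod _ (by
      exact ((hc.comp measurable_fst).mul (by fun_prop)).enorm.aemeasurable)]
    refine lt_of_le_of_lt (lintegral_mono fun z => le_of_eq ?_) hN
    have h0 : (0 : ℝ) ≤ (1 + ‖z‖ ^ 2) ^ (-N) := by positivity
    simp only [enorm_mul]
    rw [lintegral_const_mul _ (by fun_prop)]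
    congr 1
    rw [← ofReal_norm, Complex.norm_real, Real.norm_of_nonneg h0]

theorem TemperedPair.moderate_conv {A B : Eu d → ℂ} (hA : Measurable A) (hB : Measurable B)
    (h : TemperedPair A B) : Moderate (conv A B) := by
  obtain ⟨N, hN⟩ := h.integrable_weight hA hB
  refine ⟨N, hN.integral_prod_left.congr (Eventually.of_forall fun z => ?_)⟩
  simp only [conv]
  rw [integral_const_mul]

theorem TemperedPair.integrable_schwartz {A B : Eu d → ℂ} (hA : Measurable A) (hB : Measurable B)
    (h : TemperedPair A B) (ψ : 𝓢(Eu d, ℂ)) : Integrable (fun p : Eu d × Eu d =>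
      ψ p.1 * (A (p.1 - p.2) * B p.2)) (volume.prod volume) := by
  obtain ⟨N, hN⟩ := h.integrable_weight hA hB
  set φ := SchwartzMap.smulLeftCLM ℂ (fun x : Eu d => (((1 + ‖x‖ ^ 2) ^ N : ℝ) : ℂ)) ψ
  have hφ : ∀ x, φ x = (((1 + ‖x‖ ^ 2) ^ N : ℝ) : ℂ) * ψ x := fun x => by
    simp only [φ, SchwartzMap.smulLeftCLM_apply (hasTemperateGrowth_japanese N), smul_eq_mul]
  have := hN.bdd_mul (f := fun p : Eu d × Eu d => φ p.1) (c := SchwartzMap.seminorm ℂ 0 0 φ)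
    (φ.continuous.comp continuous_fst).aestronglyMeasurable
    (Eventually.of_forall fun p => SchwartzMap.norm_le_seminorm ℂ φ p.1)
  refine this.congr (Eventually.of_forall fun p => ?_)
  have h0 : (0 : ℝ) < 1 + ‖p.1‖ ^ 2 := by positivity
  simp only [hφ]
  calc _ = ((((1 + ‖p.1‖ ^ 2) ^ N : ℝ) : ℂ) * (((1 + ‖p.1‖ ^ 2) ^ (-N) : ℝ) : ℂ)) *
      (ψ p.1 * (A (p.1 - p.2) * B p.2)) := by ring
    _ = _ := by
      rw [← Complex.ofReal_mul, ← Real.rpow_add h0]; simp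

theorem TemperedPair.integrable_shear {A B : Eu d → ℂ} (hA : Measurable A) (hB : Measurable B)
    (h : TemperedPair A B) (ψ : 𝓢(Eu d, ℂ)) : Integrable (fun p : Eu d × Eu d =>
      ψ (p.1 + p.2) * (A p.1 * B p.2)) (volume.prod volume) := by
  -- The shear `(ξ, η) ↦ (ξ + η, η)` preserves the product measure.
  have hmp := measurePreserving_add_prod (volume : Measure (Eu d)) (volume : Measure (Eu d))
  have := hmp.integrable_comp_of_integrable (h.integrable_schwartz hA hB ψ)
  simpa [Function.comp_def] using this

theorem TemperedPair.integral_conv {A B : Eu d → ℂ} (hA : Measurable A) (hB : Measurable B)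
    (h : TemperedPair A B) (ψ : 𝓢(Eu d, ℂ)) :
    ∫ z, ψ z * conv A B z =
      ∫ p : Eu d × Eu d, ψ (p.1 + p.2) * (A p.1 * B p.2) ∂(volume.prod volume) := by
  have hmp := measurePreserving_add_prod (volume : Measure (Eu d)) (volume : Measure (Eu d))
  have hi := h.integrable_schwartz hA hB ψ
  have e := integral_map hmp.measurable.aemeasurable
    (f := fun p : Eu d × Eu d => ψ p.1 * (A (p.1 - p.2) * B p.2))
    (by rw [hmp.map_eq]; exact hi.aestronglyMeasurable)
  rw [hmp.map_eq, integral_prod _ hi] at e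
  simp only [add_sub_cancel_right, integral_const_mul] at e
  exact e

/-- The convolution theorem: both sides, tested against `ψ`, are the double integral of `ψ(ξ + η)
A(ξ) B(η)`, and absolute convergence justifies Fubini. -/
theorem TemperedPair.isGivenBy_conv {b T : 𝓢'(Eu d, ℂ)} {f g A B : Eu d → ℂ} (hA : Measurable A)
    (hB : Measurable B) (h : TemperedPair A B) (hf : IsInverseTransform f A)
    (hb : IsGivenBy b g) (hbB : IsGivenBy (𝓕 b) B) {M : ℝ} (hM : ∀ᵐ x, ‖g x‖ ≤ M)
    (hT : IsGivenBy T (fun x => f x * g x)) : IsGivenBy (𝓕 T) (conv A B) := by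
  obtain ⟨T', hT'⟩ := (h.moderate_conv hA hB).exists_isGivenBy
  convert hT'
  ext ψ
  rw [fourier_product_apply hf hb hbB hM hT, (hT'.2 ψ).2, h.integral_conv hA hB,
    integral_prod _ (h.integrable_shear hA hB ψ)]
  refine integral_congr_ae (Eventually.of_forall fun ξ => ?_)
  simp only [← integral_const_mul]
  congr 1; ext η; ring

/-! ### Weighted norms -/

theorem eLpNorm_two_eq_lintegral {α E : Type*} [MeasurableSpace α] [NormedAddCommGroup E]
    (μ : Measure α) (g : α → E) :
    eLpNorm g 2 μ = (∫⁻ x, ‖g x‖ₑ ^ 2 ∂μ) ^ (1 / 2 : ℝ) := by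
  rw [eLpNorm_eq_lintegral_rpow_enorm_toReal (by norm_num) (by norm_num)]
  simp

theorem weighted_eLpNorm_eq (hd : 1 ≤ d) (s : ℝ) (g : Eu d → ℂ) :
    eLpNorm (fun ξ => ((‖ξ‖ ^ s : ℝ) : ℂ) * g ξ) 2 volume =
      (∫⁻ ξ, ‖ξ‖ₑ ^ (2 * s) * ‖g ξ‖ₑ ^ 2) ^ (1 / 2 : ℝ) := by
  rw [eLpNorm_two_eq_lintegral]
  congr 1
  refine lintegral_congr_ae ?_
  filter_upwards [ae_enorm_ne_zero hd] with x hx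
  have hx' : 0 < ‖x‖ := by
    rw [norm_pos_iff]; rintro rfl; simp at hx
  have e : ‖((‖x‖ ^ s : ℝ) : ℂ)‖ₑ = ‖x‖ₑ ^ s := by
    rw [← ofReal_norm, Complex.norm_real, Real.norm_of_nonneg (by positivity),
      ← ENNReal.ofReal_rpow_of_pos hx', ofReal_norm]
  rw [enorm_mul, mul_pow, e, ← ENNReal.rpow_natCast, ← ENNReal.rpow_mul]
  congr 2; push_cast; ring

/-- A representative of the Fourier transform of an element of a Sobolev space that is measurable
everywhere. -/
theorem MemSobolevHom.exists_measurable {s : ℝ} {f : 𝓢'(Eu d, ℂ)} (h : MemSobolevHom s f) :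
    ∃ A : Eu d → ℂ, Measurable A ∧ IsGivenBy (𝓕 f) A ∧
      MemLp (fun ξ => ((‖ξ‖ ^ s : ℝ) : ℂ) * A ξ) 2 volume := by
  obtain ⟨g, hg, hg2⟩ := h
  have hm := hg.1.aestronglyMeasurable
  refine ⟨hm.mk g, hm.stronglyMeasurable_mk.measurable, hg.congr hm.ae_eq_mk,
    (memLp_congr_ae ?_).1 hg2⟩
  filter_upwards [hm.ae_eq_mk] with x hx; rw [← hx]

/-! ### The full convolution -/

/-- One of two frequencies is always at most the other, so the two regions cover; their overlap does
no harm in an upper bound. -/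
theorem lconv_le_paraConv (F G : Eu d → ℝ≥0∞) (hF : Measurable F) (hG : Measurable G) (z : Eu d) :
    ∫⁻ y, F (z - y) * G y ≤ paraConv F G z + paraConv G F z := by
  have hm1 : Measurable fun y => if ‖z - y‖ₑ ≤ 8 * ‖y‖ₑ then F (z - y) * G y else 0 :=
    Measurable.ite (measurableSet_le (by fun_prop) (by fun_prop)) (by fun_prop) (by fun_prop)
  have e : paraConv G F z = ∫⁻ y, if ‖y‖ₑ ≤ 8 * ‖z - y‖ₑ then G y * F (z - y) else 0 := by
    rw [paraConv, ← lintegral_sub_left_eq_self _ z]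
    simp
  rw [e, paraConv, ← lintegral_add_left hm1]
  refine lintegral_mono fun y => ?_
  rcases le_total ‖z - y‖ₑ ‖y‖ₑ with h | h
  · rw [if_pos (h.trans (le_mul_of_one_le_left zero_le (by norm_num)))]
    exact le_add_right le_rfl
  · rw [if_pos (c := ‖y‖ₑ ≤ _) (h.trans (le_mul_of_one_le_left zero_le (by norm_num)))]
    exact le_add_left (mul_comm _ _).le

theorem exists_tsum_lconv_le (hd : 1 ≤ d) {s₁ s₂ : ℝ} (h₁ : s₁ < (d : ℝ) / 2)
    (h₂ : s₂ < (d : ℝ) / 2) (h₁₂ : 0 < s₁ + s₂) : ∃ C : ℝ≥0∞, C ≠ ⊤ ∧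
    ∀ F G : Eu d → ℝ≥0∞, Measurable F → Measurable G →
    ∑' l : ℤ, ((2 : ℝ≥0∞) ^ l) ^ (s₁ + s₂ - d / 2) *
        (∫⁻ z in annulus l, (∫⁻ y, F (z - y) * G y) ^ 2) ^ (1 / 2 : ℝ) ≤
      C * ((∫⁻ x, ‖x‖ₑ ^ (2 * s₁) * F x ^ 2) ^ (1 / 2 : ℝ) *
        (∫⁻ x, ‖x‖ₑ ^ (2 * s₂) * G x ^ 2) ^ (1 / 2 : ℝ)) := by
  obtain ⟨C₁, hC₁, k1⟩ := exists_tsum_paraConv_le hd h₁ h₁₂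
  obtain ⟨C₂, hC₂, k2⟩ := exists_tsum_paraConv_le hd h₂ (by rwa [add_comm])
  refine ⟨C₁ + C₂, by finiteness, fun F G hF hG => ?_⟩
  have key : ∀ l : ℤ, (∫⁻ z in annulus l, (∫⁻ y, F (z - y) * G y) ^ 2) ^ (1 / 2 : ℝ) ≤
      (∫⁻ z in annulus l, paraConv F G z ^ 2) ^ (1 / 2 : ℝ) +
      (∫⁻ z in annulus l, paraConv G F z ^ 2) ^ (1 / 2 : ℝ) := fun l => by
    have := ENNReal.lintegral_Lp_add_le (μ := volume.restrict (annulus l)) (p := 2)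
      (measurable_paraConv hF hG).aemeasurable (measurable_paraConv hG hF).aemeasurable
      (by norm_num)
    simp only [ENNReal.rpow_two, Pi.add_apply] at this
    refine le_trans (ENNReal.rpow_le_rpow (lintegral_mono fun z => ?_) (by norm_num)) this
    exact pow_le_pow_left' (lconv_le_paraConv F G hF hG z) 2
  calc _ ≤ ∑' l : ℤ, (((2 : ℝ≥0∞) ^ l) ^ (s₁ + s₂ - d / 2) *
          (∫⁻ z in annulus l, paraConv F G z ^ 2) ^ (1 / 2 : ℝ) +
        ((2 : ℝ≥0∞) ^ l) ^ (s₂ + s₁ - d / 2) *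
          (∫⁻ z in annulus l, paraConv G F z ^ 2) ^ (1 / 2 : ℝ)) := by
        refine ENNReal.tsum_le_tsum fun l => ?_
        refine (mul_le_mul_right (key l) _).trans (le_of_eq ?_)
        rw [mul_add, add_comm s₂ s₁]
    _ ≤ _ := by
        rw [ENNReal.tsum_add, add_mul]
        refine add_le_add (k1 F G hF hG) ((k2 G F hG hF).trans (le_of_eq ?_))
        rw [mul_comm (_ ^ (1 / 2 : ℝ))]

theorem exists_lintegral_weight_lt_top (hd : 1 ≤ d) {p : ℝ} (hp : 0 < p + d) :
    ∃ N : ℝ, ∫⁻ x : Eu d, ‖x‖ₑ ^ p * ENNReal.ofReal ((1 + ‖x‖ ^ 2) ^ (-N)) ^ 2 < ⊤ := by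
  obtain ⟨C, hC, h⟩ := exists_lintegral_low_rpow_le hd hp
  -- For `|x| > 1` the squared weight absorbs `|x|^p ≤ (1 + |x|^2)^|p|` and leaves the integrable
  -- power `-(d + 1)`.
  refine ⟨(|p| + (d + 1)) / 2, ?_⟩
  have hj := (integrable_japanese (d := d)).lintegral_lt_top
  refine lt_of_le_of_lt (b := ∫⁻ x : Eu d, ({x : Eu d | ‖x‖ₑ ≤ 1}.indicator (fun x => ‖x‖ₑ ^ p) x +
    ENNReal.ofReal ((1 + ‖x‖ ^ 2) ^ (-(d + 1 : ℝ))))) (lintegral_mono fun x => ?_) ?_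
  · have h1 : (1 : ℝ) ≤ 1 + ‖x‖ ^ 2 := by nlinarith [sq_nonneg ‖x‖]
    have h0 : (0 : ℝ) < 1 + ‖x‖ ^ 2 := by positivity
    by_cases hx : ‖x‖ₑ ≤ 1
    · rw [Set.indicator_of_mem (show x ∈ {x : Eu d | ‖x‖ₑ ≤ 1} from hx)]
      refine le_add_right (mul_le_of_le_one_right zero_le ?_)
      refine pow_le_one₀ zero_le ?_
      rw [ENNReal.ofReal_le_one]
      refine Real.rpow_le_one_of_one_le_of_nonpos h1 ?_
      have : 0 ≤ |p| := abs_nonneg p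
      rw [neg_nonpos]; positivity
    · refine le_add_left ?_
      have hx1 : 1 < ‖x‖ := by
        rw [not_le, ← ofReal_norm, ENNReal.one_lt_ofReal] at hx; exact hx
      rw [← ofReal_norm, ENNReal.ofReal_rpow_of_pos (by linarith), ← ENNReal.ofReal_pow (by positivity),
        ← ENNReal.ofReal_mul (by positivity)]
      refine ENNReal.ofReal_le_ofReal ?_
      have e1 : ‖x‖ ^ p ≤ (1 + ‖x‖ ^ 2) ^ |p| := by
        calc ‖x‖ ^ p ≤ ‖x‖ ^ |p| := Real.rpow_le_rpow_of_exponent_le hx1.le (le_abs_self p)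
          _ ≤ _ := Real.rpow_le_rpow (by linarith) (by nlinarith) (abs_nonneg p)
      have e2 : ((1 + ‖x‖ ^ 2) ^ (-((|p| + (d + 1)) / 2) : ℝ)) ^ 2 =
          (1 + ‖x‖ ^ 2) ^ (-|p| + -(d + 1 : ℝ)) := by
        rw [← Real.rpow_natCast, ← Real.rpow_mul h0.le]; congr 1; push_cast; ring
      calc _ ≤ (1 + ‖x‖ ^ 2) ^ |p| * (1 + ‖x‖ ^ 2) ^ (-|p| + -(d + 1 : ℝ)) := by
            rw [e2]; gcongr
        _ = _ := by rw [← Real.rpow_add h0]; congr 1; ring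
  · rw [lintegral_add_left (Measurable.indicator (by fun_prop) (measurableSet_enorm_le _))]
    refine ENNReal.add_lt_top.2 ⟨lt_of_le_of_lt (h 1) ?_, hj⟩
    simp [hC.lt_top]

theorem exists_mem_annulus {x : Eu d} (hx : ‖x‖ₑ ≠ 0) :
    ∃ n : ℤ, (2 : ℝ≥0∞) ^ n ≤ ‖x‖ₑ ∧ ‖x‖ₑ < 2 ^ (n + 1) :=
  ENNReal.exists_mem_Ico_zpow hx enorm_ne_top (by norm_num) (by norm_num)

theorem lintegral_le_tsum_annulus (hd : 1 ≤ d) (f : Eu d → ℝ≥0∞) :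
    ∫⁻ z, f z ≤ ∑' l : ℤ, ∫⁻ z in annulus l, f z := by
  refine le_trans (le_of_eq ?_) (lintegral_iUnion_le _ _)
  rw [← setLIntegral_univ]
  refine setLIntegral_congr (Filter.EventuallyEq.symm (eventuallyEq_univ.2 ?_))
  filter_upwards [ae_enorm_ne_zero hd] with x hx
  obtain ⟨n, h1, h2⟩ := exists_mem_annulus hx
  refine Set.mem_iUnion.2 ⟨n, h1, h2.le.trans ?_⟩
  exact ENNReal.zpow_le_of_le (by norm_num) (by omega)

/-- Summability over the dyadic annuli implies integrability against a power of `1 + |x|^2`. -/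
theorem exists_lintegral_lt_top_of_tsum (hd : 1 ≤ d) {σ : ℝ} (hσ : σ < (d : ℝ) / 2)
    {Q : Eu d → ℝ≥0∞} (hQ : Measurable Q)
    (h : ∑' l : ℤ, ((2 : ℝ≥0∞) ^ l) ^ σ * (∫⁻ z in annulus l, Q z ^ 2) ^ (1 / 2 : ℝ) < ⊤) :
    ∃ N : ℝ, ∫⁻ z : Eu d, ENNReal.ofReal ((1 + ‖z‖ ^ 2) ^ (-N)) * Q z < ⊤ := by
  -- The weight dual to `|x|^(2σ)` is locally integrable at the origin because `σ < d/2`;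
  -- Cauchy-Schwarz is applied on each annulus.
  obtain ⟨N, hN⟩ := exists_lintegral_weight_lt_top (d := d) hd (p := -(2 * σ)) (by linarith)
  refine ⟨N, ?_⟩
  set w : Eu d → ℝ≥0∞ := fun z => ENNReal.ofReal ((1 + ‖z‖ ^ 2) ^ (-N)) with hw
  have hwm : Measurable w := by fun_prop
  set W := ∫⁻ x : Eu d, ‖x‖ₑ ^ (-(2 * σ)) * w x ^ 2 with hW
  have hs : ∀ x : ℝ≥0∞, (x ^ 2) ^ (1 / 2 : ℝ) = x := fun x => by
    rw [← ENNReal.rpow_natCast, ← ENNReal.rpow_mul]; simp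
  have hblock : ∀ l : ℤ, ∫⁻ z in annulus l, w z * Q z ≤ (4 ^ |2 * σ| * W) ^ (1 / 2 : ℝ) *
      (((2 : ℝ≥0∞) ^ l) ^ σ * (∫⁻ z in annulus l, Q z ^ 2) ^ (1 / 2 : ℝ)) := fun l => by
    have hcs := sq_lintegral_mul_le (volume.restrict (annulus l)) hwm.aemeasurable hQ.aemeasurable
    have hw2 : ∫⁻ z in annulus l, w z ^ 2 ≤ 4 ^ |2 * σ| * ((2 : ℝ≥0∞) ^ l) ^ (2 * σ) * W := by
      rw [hW, ← lintegral_const_mul _ (by fun_prop)]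
      refine le_trans ?_ (setLIntegral_le_lintegral (annulus l) _)
      refine setLIntegral_mono_ae' (measurableSet_annulus l) ?_
      filter_upwards [ae_enorm_ne_zero hd] with x hx hxl
      have hc := rpow_le_of_comparable (x := ‖x‖ₑ) (y := (2 : ℝ≥0∞) ^ l) (c := 4) (by
          refine hxl.2.trans (le_of_eq ?_)
          rw [two_zpow_add, mul_comm]; congr 1; rw [← ENNReal.rpow_intCast]; norm_num)
        (hxl.1.trans (le_mul_of_one_le_left zero_le (by norm_num))) (by norm_num) (by norm_num)
        (2 * σ)
      calc w x ^ 2 = ‖x‖ₑ ^ (2 * σ) * (‖x‖ₑ ^ (-(2 * σ)) * w x ^ 2) := by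
            rw [← mul_assoc, rpow_mul_rpow_neg hx enorm_ne_top, one_mul]
        _ ≤ _ := by gcongr
    rw [← hs (∫⁻ z in annulus l, w z * Q z)]
    calc _ ≤ ((4 ^ |2 * σ| * ((2 : ℝ≥0∞) ^ l) ^ (2 * σ) * W) *
          ∫⁻ z in annulus l, Q z ^ 2) ^ (1 / 2 : ℝ) := by
          refine ENNReal.rpow_le_rpow (hcs.trans (by gcongr)) (by norm_num)
      _ = ((4 ^ |2 * σ| * W) * (((2 : ℝ≥0∞) ^ l) ^ (2 * σ) *
          ∫⁻ z in annulus l, Q z ^ 2)) ^ (1 / 2 : ℝ) := by congr 1; ring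
      _ = _ := by
          rw [ENNReal.mul_rpow_of_nonneg _ _ (by norm_num),
            ENNReal.mul_rpow_of_nonneg (((2 : ℝ≥0∞) ^ l) ^ (2 * σ)) _ (by norm_num),
            ← ENNReal.rpow_mul (2 ^ l)]
          congr 4; ring
  have hcover : ∫⁻ z, w z * Q z ≤ ∑' l : ℤ, ∫⁻ z in annulus l, w z * Q z := by
    exact lintegral_le_tsum_annulus hd _
  refine lt_of_le_of_lt (hcover.trans (ENNReal.tsum_le_tsum hblock)) ?_
  rw [ENNReal.tsum_mul_left]
  refine ENNReal.mul_lt_top ?_ h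
  exact ENNReal.rpow_lt_top_of_nonneg (by norm_num) (by finiteness)

/-! ### Smooth cut-offs -/

theorem hasCompactSupport_scaled {χ : Eu d → ℂ} (h0 : ∀ ξ, 2 < ‖ξ‖ → χ ξ = 0) (l : ℤ) :
    HasCompactSupport fun ξ => χ (((2 : ℝ) ^ (-l)) • ξ) := by
  have h1 : HasCompactSupport χ := by
    refine HasCompactSupport.intro (isCompact_closedBall (0 : Eu d) 2) fun x hx => h0 x ?_
    simpa using hx
  exact h1.comp_smul (by positivity)

theorem contDiff_scaled {χ : Eu d → ℂ} (hχ : ContDiff ℝ ∞ χ) (l : ℤ) :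
    ContDiff ℝ ∞ fun ξ => χ (((2 : ℝ) ^ (-l)) • ξ) :=
  hχ.comp (contDiff_const_smul _)

theorem hasTemperateGrowth_scaled {χ : Eu d → ℂ} (hχ : ContDiff ℝ ∞ χ)
    (h0 : ∀ ξ, 2 < ‖ξ‖ → χ ξ = 0) (l : ℤ) :
    (fun ξ => χ (((2 : ℝ) ^ (-l)) • ξ)).HasTemperateGrowth :=
  (hasCompactSupport_scaled h0 l).hasTemperateGrowth (contDiff_scaled hχ l)

theorem exists_bound_cutoff {χ : Eu d → ℂ} (hχ : ContDiff ℝ ∞ χ)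
    (h0 : ∀ ξ, 2 < ‖ξ‖ → χ ξ = 0) : ∃ M : ℝ≥0, ∀ ξ, ‖χ ξ‖ ≤ M := by
  have h1 : HasCompactSupport χ := by
    refine HasCompactSupport.intro (isCompact_closedBall (0 : Eu d) 2) fun x hx => h0 x ?_
    simpa using hx
  obtain ⟨C, hC⟩ := h1.exists_bound_of_continuous hχ.continuous
  exact ⟨C.toNNReal, fun ξ => (hC ξ).trans (Real.le_coe_toNNReal C)⟩

theorem integrable_cutoff_mul {χ A : Eu d → ℂ} (hχ : ContDiff ℝ ∞ χ)
    (h0 : ∀ ξ, 2 < ‖ξ‖ → χ ξ = 0) (hA : LocallyIntegrable A volume) (l : ℤ) :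
    Integrable fun ξ => χ (((2 : ℝ) ^ (-l)) • ξ) * A ξ :=
  hA.integrable_smul_left_of_hasCompactSupport (contDiff_scaled hχ l).continuous
    (hasCompactSupport_scaled h0 l)

theorem norm_scaled (l : ℤ) (ξ : Eu d) : ‖((2 : ℝ) ^ (-l)) • ξ‖ = (2 : ℝ) ^ (-l) * ‖ξ‖ := by
  rw [norm_smul, Real.norm_of_nonneg (by positivity)]

theorem tendsto_cutoff_one {χ : Eu d → ℂ} (h1 : ∀ ξ, ‖ξ‖ ≤ 1 → χ ξ = 1) (ξ : Eu d) :
    ∀ᶠ l : ℤ in atTop, χ (((2 : ℝ) ^ (-l)) • ξ) = 1 := by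
  obtain ⟨n, hn⟩ := pow_unbounded_of_one_lt ‖ξ‖ (one_lt_two)
  filter_upwards [eventually_ge_atTop (n : ℤ)] with l hl
  refine h1 _ ?_
  rw [norm_scaled, zpow_neg, inv_mul_le_one₀ (by positivity)]
  refine hn.le.trans ?_
  rw [← zpow_natCast]
  exact zpow_le_zpow_right₀ (by norm_num) hl

theorem tendsto_cutoff_zero {χ : Eu d → ℂ} (h0 : ∀ ξ, 2 < ‖ξ‖ → χ ξ = 0) {ξ : Eu d} (hξ : ξ ≠ 0) :
    ∀ᶠ l : ℤ in atTop, χ (((2 : ℝ) ^ (-(-l))) • ξ) = 0 := by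
  have hpos : 0 < ‖ξ‖ := norm_pos_iff.2 hξ
  obtain ⟨n, hn⟩ := pow_unbounded_of_one_lt (2 / ‖ξ‖) (one_lt_two)
  filter_upwards [eventually_ge_atTop (n : ℤ)] with l hl
  refine h0 _ ?_
  rw [norm_scaled, neg_neg]
  rw [div_lt_iff₀ hpos] at hn
  refine hn.trans_le ?_
  gcongr
  rw [← zpow_natCast]
  exact zpow_le_zpow_right₀ (by norm_num) hl

theorem cutoff_sub_eq_zero {χ : Eu d → ℂ} (h1 : ∀ ξ, ‖ξ‖ ≤ 1 → χ ξ = 1)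
    (h0 : ∀ ξ, 2 < ‖ξ‖ → χ ξ = 0) (l : ℤ) {ξ : Eu d} (hξ : ξ ∉ annulus l) :
    χ (((2 : ℝ) ^ (-(l + 1))) • ξ) - χ (((2 : ℝ) ^ (-l)) • ξ) = 0 := by
  have hcase : ‖ξ‖ < 2 ^ l ∨ (2 : ℝ) ^ (l + 2) < ‖ξ‖ := by
    by_contra! hc
    refine hξ ⟨?_, ?_⟩
    · rw [two_zpow_eq_ofReal, ← ofReal_norm]; exact ENNReal.ofReal_le_ofReal hc.1
    · rw [two_zpow_eq_ofReal, ← ofReal_norm]; exact ENNReal.ofReal_le_ofReal hc.2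
  have p1 : (0 : ℝ) < 2 ^ l := by positivity
  have e1 : (2 : ℝ) ^ (l + 1) = 2 ^ l * 2 := zpow_add_one₀ (by norm_num) l
  have e2 : (2 : ℝ) ^ (l + 2) = 2 ^ l * 2 * 2 := by
    rw [show l + 2 = l + 1 + 1 by ring, zpow_add_one₀ (by norm_num), e1]
  rcases hcase with hc | hc
  · rw [h1, h1, sub_self]
    · rw [norm_scaled, zpow_neg, inv_mul_le_one₀ (by positivity)]; exact hc.le
    · rw [norm_scaled, zpow_neg, inv_mul_le_one₀ (by positivity), e1]; linarith
  · rw [h0, h0, sub_self]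
    · rw [norm_scaled, zpow_neg, lt_inv_mul_iff₀ (by positivity)]; linarith
    · rw [norm_scaled, zpow_neg, lt_inv_mul_iff₀ (by positivity), e1]; linarith

/-! ### The product law in Besov spaces -/

theorem TemperedPair.mono {A B A' B' : Eu d → ℂ} (h : TemperedPair A B) {c : ℝ≥0}
    (hA : ∀ x, ‖A' x‖ ≤ c * ‖A x‖) (hB : ∀ x, ‖B' x‖ ≤ c * ‖B x‖) : TemperedPair A' B' := by
  obtain ⟨N, hN⟩ := h
  have hA' : ∀ x, ‖A' x‖ₑ ≤ c * ‖A x‖ₑ := fun x => by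
    simpa [enorm, ← ENNReal.coe_mul, ← NNReal.coe_le_coe] using hA x
  have hB' : ∀ x, ‖B' x‖ₑ ≤ c * ‖B x‖ₑ := fun x => by
    simpa [enorm, ← ENNReal.coe_mul, ← NNReal.coe_le_coe] using hB x
  refine ⟨N, lt_of_le_of_lt ?_ (ENNReal.mul_lt_top (ENNReal.coe_lt_top (r := c * c)) hN)⟩
  rw [← lintegral_const_mul' _ _ ENNReal.coe_ne_top]
  refine lintegral_mono fun z => ?_
  rw [mul_left_comm, ← lintegral_const_mul' _ _ ENNReal.coe_ne_top]
  refine mul_le_mul_right (lintegral_mono fun y => ?_) _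
  calc _ ≤ (c * ‖A (z - y)‖ₑ) * (c * ‖B y‖ₑ) := by gcongr; exacts [hA' _, hB' _]
    _ = _ := by push_cast; ring

theorem exists_apply_eq_integral (ψ : 𝓢(Eu d, ℂ)) : ∃ φ : 𝓢(Eu d, ℂ),
    ∀ (c : 𝓢'(Eu d, ℂ)) (H : Eu d → ℂ), IsGivenBy (𝓕 c) H → c ψ = ∫ x, φ x * H x := by
  refine ⟨𝓕⁻ ψ, fun c H hc => ?_⟩
  rw [← (hc.2 _).2, TemperedDistribution.fourier_apply, fourier_fourierInv_eq]

theorem tendsto_integral_schwartz_mul {ι : Type*} {L : Filter ι} [L.IsCountablyGenerated]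
    {g : ι → Eu d → ℂ} {T : ι → 𝓢'(Eu d, ℂ)} (hT : ∀ i, IsGivenBy (T i) (g i)) {c : 𝓢'(Eu d, ℂ)}
    {H g' : Eu d → ℂ} (hc : IsGivenBy c H) {M : ℝ} (hM : ∀ i x, ‖g i x‖ ≤ M * ‖H x‖)
    (hlim : ∀ᵐ x, Tendsto (fun i => g i x) L (𝓝 (g' x))) (φ : 𝓢(Eu d, ℂ)) :
    Tendsto (fun i => ∫ x, φ x * g i x) L (𝓝 (∫ x, φ x * g' x)) := by
  refine tendsto_integral_filter_of_dominated_convergence (fun x => M * ‖φ x * H x‖)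
    (Eventually.of_forall fun l => ((hT l).2 φ).1.aestronglyMeasurable)
    (Eventually.of_forall fun l => Eventually.of_forall fun x => ?_)
    ((hc.2 φ).1.norm.const_mul M) ?_
  · rw [norm_mul, norm_mul, mul_left_comm]
    gcongr
    exact hM l x
  · filter_upwards [hlim] with x hx
    exact hx.const_mul _

/-- The product of two distributions whose Fourier transforms have an absolutely convergent
tempered convolution. -/
theorem TemperedPair.isProduct {a b c : 𝓢'(Eu d, ℂ)} {A B : Eu d → ℂ} (hA : Measurable A)
    (hB : Measurable B) (h : TemperedPair A B) (ha : IsGivenBy (𝓕 a) A) (hb : IsGivenBy (𝓕 b) B)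
    (hc : IsGivenBy (𝓕 c) (conv A B)) : IsProduct a b c := by
  intro θ hθ
  obtain ⟨M, hM⟩ := exists_bound_cutoff hθ.contDiff hθ.eq_zero
  set t : ℤ → Eu d → ℂ := fun m ξ => θ (((2 : ℝ) ^ (-m)) • ξ) with ht
  have htm : ∀ m, Measurable (t m) := fun m => (contDiff_scaled hθ.contDiff m).continuous.measurable
  have hmA : ∀ m, Measurable fun ξ => t m ξ * A ξ := fun m => (htm m).mul hA
  have hmB : ∀ m, Measurable fun ξ => t m ξ * B ξ := fun m => (htm m).mul hB
  have hAi : ∀ m, Integrable fun ξ => t m ξ * A ξ := integrable_cutoff_mul hθ.contDiff hθ.eq_zero ha.1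
  have hBi : ∀ m, Integrable fun ξ => t m ξ * B ξ := integrable_cutoff_mul hθ.contDiff hθ.eq_zero hb.1
  have htA : ∀ m, IsGivenBy (𝓕 (lowFreq θ m a)) fun ξ => t m ξ * A ξ := fun m =>
    ha.fourierMultiplier (hasTemperateGrowth_scaled hθ.contDiff hθ.eq_zero m)
  have htB : ∀ m, IsGivenBy (𝓕 (lowFreq θ m b)) fun ξ => t m ξ * B ξ := fun m =>
    hb.fourierMultiplier (hasTemperateGrowth_scaled hθ.contDiff hθ.eq_zero m)
  have hP : ∀ m : ℤ, ∃ P : 𝓢'(Eu d, ℂ), IsGivenBy P fun x =>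
      𝓕⁻ (fun ξ => t m ξ * A ξ) x * 𝓕⁻ (fun ξ => t m ξ * B ξ) x := fun m => by
    refine Moderate.exists_isGivenBy (moderate_of_bounded
      (M := (∫ ξ, ‖t m ξ * A ξ‖) * ∫ ξ, ‖t m ξ * B ξ‖) ?_ (Eventually.of_forall fun x => ?_))
    · exact ((continuous_fourierInv (hAi m)).mul (continuous_fourierInv (hBi m))).aestronglyMeasurable
    · rw [norm_mul]
      gcongr <;> exact norm_fourierInv_le _ _
  choose P hP using hP
  refine ⟨fun m => P m, fun m => ⟨_, _, isGivenBy_fourierInv (htA m) (hAi m),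
    isGivenBy_fourierInv (htB m) (hBi m), hP m⟩, ?_⟩
  have hpair : ∀ m, TemperedPair (fun ξ => t m ξ * A ξ) (fun ξ => t m ξ * B ξ) := fun m =>
    h.mono (c := M) (fun x => by rw [norm_mul]; gcongr; exact hM _)
      (fun x => by rw [norm_mul]; gcongr; exact hM _)
  have hFP : ∀ m, IsGivenBy (𝓕 (P m)) (conv (fun ξ => t m ξ * A ξ) (fun ξ => t m ξ * B ξ)) := fun m =>
    (hpair m).isGivenBy_conv (hmA m) (hmB m)
      (isInverseTransform_of_integrable (hAi m)) (isGivenBy_fourierInv (htB m) (hBi m)) (htB m)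
      (Eventually.of_forall (norm_fourierInv_le _)) (hP m)
  rw [PointwiseConvergenceCLM.tendsto_iff_forall_tendsto]
  intro ψ
  obtain ⟨φ, hφ⟩ := exists_apply_eq_integral ψ
  rw [hφ c _ hc, h.integral_conv hA hB]
  refine Tendsto.congr (fun m : ℕ =>
    ((hφ _ _ (hFP m)).trans ((hpair m).integral_conv (hmA m) (hmB m) _)).symm) ?_
  have hi := h.integrable_shear hA hB φ
  -- The truncated integrands are at most `M^2` times the full one, and at each point both cut-offs
  -- are eventually equal to `1`. Only these two facts about `θ` are used for the limit, so the
  -- limit is the same for all cut-offs.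
  refine tendsto_integral_of_dominated_convergence
    (fun p => (M * M) * ‖φ (p.1 + p.2) * (A p.1 * B p.2)‖)
    (fun m => ((hpair m).integrable_shear (hmA m) (hmB m) _).aestronglyMeasurable)
    (hi.norm.const_mul _) (fun m => Eventually.of_forall fun p => ?_)
    (Eventually.of_forall fun p => ?_)
  · simp only [norm_mul]
    calc _ = (‖t m p.1‖ * ‖t m p.2‖) * (‖φ (p.1 + p.2)‖ * (‖A p.1‖ * ‖B p.2‖)) := by ring
      _ ≤ _ := by gcongr <;> exact hM _
  · refine tendsto_const_nhds.congr' ?_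
    have e1 := tendsto_natCast_atTop_atTop (R := ℤ) |>.eventually (tendsto_cutoff_one hθ.eq_one p.1)
    have e2 := tendsto_natCast_atTop_atTop (R := ℤ) |>.eventually (tendsto_cutoff_one hθ.eq_one p.2)
    filter_upwards [e1, e2] with m h1 h2
    simp only [ht, h1, h2, one_mul]

/-- The sum telescopes to `S_{m+1} c - S_{-m} c`. The second term tends to `0` because the transform
of `c` is a function and so puts no mass at the origin. -/
theorem tendsto_sum_dyadicBlock (hd : 1 ≤ d) {χ : Eu d → ℂ} (hχ : IsCutoff χ) {c : 𝓢'(Eu d, ℂ)}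
    {H : Eu d → ℂ} (hc : IsGivenBy (𝓕 c) H) :
    Tendsto (fun m : ℕ => ∑ l ∈ Finset.Icc (-(m : ℤ)) (m : ℤ), dyadicBlock χ l c) atTop (𝓝 c) := by
  obtain ⟨M, hM⟩ := exists_bound_cutoff hχ.contDiff hχ.eq_zero
  have htel : ∀ m : ℕ, ∑ l ∈ Finset.Icc (-(m : ℤ)) (m : ℤ), dyadicBlock χ l c =
      lowFreq χ (m + 1) c - lowFreq χ (-m) c := fun m => by
    induction m with
    | zero => simp [dyadicBlock]
    | succ m ih =>
      have e : Finset.Icc (-((m + 1 : ℕ) : ℤ)) ((m + 1 : ℕ) : ℤ) =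
          insert (-((m + 1 : ℕ) : ℤ)) (insert ((m + 1 : ℕ) : ℤ) (Finset.Icc (-(m : ℤ)) (m : ℤ))) := by
        ext x; simp only [Finset.mem_insert, Finset.mem_Icc]; omega
      rw [e, Finset.sum_insert (by simp; omega), Finset.sum_insert (by simp), ih]
      have e1 : -((m + 1 : ℕ) : ℤ) + 1 = -m := by push_cast; ring
      have d1 : ∀ l, dyadicBlock χ l c = lowFreq χ (l + 1) c - lowFreq χ l c := fun _ => rfl
      rw [d1, d1, e1]
      push_cast
      abel
  simp only [htel]
  have hl : ∀ l, IsGivenBy (𝓕 (lowFreq χ l c)) fun ξ => χ (((2 : ℝ) ^ (-l)) • ξ) * H ξ := fun l =>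
    hc.fourierMultiplier (hasTemperateGrowth_scaled hχ.contDiff hχ.eq_zero l)
  rw [PointwiseConvergenceCLM.tendsto_iff_forall_tendsto]
  intro ψ
  obtain ⟨φ, hφ⟩ := exists_apply_eq_integral ψ
  have e1 : Tendsto (fun l : ℤ => lowFreq χ l c ψ) atTop (𝓝 (c ψ)) := by
    rw [hφ c _ hc]
    refine Tendsto.congr (fun l => (hφ _ _ (hl l)).symm) ?_
    refine tendsto_integral_schwartz_mul hl hc (M := M) (fun l x => ?_)
      (Eventually.of_forall fun x => tendsto_const_nhds.congr' ?_) φ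
    · rw [norm_mul]; gcongr; exact hM _
    · filter_upwards [tendsto_cutoff_one hχ.eq_one x] with l hl
      rw [hl, one_mul]
  have e2 : Tendsto (fun l : ℤ => lowFreq χ (-l) c ψ) atTop (𝓝 0) := by
    have e0 : (0 : ℂ) = ∫ x : Eu d, φ x * (fun _ => (0 : ℂ)) x := by simp
    rw [e0]
    refine Tendsto.congr (fun l => (hφ _ _ (hl (-l))).symm) ?_
    refine tendsto_integral_schwartz_mul (fun l => hl (-l)) hc (M := M) (fun l x => ?_) ?_ φ
    · rw [norm_mul]; gcongr; exact hM _
    · filter_upwards [ae_enorm_ne_zero hd] with x hx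
      refine tendsto_const_nhds.congr' ?_
      filter_upwards [tendsto_cutoff_zero hχ.eq_zero (by simpa using hx)] with l hl
      rw [hl, zero_mul]
  have n1 : Tendsto (fun m : ℕ => (m : ℤ) + 1) atTop atTop :=
    tendsto_atTop_add_const_right _ _ tendsto_natCast_atTop_atTop
  have := (e1.comp n1).sub (e2.comp (tendsto_natCast_atTop_atTop (R := ℤ)))
  simpa using this

/-- By Plancherel, since the symbol of `Δ_l` is bounded by `2M` and vanishes off `annulus l`. -/
theorem besovNorm_le {χ : Eu d → ℂ} (hχ : IsCutoff χ) {M : ℝ≥0}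
    (hM : ∀ ξ, ‖χ ξ‖ ≤ M) {c : 𝓢'(Eu d, ℂ)} {H : Eu d → ℂ} (hc : IsGivenBy (𝓕 c) H) (σ : ℝ) :
    besovNorm χ σ c ≤ 2 * M * ∑' l : ℤ, ((2 : ℝ≥0∞) ^ l) ^ σ *
      (∫⁻ z in annulus l, ‖H z‖ₑ ^ 2) ^ (1 / 2 : ℝ) := by
  rw [besovNorm, ← ENNReal.tsum_mul_left]
  refine ENNReal.tsum_le_tsum fun l => ?_
  set t : ℤ → Eu d → ℂ := fun l ξ => χ (((2 : ℝ) ^ (-l)) • ξ) with ht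
  have hg := hasTemperateGrowth_scaled hχ.contDiff hχ.eq_zero
  have hblock : IsGivenBy (𝓕 (dyadicBlock χ l c)) fun ξ => (t (l + 1) ξ - t l ξ) * H ξ := by
    have e : dyadicBlock χ l c =
        fourierMultiplierCLM ℂ (fun ξ => t (l + 1) ξ - t l ξ) c := by
      change lowFreq χ (l + 1) c - lowFreq χ l c = _
      rw [lowFreq, lowFreq, fourierMultiplierCLM_apply, fourierMultiplierCLM_apply,
        fourierMultiplierCLM_apply]
      have e2 : smulLeftCLM ℂ (fun ξ => t (l + 1) ξ - t l ξ) (𝓕 c) =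
          smulLeftCLM ℂ (t (l + 1)) (𝓕 c) - smulLeftCLM ℂ (t l) (𝓕 c) :=
        congrArg (fun L : 𝓢'(Eu d, ℂ) →L[ℂ] 𝓢'(Eu d, ℂ) => L (𝓕 c))
          (smulLeftCLM_sub (F := ℂ) (hg (l + 1)) (hg l))
      rw [e2]
      exact (map_sub (fourierInvCLM ℂ 𝓢'(Eu d, ℂ)) _ _).symm
    rw [e]
    exact hc.fourierMultiplier ((hg (l + 1)).sub (hg l))
  have hle : ∀ ξ, ‖(t (l + 1) ξ - t l ξ) * H ξ‖ₑ ≤ 2 * M * (annulus l).indicator (fun ξ => ‖H ξ‖ₑ) ξ :=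
    fun ξ => by
    by_cases hξ : ξ ∈ annulus l
    · rw [Set.indicator_of_mem hξ, enorm_mul]
      gcongr
      have hMe : ∀ k, ‖t k ξ‖ₑ ≤ M := fun k => by
        simpa [enorm, ← NNReal.coe_le_coe] using hM _
      calc _ ≤ ‖t (l + 1) ξ‖ₑ + ‖t l ξ‖ₑ := enorm_sub_le
        _ ≤ M + M := by gcongr <;> exact hMe _
        _ = 2 * M := by ring
    · have := cutoff_sub_eq_zero hχ.eq_one hχ.eq_zero l hξ
      simp only [ht, this]; simp
  have hbound : eLpNorm (fun ξ => (t (l + 1) ξ - t l ξ) * H ξ) 2 volume ≤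
      2 * M * (∫⁻ z in annulus l, ‖H z‖ₑ ^ 2) ^ (1 / 2 : ℝ) := by
    rw [eLpNorm_two_eq_lintegral]
    calc _ ≤ (∫⁻ x, (2 * M) ^ 2 * (annulus l).indicator (fun ξ => ‖H ξ‖ₑ ^ 2) x) ^ (1 / 2 : ℝ) := by
          refine ENNReal.rpow_le_rpow (lintegral_mono fun x => ?_) (by norm_num)
          refine (pow_le_pow_left' (hle x) 2).trans (le_of_eq ?_)
          rw [mul_pow]
          by_cases hx : x ∈ annulus l <;> simp [hx]
      _ = _ := by
          rw [lintegral_const_mul' _ _ (by finiteness), lintegral_indicator (measurableSet_annulus l),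
            ENNReal.mul_rpow_of_nonneg _ _ (by norm_num), ← ENNReal.rpow_natCast (2 * (M : ℝ≥0∞)),
            ← ENNReal.rpow_mul]
          simp
  rw [mul_left_comm, ← ENNReal.rpow_intCast, ← ENNReal.rpow_mul]
  gcongr
  by_cases htop : eLpNorm (fun ξ => (t (l + 1) ξ - t l ξ) * H ξ) 2 volume = ⊤
  · rw [htop, top_le_iff] at hbound
    rw [hbound]; exact le_top
  · exact (l2Norm_le hblock ⟨hblock.1.aestronglyMeasurable, lt_top_iff_ne_top.2 htop⟩).trans hbound

theorem tsum_annulus_conv_le {A B : Eu d → ℂ} (σ : ℝ) :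
    ∑' l : ℤ, ((2 : ℝ≥0∞) ^ l) ^ σ * (∫⁻ z in annulus l, ‖conv A B z‖ₑ ^ 2) ^ (1 / 2 : ℝ) ≤
    ∑' l : ℤ, ((2 : ℝ≥0∞) ^ l) ^ σ *
      (∫⁻ z in annulus l, (∫⁻ y, ‖A (z - y)‖ₑ * ‖B y‖ₑ) ^ 2) ^ (1 / 2 : ℝ) := by
  gcongr with l z
  refine (enorm_integral_le_lintegral_enorm _).trans (le_of_eq ?_)
  simp only [enorm_mul]

/-- The product is built as the inverse transform of `conv A B`. One dyadic estimate serves twice: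
it makes the convolution tempered, as `s₁ + s₂ - d/2 < d/2`, and it bounds the Besov norm. -/
theorem exists_product_memBesov (hd : 1 ≤ d) {χ : Eu d → ℂ} (hχ : IsCutoff χ) {s₁ s₂ : ℝ}
    (h₁₂ : 0 < s₁ + s₂) (h₁ : s₁ < (d : ℝ) / 2) (h₂ : s₂ < (d : ℝ) / 2) :
    ∃ C : ℝ≥0, ∀ a b : 𝓢'(Eu d, ℂ), MemSobolevHom s₁ a → MemSobolevHom s₂ b →
      ∃ ab : 𝓢'(Eu d, ℂ), IsProduct a b ab ∧ MemBesov χ (s₁ + s₂ - (d : ℝ) / 2) ab ∧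
        besovNorm χ (s₁ + s₂ - (d : ℝ) / 2) ab ≤ C * (sobolevNorm s₁ a * sobolevNorm s₂ b) := by
  obtain ⟨M, hM⟩ := exists_bound_cutoff hχ.contDiff hχ.eq_zero
  obtain ⟨C, hC, hbd⟩ := exists_tsum_lconv_le hd h₁ h₂ h₁₂
  refine ⟨2 * M * C.toNNReal, fun a b ha hb => ?_⟩
  obtain ⟨A, hAm, hA, hA2⟩ := ha.exists_measurable
  obtain ⟨B, hBm, hB, hB2⟩ := hb.exists_measurable
  have key := hbd (fun x => ‖A x‖ₑ) (fun x => ‖B x‖ₑ) hAm.enorm hBm.enorm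
  rw [← weighted_eLpNorm_eq hd, ← weighted_eLpNorm_eq hd] at key
  have hfin : C * (eLpNorm (fun ξ => ((‖ξ‖ ^ s₁ : ℝ) : ℂ) * A ξ) 2 volume *
      eLpNorm (fun ξ => ((‖ξ‖ ^ s₂ : ℝ) : ℂ) * B ξ) 2 volume) < ⊤ :=
    ENNReal.mul_lt_top hC.lt_top (ENNReal.mul_lt_top hA2.2 hB2.2)
  have hpair : TemperedPair A B := exists_lintegral_lt_top_of_tsum hd
    (σ := s₁ + s₂ - (d : ℝ) / 2) (by linarith) (measurable_conv hAm.enorm hBm.enorm)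
    (key.trans_lt hfin)
  obtain ⟨T, hT⟩ := (hpair.moderate_conv hAm hBm).exists_isGivenBy
  have hc : IsGivenBy (𝓕 (𝓕⁻ T)) (conv A B) := by rwa [fourier_fourierInv_eq]
  have hnorm := ((besovNorm_le hχ hM hc (s₁ + s₂ - (d : ℝ) / 2)).trans
    (mul_le_mul_right ((tsum_annulus_conv_le _).trans key) _))
  refine ⟨𝓕⁻ T, hpair.isProduct hAm hBm hA hB hc, ⟨tendsto_sum_dyadicBlock hd hχ hc, ?_⟩, ?_⟩
  · exact hnorm.trans_lt (ENNReal.mul_lt_top (by finiteness) hfin)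
  · rw [sobolevNorm_eq hA, sobolevNorm_eq hB]
    refine hnorm.trans (le_of_eq ?_)
    push_cast
    rw [ENNReal.coe_toNNReal hC, mul_assoc, mul_assoc, mul_assoc]

/-! ### Uniform bounds for low frequency cut-offs of bounded functions -/

theorem fourier_scaled (χ : Eu d → ℂ) (l : ℤ) (y : Eu d) :
    𝓕 (fun ξ => χ (((2 : ℝ) ^ (-l)) • ξ)) y = (((2 : ℝ) ^ l) ^ d : ℝ) • 𝓕 χ (((2 : ℝ) ^ l) • y) := by
  rw [Real.fourier_eq, Real.fourier_eq]
  have key := Measure.integral_comp_smul (volume : Measure (Eu d))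
    (fun η => Real.fourierChar (-inner ℝ η (((2 : ℝ) ^ l) • y)) • χ η) ((2 : ℝ) ^ (-l))
  have e : ∀ ξ : Eu d, inner ℝ (((2 : ℝ) ^ (-l)) • ξ) (((2 : ℝ) ^ l) • y) = inner ℝ ξ y := fun ξ => by
    rw [inner_smul_left, inner_smul_right, ← mul_assoc, conj_trivial, zpow_neg,
      inv_mul_cancel₀ (by positivity), one_mul]
  simp only [e] at key
  rw [key]
  congr 1
  rw [finrank_euclideanSpace_fin, ← inv_pow, ← zpow_neg, neg_neg, abs_of_pos (by positivity)]

/-- Modulation translates the transform and dilation rescales it with preserved `L^1` norm; this is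
the source of uniformity in `l` and `x`. -/
theorem integral_norm_fourier_modulated (χ : Eu d → ℂ) (l : ℤ) (x : Eu d) :
    ∫ y, ‖𝓕 (fun ξ => (Real.fourierChar (inner ℝ ξ x) : ℂ) * χ (((2 : ℝ) ^ (-l)) • ξ)) y‖ =
      ∫ y, ‖𝓕 χ y‖ := by
  have e : ∀ y, 𝓕 (fun ξ => (Real.fourierChar (inner ℝ ξ x) : ℂ) * χ (((2 : ℝ) ^ (-l)) • ξ)) y =
      𝓕 (fun ξ => χ (((2 : ℝ) ^ (-l)) • ξ)) (y - x) := fun y => by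
    rw [Real.fourier_eq, Real.fourier_eq]
    refine integral_congr_ae (Eventually.of_forall fun ξ => ?_)
    simp only [Circle.smul_def, smul_eq_mul]
    rw [← mul_assoc, ← Circle.coe_mul, ← AddChar.map_add_eq_mul, inner_sub_right]
    congr 3; ring
  simp only [e]
  rw [integral_sub_right_eq_self (fun y => ‖𝓕 (fun ξ => χ (((2 : ℝ) ^ (-l)) • ξ)) y‖) x]
  simp only [fourier_scaled, norm_smul]
  rw [integral_const_mul, Measure.integral_comp_smul (volume : Measure (Eu d)) (fun y => ‖𝓕 χ y‖),
    finrank_euclideanSpace_fin, Real.norm_of_nonneg (by positivity), abs_of_pos (by positivity),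
    smul_eq_mul, ← mul_assoc, mul_inv_cancel₀ (by positivity), one_mul]

theorem ae_norm_le_norm (b : Lp ℂ ∞ (volume : Measure (Eu d))) : ∀ᵐ y, ‖b y‖ ≤ ‖b‖ := by
  have := ae_le_eLpNormEssSup (f := b) (μ := (volume : Measure (Eu d)))
  filter_upwards [this] with y hy
  rw [← eLpNorm_exponent_top] at hy
  rw [Lp.norm_def, ← toReal_enorm]
  exact ENNReal.toReal_mono (Lp.eLpNorm_ne_top b) hy

/-- The value of `S_l b` at `x` is the pairing of `𝓕 b` with a modulated cut-off, hence of `b` with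
the transform of that cut-off, whose `L^1` norm is `‖𝓕 χ‖_{L^1}`. -/
theorem exists_norm_lowFreq_le {χ : Eu d → ℂ} (hχ : ContDiff ℝ ∞ χ)
    (h0 : ∀ ξ, 2 < ‖ξ‖ → χ ξ = 0) : ∃ C : ℝ≥0, ∀ (b : Lp ℂ ∞ (volume : Measure (Eu d)))
      (B : Eu d → ℂ), IsGivenBy (𝓕 (b : 𝓢'(Eu d, ℂ))) B → ∀ (l : ℤ) (x : Eu d),
      ‖𝓕⁻ (fun ξ => χ (((2 : ℝ) ^ (-l)) • ξ) * B ξ) x‖ ≤ C * ‖b‖ := by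
  refine ⟨(∫ y, ‖𝓕 χ y‖).toNNReal, fun b B hB l x => ?_⟩
  rw [Real.coe_toNNReal _ (integral_nonneg fun _ => norm_nonneg _)]
  have hsm : ContDiff ℝ ∞ fun ξ : Eu d =>
      (Real.fourierChar (inner ℝ ξ x) : ℂ) * χ (((2 : ℝ) ^ (-l)) • ξ) := by
    refine ContDiff.mul ?_ (contDiff_scaled hχ l)
    simp only [Real.fourierChar_apply]
    refine Complex.contDiff_exp.comp (ContDiff.mul ?_ contDiff_const)
    exact Complex.ofRealCLM.contDiff.comp (contDiff_const.mul (contDiff_id.inner ℝ contDiff_const))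
  have hcs : HasCompactSupport fun ξ : Eu d =>
      (Real.fourierChar (inner ℝ ξ x) : ℂ) * χ (((2 : ℝ) ^ (-l)) • ξ) :=
    (hasCompactSupport_scaled h0 l).mul_left
  set ψ : 𝓢(Eu d, ℂ) := hcs.toSchwartzMap hsm with hψ
  have hψa : (⇑ψ : Eu d → ℂ) = fun ξ =>
      (Real.fourierChar (inner ℝ ξ x) : ℂ) * χ (((2 : ℝ) ^ (-l)) • ξ) := rfl
  have e1 : 𝓕⁻ (fun ξ => χ (((2 : ℝ) ^ (-l)) • ξ) * B ξ) x = ∫ y, 𝓕 ψ y * b y := by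
    rw [Real.fourierInv_eq]
    have h1 := (hB.2 ψ).2
    rw [TemperedDistribution.fourier_apply, ((isGivenBy_Lp b).2 _).2] at h1
    rw [h1]
    refine integral_congr_ae (Eventually.of_forall fun ξ => ?_)
    simp only [hψa, Circle.smul_def, smul_eq_mul]
    ring
  rw [e1, ← integral_norm_fourier_modulated χ l x, ← integral_mul_const]
  have hint : Integrable fun y => ‖𝓕 ψ y‖ * ‖b‖ :=
    ((𝓕 ψ).integrable (μ := volume)).norm.mul_const _
  rw [SchwartzMap.fourier_coe, hψa] at hint
  refine norm_integral_le_of_norm_le hint ?_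
  filter_upwards [ae_norm_le_norm b] with y hy
  rw [norm_mul, SchwartzMap.fourier_coe, hψa]
  gcongr

theorem exists_cutoff : ∃ χ : Eu d → ℂ, ContDiff ℝ ∞ χ ∧ (∀ ξ, ‖ξ‖ ≤ 1 → χ ξ = 1) ∧
    ∀ ξ, 2 < ‖ξ‖ → χ ξ = 0 := by
  let f : ContDiffBump (0 : Eu d) := ⟨1, 2, by norm_num, by norm_num⟩
  refine ⟨fun ξ => (f ξ : ℂ), Complex.ofRealCLM.contDiff.comp f.contDiff, fun ξ hξ => ?_,
    fun ξ hξ => ?_⟩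
  · simp only; rw [f.one_of_mem_closedBall (by simpa using hξ)]; simp
  · simp only; rw [f.zero_of_le_dist (by simpa using hξ.le)]; simp

/-! ### Multiplication by a bounded function in Fourier variables -/

/-- By Plancherel, convolution with `B` acts on `L^2` as multiplication by the bounded function `g`.
Cancellation in `B` is used here, so absolute values would not do. -/
theorem eLpNorm_conv_le {b : 𝓢'(Eu d, ℂ)} {g A B : Eu d → ℂ} (hA : Measurable A)
    (hB : Measurable B) (h : TemperedPair A B) (hA2 : MemLp A 2 volume) (hb : IsGivenBy b g)
    (hbB : IsGivenBy (𝓕 b) B) {M : ℝ} (hM : ∀ᵐ x, ‖g x‖ ≤ M) :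
    eLpNorm (conv A B) 2 volume ≤ ENNReal.ofReal M * eLpNorm A 2 volume := by
  set f : Lp ℂ 2 (volume : Measure (Eu d)) := 𝓕⁻ (hA2.toLp A)
  have hle : ∀ᵐ x, ‖f x * g x‖ ≤ M * ‖f x‖ := by
    filter_upwards [hM] with x hx
    rw [norm_mul, mul_comm]; gcongr
  have hfg : MemLp (fun x => f x * g x) 2 volume :=
    (Lp.memLp f).of_le_mul ((Lp.aestronglyMeasurable f).mul hb.1.aestronglyMeasurable) hle
  have hT : IsGivenBy (hfg.toLp _ : 𝓢'(Eu d, ℂ)) fun x => f x * g x :=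
    (isGivenBy_Lp _).congr hfg.coeFn_toLp
  have h1 := h.isGivenBy_conv hA hB (isInverseTransform_of_memLp hA2) hb hbB hM hT
  rw [Lp.fourier_toTemperedDistribution_eq] at h1
  rw [← eLpNorm_congr_ae ((isGivenBy_Lp _).ae_eq h1), ← Lp.enorm_def,
    enorm_eq_iff_norm_eq.2 (Lp.norm_fourier_eq _), Lp.enorm_toLp]
  refine (eLpNorm_le_mul_eLpNorm_of_ae_le_mul hle 2).trans (le_of_eq ?_)
  have h3 : ‖f‖ = ‖hA2.toLp A‖ := by
    rw [← Lp.norm_fourier_eq, fourier_fourierInv_eq]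
  rw [← Lp.enorm_def, enorm_eq_iff_norm_eq.2 h3, Lp.enorm_toLp]

/-! ### Splitting into low and high frequencies -/

theorem integrable_low {A : Eu d → ℂ} (hA : LocallyIntegrable A volume) :
    Integrable ((Metric.closedBall (0 : Eu d) 1).indicator A) :=
  (integrable_indicator_iff Metric.isClosed_closedBall.measurableSet).2
    (hA.integrableOn_isCompact (isCompact_closedBall 0 1))

theorem memLp_high {A : Eu d → ℂ} {s : ℝ} (hs : 0 ≤ s) (hm : Measurable A)
    (hA : MemLp (fun ξ => ((‖ξ‖ ^ s : ℝ) : ℂ) * A ξ) 2 volume) :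
    MemLp ((Metric.closedBall (0 : Eu d) 1)ᶜ.indicator A) 2 volume := by
  refine hA.mono
    (hm.indicator Metric.isClosed_closedBall.measurableSet.compl).aestronglyMeasurable
    (Eventually.of_forall fun ξ => ?_)
  by_cases hξ : ξ ∈ (Metric.closedBall (0 : Eu d) 1)ᶜ
  · rw [Set.indicator_of_mem hξ, norm_mul]
    have h1 : 1 < ‖ξ‖ := by simpa using hξ
    refine le_mul_of_one_le_left (norm_nonneg _) ?_
    rw [Complex.norm_real, Real.norm_of_nonneg (by positivity)]
    exact Real.one_le_rpow h1.le hs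
  · rw [Set.indicator_of_notMem hξ, norm_zero]; positivity

/-- Convolving `L^1 + L^2` with itself gives terms in `L^1`, `L^2` (twice) and `L^∞`; the weight is
bounded and integrable, hence in `L^2`, and pairs with each of them. -/
theorem lintegral_weight_lconv_lt_top {F₁ F₂ G₁ G₂ w : Eu d → ℝ≥0∞} (hF₁ : Measurable F₁)
    (hF₂ : Measurable F₂) (hG₁ : Measurable G₁) (hG₂ : Measurable G₂) (hw : Measurable w)
    (hF₁i : ∫⁻ x, F₁ x < ⊤) (hF₂i : ∫⁻ x, F₂ x ^ 2 < ⊤) (hG₁i : ∫⁻ x, G₁ x < ⊤)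
    (hG₂i : ∫⁻ x, G₂ x ^ 2 < ⊤) (hw1 : ∀ x, w x ≤ 1) (hwi : ∫⁻ x, w x < ⊤) :
    ∫⁻ z, w z * ∫⁻ y, (F₁ (z - y) + F₂ (z - y)) * (G₁ y + G₂ y) < ⊤ := by
  have hw2 : ∫⁻ x, w x ^ 2 < ⊤ := by
    refine lt_of_le_of_lt (lintegral_mono fun x => ?_) hwi
    rw [sq]; exact mul_le_of_le_one_left zero_le (hw1 x)
  have hsq : ∀ {Q : Eu d → ℝ≥0∞}, Measurable Q → ∫⁻ z, Q z ^ 2 < ⊤ → ∫⁻ z, w z * Q z < ⊤ := by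
    intro Q hQ hQ2
    have := (sq_lintegral_mul_le volume hw.aemeasurable hQ.aemeasurable).trans_lt
      (ENNReal.mul_lt_top hw2 hQ2)
    by_contra hcon
    rw [not_lt, top_le_iff] at hcon
    rw [hcon] at this
    simp at this
  have h11 : ∫⁻ z, w z * ∫⁻ y, F₁ (z - y) * G₁ y < ⊤ := by
    refine lt_of_le_of_lt (lintegral_mono fun z => mul_le_of_le_one_left zero_le (hw1 z)) ?_
    have hm : Measurable fun p : Eu d × Eu d => F₁ (p.1 - p.2) * G₁ p.2 := by fun_prop
    rw [lintegral_lintegral_swap hm.aemeasurable]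
    have : ∀ y : Eu d, ∫⁻ z, F₁ (z - y) * G₁ y = (∫⁻ x, F₁ x) * G₁ y := fun y => by
      rw [lintegral_mul_const _ (by fun_prop), lintegral_sub_right_eq_self F₁ y]
    simp only [this]
    rw [lintegral_const_mul _ hG₁]
    exact ENNReal.mul_lt_top hF₁i hG₁i
  have h12 : ∫⁻ z, w z * ∫⁻ y, F₁ (z - y) * G₂ y < ⊤ := hsq (measurable_conv hF₁ hG₂)
    ((lintegral_conv_sq_le hF₁ hG₂).trans_lt
      (ENNReal.mul_lt_top (ENNReal.pow_lt_top hF₁i) hG₂i))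
  have h21 : ∫⁻ z, w z * ∫⁻ y, F₂ (z - y) * G₁ y < ⊤ := by
    have e : ∀ z, ∫⁻ y, F₂ (z - y) * G₁ y = ∫⁻ y, G₁ (z - y) * F₂ y := fun z => by
      rw [← lintegral_sub_left_eq_self _ z]
      simp only [sub_sub_cancel, mul_comm]
    simp only [e]
    exact hsq (measurable_conv hG₁ hF₂) ((lintegral_conv_sq_le hG₁ hF₂).trans_lt
      (ENNReal.mul_lt_top (ENNReal.pow_lt_top hG₁i) hF₂i))
  have h22 : ∫⁻ z, w z * ∫⁻ y, F₂ (z - y) * G₂ y < ⊤ := by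
    set K := (∫⁻ x, F₂ x ^ 2) * ∫⁻ y, G₂ y ^ 2 with hK
    have hKt : K < ⊤ := ENNReal.mul_lt_top hF₂i hG₂i
    refine lt_of_le_of_lt (b := ∫⁻ z, w z * K ^ (1 / 2 : ℝ)) (lintegral_mono fun z => ?_) ?_
    · refine mul_le_mul_right ?_ _
      have := ENNReal.rpow_le_rpow (sq_conv_le hF₂ hG₂ z) (by norm_num : (0 : ℝ) ≤ 1 / 2)
      rw [← ENNReal.rpow_natCast, ← ENNReal.rpow_mul] at this
      simpa using this
    · rw [lintegral_mul_const _ hw]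
      exact ENNReal.mul_lt_top hwi (ENNReal.rpow_lt_top_of_nonneg (by norm_num) hKt.ne)
  have e : ∀ z, w z * ∫⁻ y, (F₁ (z - y) + F₂ (z - y)) * (G₁ y + G₂ y) =
      (w z * (∫⁻ y, F₁ (z - y) * G₁ y) + w z * ∫⁻ y, F₁ (z - y) * G₂ y) +
      (w z * (∫⁻ y, F₂ (z - y) * G₁ y) + w z * ∫⁻ y, F₂ (z - y) * G₂ y) := fun z => by
    rw [← mul_add, ← mul_add, ← mul_add, ← lintegral_add_left (by fun_prop),
      ← lintegral_add_left (by fun_prop), ← lintegral_add_left (by fun_prop)]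
    congr 1
    refine lintegral_congr fun y => ?_
    ring
  have m11 : Measurable fun z => w z * ∫⁻ y, F₁ (z - y) * G₁ y := hw.mul (measurable_conv hF₁ hG₁)
  have m12 : Measurable fun z => w z * ∫⁻ y, F₁ (z - y) * G₂ y := hw.mul (measurable_conv hF₁ hG₂)
  have m21 : Measurable fun z => w z * ∫⁻ y, F₂ (z - y) * G₁ y := hw.mul (measurable_conv hF₂ hG₁)
  have m1 : Measurable fun z => w z * (∫⁻ y, F₁ (z - y) * G₁ y) + w z * ∫⁻ y, F₁ (z - y) * G₂ y :=
    m11.add m12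
  simp only [e]
  rw [lintegral_add_left m1, lintegral_add_left m11, lintegral_add_left m21]
  exact ENNReal.add_lt_top.2 ⟨ENNReal.add_lt_top.2 ⟨h11, h12⟩, ENNReal.add_lt_top.2 ⟨h21, h22⟩⟩

theorem temperedPair_of_split {A B : Eu d → ℂ} (hA : Measurable A) (hB : Measurable B)
    (hA1 : Integrable ((Metric.closedBall (0 : Eu d) 1).indicator A))
    (hA2 : MemLp ((Metric.closedBall (0 : Eu d) 1)ᶜ.indicator A) 2 volume)
    (hB1 : Integrable ((Metric.closedBall (0 : Eu d) 1).indicator B))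
    (hB2 : MemLp ((Metric.closedBall (0 : Eu d) 1)ᶜ.indicator B) 2 volume) : TemperedPair A B := by
  have hms : MeasurableSet (Metric.closedBall (0 : Eu d) 1) :=
    Metric.isClosed_closedBall.measurableSet
  have hL2 : ∀ {g : Eu d → ℂ}, MemLp g 2 volume → ∫⁻ x, ‖g x‖ₑ ^ 2 < ⊤ := fun {g} hg => by
    have := hg.2
    rw [eLpNorm_two_eq_lintegral] at this
    by_contra hcon
    rw [not_lt, top_le_iff] at hcon
    rw [hcon] at this
    simp at this
  refine ⟨d + 1, ?_⟩
  have key := lintegral_weight_lconv_lt_top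
    (w := fun z : Eu d => ENNReal.ofReal ((1 + ‖z‖ ^ 2) ^ (-(d + 1 : ℝ))))
    (hA.indicator hms).enorm (hA.indicator hms.compl).enorm (hB.indicator hms).enorm
    (hB.indicator hms.compl).enorm (by fun_prop) hA1.2 (hL2 hA2) hB1.2 (hL2 hB2)
    (fun x => by
      rw [ENNReal.ofReal_le_one]
      refine Real.rpow_le_one_of_one_le_of_nonpos (by nlinarith [sq_nonneg ‖x‖]) ?_
      rw [neg_nonpos]; positivity)
    integrable_japanese.lintegral_lt_top
  have e : ∀ (g : Eu d → ℂ) (x : Eu d), ‖(Metric.closedBall (0 : Eu d) 1).indicator g x‖ₑ +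
      ‖(Metric.closedBall (0 : Eu d) 1)ᶜ.indicator g x‖ₑ = ‖g x‖ₑ := fun g x => by
    by_cases hx : x ∈ Metric.closedBall (0 : Eu d) 1 <;> simp [Set.indicator, hx]
  simpa only [e] using key

/-! ### Dyadic shells -/

theorem lt_of_two_zpow_lt {m n : ℤ} (h : (2 : ℝ≥0∞) ^ m < 2 ^ n) : m < n := by
  by_contra hcon
  exact absurd (ENNReal.zpow_le_of_le (by norm_num) (not_lt.1 hcon)) (not_le.2 h)

/-- The points `x` with `2^j ≤ |x| < 2^(j+1)`. -/
def shell (j : ℤ) : Set (Eu d) := {x | (2 : ℝ≥0∞) ^ j ≤ ‖x‖ₑ ∧ ‖x‖ₑ < 2 ^ (j + 1)}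

theorem measurableSet_shell (j : ℤ) : MeasurableSet (shell j : Set (Eu d)) :=
  (measurableSet_le_enorm _).inter
    (measurableSet_lt (f := fun x : Eu d => ‖x‖ₑ) (by fun_prop) measurable_const)

theorem shell_index_eq {x : Eu d} {j n : ℤ} (hj : x ∈ shell j) (hn : x ∈ shell n) : j = n := by
  have h1 := lt_of_two_zpow_lt (hj.1.trans_lt hn.2)
  have h2 := lt_of_two_zpow_lt (hn.1.trans_lt hj.2)
  omega

theorem tsum_shell_indicator {E : Type*} [AddCommMonoid E] [TopologicalSpace E] (f : Eu d → E)
    {x : Eu d} (hx : ‖x‖ₑ ≠ 0) : ∑' j : ℤ, (shell j).indicator f x = f x := by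
  obtain ⟨n, hn⟩ := exists_mem_annulus hx
  rw [tsum_eq_single n fun j hj => Set.indicator_of_notMem (fun h => hj (shell_index_eq h hn)) f]
  exact Set.indicator_of_mem (show x ∈ shell n from hn) f

theorem tsum_shell_indicator_le (f : Eu d → ℝ≥0∞) (x : Eu d) :
    ∑' j : ℤ, (shell j).indicator f x ≤ f x := by
  by_cases hx : ‖x‖ₑ = 0
  · have h : ∀ j : ℤ, (shell j).indicator f x = 0 := fun j => by
      refine Set.indicator_of_notMem (fun hj => two_zpow_ne_zero j ?_) f
      have := hj.1
      rwa [hx, nonpos_iff_eq_zero] at this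
    simp [h]
  · exact (tsum_shell_indicator f hx).le

theorem tsum_lintegral_shell_le {s : ℝ} (hs : 0 ≤ s) {F : Eu d → ℝ≥0∞} (hF : Measurable F) :
    ∑' j : ℤ, ((2 : ℝ≥0∞) ^ j) ^ (2 * s) * ∫⁻ x, (shell j).indicator F x ^ 2 ≤
      ∫⁻ x, ‖x‖ₑ ^ (2 * s) * F x ^ 2 := by
  have hm : Measurable fun x : Eu d => ‖x‖ₑ ^ (2 * s) * F x ^ 2 := by fun_prop
  calc _ ≤ ∑' j : ℤ, ∫⁻ x, (shell j).indicator (fun x => ‖x‖ₑ ^ (2 * s) * F x ^ 2) x := by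
        refine ENNReal.tsum_le_tsum fun j => ?_
        rw [← lintegral_const_mul _ ((hF.indicator (measurableSet_shell j)).pow_const 2)]
        refine lintegral_mono fun x => ?_
        by_cases hx : x ∈ shell j
        · simp only [Set.indicator_of_mem hx]
          gcongr
          exact hx.1
        · simp [Set.indicator_of_notMem hx]
    _ = ∫⁻ x, ∑' j : ℤ, (shell j).indicator (fun x => ‖x‖ₑ ^ (2 * s) * F x ^ 2) x :=
        (lintegral_tsum fun j => (hm.indicator (measurableSet_shell j)).aemeasurable).symm
    _ ≤ _ := lintegral_mono fun x => tsum_shell_indicator_le _ x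

/-- Almost orthogonality of functions supported in dyadic annuli. -/
theorem lintegral_sq_tsum_le (hd : 1 ≤ d) {s : ℝ} (hs : 0 ≤ s) {U : ℤ → Eu d → ℝ≥0∞}
    (hU : ∀ j, Measurable (U j))
    (hsupp : ∀ j z, U j z ≠ 0 → (2 : ℝ≥0∞) ^ (j - 1) ≤ ‖z‖ₑ ∧ ‖z‖ₑ ≤ 2 ^ (j + 2)) :
    ∫⁻ z, ‖z‖ₑ ^ (2 * s) * (∑' j, U j z) ^ 2 ≤
      4 * 4 ^ (2 * s) * ∑' j : ℤ, ((2 : ℝ≥0∞) ^ j) ^ (2 * s) * ∫⁻ z, U j z ^ 2 := by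
  have key : ∀ᵐ z : Eu d, ‖z‖ₑ ^ (2 * s) * (∑' j, U j z) ^ 2 ≤
      ∑' j : ℤ, 4 * 4 ^ (2 * s) * (((2 : ℝ≥0∞) ^ j) ^ (2 * s) * U j z ^ 2) := by
    filter_upwards [ae_enorm_ne_zero hd] with z hz
    obtain ⟨n, h1, h2⟩ := exists_mem_annulus hz
    -- For `2^n ≤ |z| < 2^(n+1)` the support condition forces `j - 1 < n + 1` and `n < j + 3`, so at
    -- most four terms are nonzero at `z`.
    have hcard : ∑' j : ℤ, (if j ∈ Finset.Icc (n - 2) (n + 1) then (1 : ℝ≥0∞) else 0) = 4 := by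
      rw [tsum_eq_sum (s := Finset.Icc (n - 2) (n + 1)) fun j hj => if_neg hj,
        Finset.sum_congr rfl fun j hj => if_pos hj]
      simp only [Finset.sum_const, Int.card_Icc, nsmul_eq_mul, mul_one]
      have : (n + 1 + 1 - (n - 2)).toNat = 4 := by omega
      rw [this]; norm_num
    have hcs := tsum_le_of_sq_le_mul (T := fun j => U j z) (a := fun j => U j z ^ 2)
      (b := fun j => if j ∈ Finset.Icc (n - 2) (n + 1) then (1 : ℝ≥0∞) else 0) fun j => by
        by_cases h0 : U j z = 0
        · simp [h0]
        · obtain ⟨h3, h4⟩ := hsupp j z h0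
          have h5 := lt_of_two_zpow_lt (h3.trans_lt h2)
          have h6 : (2 : ℝ≥0∞) ^ n < 2 ^ (j + 3) := by
            refine (h1.trans h4).trans_lt ?_
            rw [two_zpow_eq_ofReal, two_zpow_eq_ofReal, ENNReal.ofReal_lt_ofReal_iff (by positivity)]
            exact zpow_lt_zpow_right₀ (by norm_num) (by omega)
          have h7 := lt_of_two_zpow_lt h6
          rw [if_pos (Finset.mem_Icc.2 (by omega)), mul_one]
    rw [hcard] at hcs
    calc _ ≤ ‖z‖ₑ ^ (2 * s) * ((∑' j, U j z ^ 2) * 4) := mul_le_mul_right hcs _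
      _ = ∑' j, 4 * (‖z‖ₑ ^ (2 * s) * U j z ^ 2) := by
          rw [ENNReal.tsum_mul_left, ENNReal.tsum_mul_left]; ring
      _ ≤ _ := by
          refine ENNReal.tsum_le_tsum fun j => ?_
          by_cases h0 : U j z = 0
          · simp [h0]
          · have h4 : ‖z‖ₑ ≤ 4 * 2 ^ j := by
              refine (hsupp j z h0).2.trans (le_of_eq ?_)
              rw [two_zpow_add, mul_comm]; congr 1; rw [← ENNReal.rpow_intCast]; norm_num
            have h5 := ENNReal.rpow_le_rpow h4 (show 0 ≤ 2 * s by linarith)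
            rw [ENNReal.mul_rpow_of_nonneg _ _ (by linarith)] at h5
            calc _ ≤ 4 * (4 ^ (2 * s) * ((2 : ℝ≥0∞) ^ j) ^ (2 * s) * U j z ^ 2) := by gcongr
              _ = _ := by ring
  refine (lintegral_mono_ae key).trans (le_of_eq ?_)
  rw [lintegral_tsum fun j => by have := hU j; fun_prop, ← ENNReal.tsum_mul_left]
  refine tsum_congr fun j => ?_
  have := hU j
  rw [lintegral_const_mul _ (by fun_prop), lintegral_const_mul _ (by fun_prop)]

theorem enorm_le_of_cutoff_ne_zero {χ : Eu d → ℂ} (h0 : ∀ ξ, 2 < ‖ξ‖ → χ ξ = 0) {k : ℤ} {y : Eu d}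
    (h : χ (((2 : ℝ) ^ (-k)) • y) ≠ 0) : ‖y‖ₑ ≤ 2 ^ (k + 1) := by
  have h1 := not_lt.1 (mt (h0 _) h)
  rw [norm_scaled, zpow_neg, inv_mul_le_iff₀ (by positivity)] at h1
  rw [two_zpow_eq_ofReal, ← ofReal_norm, zpow_add_one₀ (by norm_num)]
  exact ENNReal.ofReal_le_ofReal h1

theorem lt_enorm_of_cutoff_ne_one {χ : Eu d → ℂ} (h1 : ∀ ξ, ‖ξ‖ ≤ 1 → χ ξ = 1) {k : ℤ} {y : Eu d}
    (h : χ (((2 : ℝ) ^ (-k)) • y) ≠ 1) : 2 ^ k < ‖y‖ₑ := by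
  have h2 := not_le.1 (mt (h1 _) h)
  rw [norm_scaled, zpow_neg, lt_inv_mul_iff₀ (by positivity), mul_one] at h2
  rw [two_zpow_eq_ofReal, ← ofReal_norm, ENNReal.ofReal_lt_ofReal_iff_of_nonneg (by positivity)]
  exact h2

/-! ### Weighted bound for the convolution -/

theorem stronglyMeasurable_conv {A B : Eu d → ℂ} (hA : Measurable A) (hB : Measurable B) :
    StronglyMeasurable (conv A B) := by
  have : Measurable fun p : Eu d × Eu d => A (p.1 - p.2) * B p.2 := by fun_prop
  exact this.stronglyMeasurable.integral_prod_right'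

/-- The shift `j - 2` keeps `|y| ≤ 2^(j-1)`, half the inner radius of the shell, so the sum of the
frequencies stays of size `2^j`. -/
theorem enorm_mem_of_conv_shell_ne_zero {χ : Eu d → ℂ} (h0 : ∀ ξ, 2 < ‖ξ‖ → χ ξ = 0)
    {A B : Eu d → ℂ} {j : ℤ} {z : Eu d}
    (h : conv ((shell j).indicator A) (fun y => χ (((2 : ℝ) ^ (-(j - 2))) • y) * B y) z ≠ 0) :
    (2 : ℝ≥0∞) ^ (j - 1) ≤ ‖z‖ₑ ∧ ‖z‖ₑ ≤ 2 ^ (j + 2) := by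
  have hex : ∃ y, (shell j).indicator A (z - y) * (χ (((2 : ℝ) ^ (-(j - 2))) • y) * B y) ≠ 0 := by
    by_contra! hc
    exact h (by simp only [conv, hc, integral_zero])
  obtain ⟨y, hy⟩ := hex
  have h1 : z - y ∈ shell j := Set.mem_of_indicator_ne_zero (left_ne_zero_of_mul hy)
  have h2 := enorm_le_of_cutoff_ne_zero h0 (left_ne_zero_of_mul (right_ne_zero_of_mul hy))
  rw [show j - 2 + 1 = j - 1 by ring] at h2
  have hdouble : ∀ k : ℤ, (2 : ℝ≥0∞) ^ (k + 1) = 2 ^ k + 2 ^ k := fun k => by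
    rw [two_zpow_add, zpow_one, mul_two]
  constructor
  · have h3 : (2 : ℝ≥0∞) ^ (j - 1) + 2 ^ (j - 1) ≤ ‖z‖ₑ + 2 ^ (j - 1) := by
      rw [← hdouble, sub_add_cancel]
      exact h1.1.trans ((enorm_sub_le).trans (by gcongr))
    exact (ENNReal.add_le_add_iff_right (two_zpow_ne_top _)).1 h3
  · calc ‖z‖ₑ = ‖(z - y) + y‖ₑ := by rw [sub_add_cancel]
      _ ≤ ‖z - y‖ₑ + ‖y‖ₑ := enorm_add_le _ _
      _ ≤ 2 ^ (j + 1) + 2 ^ (j + 1) := by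
          refine add_le_add h1.2.le (h2.trans ?_)
          exact ENNReal.zpow_le_of_le (by norm_num) (by omega)
      _ = _ := by rw [← hdouble]; congr 1; ring

/-- Bony's decomposition: `A` is cut into shells, and `B` is split by the cut-off at scale
`2^(j-2)`. Absolute values are taken only in the complementary part, which `paraConv` dominates. -/
theorem enorm_conv_le (hd : 1 ≤ d) {χ : Eu d → ℂ} (hχ : Measurable χ)
    (h1 : ∀ ξ, ‖ξ‖ ≤ 1 → χ ξ = 1) {M : ℝ≥0} (hM : ∀ ξ, ‖χ ξ‖ ≤ M) {A B : Eu d → ℂ}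
    (hA : Measurable A) (hB : Measurable B) {z : Eu d} (hz : ∫⁻ y, ‖A (z - y)‖ₑ * ‖B y‖ₑ < ⊤) :
    ‖conv A B z‖ₑ ≤
      ∑' j : ℤ, ‖conv ((shell j).indicator A) (fun y => χ (((2 : ℝ) ^ (-(j - 2))) • y) * B y) z‖ₑ +
      (1 + M) * paraConv (fun x => ‖A x‖ₑ) (fun x => ‖B x‖ₑ) z := by
  have hAj : ∀ j : ℤ, Measurable ((shell j).indicator A) := fun j =>
    hA.indicator (measurableSet_shell j)
  have hMe : ∀ ξ, ‖χ ξ‖ₑ ≤ M := fun ξ => by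
    simpa [enorm, ← NNReal.coe_le_coe] using hM ξ
  have hle : ∀ (j : ℤ) (x : Eu d), ‖(shell j).indicator A x‖ₑ ≤ ‖A x‖ₑ := fun j x =>
    enorm_indicator_le_enorm_self A x
  have hsum : ∑' j : ℤ, ∫⁻ y, ‖(shell j).indicator A (z - y) * B y‖ₑ ≠ ⊤ := by
    rw [← lintegral_tsum fun j => by have := hAj j; fun_prop]
    refine (lt_of_le_of_lt (lintegral_mono fun y => ?_) hz).ne
    simp only [enorm_mul, enorm_indicator_eq_indicator_enorm]
    rw [ENNReal.tsum_mul_right]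
    gcongr
    exact tsum_shell_indicator_le _ _
  have hdec : conv A B z = ∑' j : ℤ, conv ((shell j).indicator A) B z := by
    simp only [conv]
    rw [← integral_tsum (fun j => by have := hAj j; fun_prop) hsum]
    refine integral_congr_ae ?_
    have hne : ∀ᵐ y : Eu d, ‖z - y‖ₑ ≠ 0 :=
      (quasiMeasurePreserving_sub_left volume z).ae (ae_enorm_ne_zero hd)
    filter_upwards [hne] with y hy
    rw [tsum_mul_right, tsum_shell_indicator A hy]
  have hone : ∀ j : ℤ, ‖conv ((shell j).indicator A) B z‖ₑ ≤
      ‖conv ((shell j).indicator A) (fun y => χ (((2 : ℝ) ^ (-(j - 2))) • y) * B y) z‖ₑ +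
      ∫⁻ y, (1 + M) * (if ‖z - y‖ₑ ≤ 8 * ‖y‖ₑ then
        (shell j).indicator (fun x => ‖A x‖ₑ) (z - y) * ‖B y‖ₑ else 0) := fun j => by
    have := hAj j
    have hi : Integrable fun y => (shell j).indicator A (z - y) * B y := by
      refine ⟨by fun_prop, lt_of_le_of_lt (lintegral_mono fun y => ?_) hz⟩
      rw [enorm_mul]; gcongr; exact hle j _
    have hi1 : Integrable fun y =>
        (shell j).indicator A (z - y) * (χ (((2 : ℝ) ^ (-(j - 2))) • y) * B y) := by
      refine (hi.bdd_mul (f := fun y => χ (((2 : ℝ) ^ (-(j - 2))) • y)) (c := M)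
        (hχ.comp (measurable_const_smul _)).aestronglyMeasurable
        (Eventually.of_forall fun y => hM _)).congr (Eventually.of_forall fun y => ?_)
      simp only; ring
    have e : conv ((shell j).indicator A) B z =
        conv ((shell j).indicator A) (fun y => χ (((2 : ℝ) ^ (-(j - 2))) • y) * B y) z +
        ∫ y, ((shell j).indicator A (z - y) * B y -
          (shell j).indicator A (z - y) * (χ (((2 : ℝ) ^ (-(j - 2))) • y) * B y)) := by
      rw [integral_sub hi hi1]; simp only [conv]; ring
    rw [e]
    refine (enorm_add_le _ _).trans (add_le_add le_rfl ?_)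
    refine (enorm_integral_le_lintegral_enorm _).trans (lintegral_mono fun y => ?_)
    have e2 : (shell j).indicator A (z - y) * B y -
        (shell j).indicator A (z - y) * (χ (((2 : ℝ) ^ (-(j - 2))) • y) * B y) =
        (1 - χ (((2 : ℝ) ^ (-(j - 2))) • y)) * ((shell j).indicator A (z - y) * B y) := by ring
    simp only [e2]
    by_cases hcut : χ (((2 : ℝ) ^ (-(j - 2))) • y) = 1
    · rw [hcut, sub_self, zero_mul, enorm_zero]; exact zero_le
    by_cases hmem : z - y ∈ shell j
    · have h2 := (lt_enorm_of_cutoff_ne_one h1 hcut).le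
      -- Here `|z - y| < 2^(j+1) = 8 · 2^(j-2) < 8|y|`, which explains the constant `8` in
      -- `paraConv`.
      have h3 : ‖z - y‖ₑ ≤ 8 * ‖y‖ₑ := by
        refine hmem.2.le.trans (le_trans (le_of_eq ?_) (mul_le_mul_right h2 8))
        rw [show j + 1 = j - 2 + 3 by ring, two_zpow_add, mul_comm]
        congr 1; rw [← ENNReal.rpow_intCast]; norm_num
      rw [if_pos h3, enorm_mul, enorm_mul, ← enorm_indicator_eq_indicator_enorm]
      gcongr
      refine enorm_sub_le.trans (add_le_add ?_ (hMe _))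
      simp
    · simp [Set.indicator_of_notMem hmem]
  rw [hdec]
  refine (enorm_tsum_le_tsum_enorm).trans ((ENNReal.tsum_le_tsum hone).trans ?_)
  rw [ENNReal.tsum_add]
  refine add_le_add le_rfl ?_
  have hmi : ∀ j : ℤ, Measurable fun y => if ‖z - y‖ₑ ≤ 8 * ‖y‖ₑ then
      (shell j).indicator (fun x => ‖A x‖ₑ) (z - y) * ‖B y‖ₑ else 0 := fun j => by
    have := hA.enorm.indicator (measurableSet_shell j)
    exact Measurable.ite (measurableSet_le (by fun_prop) (by fun_prop)) (by fun_prop) (by fun_prop)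
  simp only [lintegral_const_mul _ (hmi _)]
  rw [ENNReal.tsum_mul_left, ← lintegral_tsum fun j => (hmi j).aemeasurable]
  refine mul_le_mul_right (lintegral_mono fun y => ?_) _
  by_cases hy : ‖z - y‖ₑ ≤ 8 * ‖y‖ₑ
  · simp only [if_pos hy]
    rw [ENNReal.tsum_mul_right]
    gcongr
    exact tsum_shell_indicator_le _ _
  · simp [if_neg hy]

/-- The annuli cover almost everything, and the `ℓ^2` norm of the block norms is at most their `ℓ^1`
norm. -/
theorem lintegral_weight_sq_le (hd : 1 ≤ d) {s : ℝ} (hs : 0 ≤ s) (P : Eu d → ℝ≥0∞) :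
    ∫⁻ z, ‖z‖ₑ ^ (2 * s) * P z ^ 2 ≤ 4 ^ (2 * s) *
      (∑' l : ℤ, ((2 : ℝ≥0∞) ^ l) ^ s * (∫⁻ z in annulus l, P z ^ 2) ^ (1 / 2 : ℝ)) ^ 2 := by
  set t : ℤ → ℝ≥0∞ := fun l => ((2 : ℝ≥0∞) ^ l) ^ s * (∫⁻ z in annulus l, P z ^ 2) ^ (1 / 2 : ℝ)
  have hc : (4 : ℝ≥0∞) ^ (2 * s) ≠ ⊤ := ENNReal.rpow_ne_top_of_nonneg (by linarith) (by norm_num)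
  have hblock : ∀ l : ℤ, ∫⁻ z in annulus l, ‖z‖ₑ ^ (2 * s) * P z ^ 2 ≤ 4 ^ (2 * s) * t l ^ 2 :=
    fun l => by
      have hz : ∀ z ∈ annulus l, ‖(z : Eu d)‖ₑ ^ (2 * s) * P z ^ 2 ≤
          4 ^ (2 * s) * ((2 : ℝ≥0∞) ^ l) ^ (2 * s) * P z ^ 2 := fun z hz => by
        have h4 : ‖z‖ₑ ≤ 4 * 2 ^ l := by
          refine hz.2.trans (le_of_eq ?_)
          rw [two_zpow_add, mul_comm]; congr 1; rw [← ENNReal.rpow_intCast]; norm_num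
        rw [← ENNReal.mul_rpow_of_nonneg _ _ (by linarith)]
        gcongr
      refine (setLIntegral_mono' (measurableSet_annulus l) hz).trans (le_of_eq ?_)
      have hc2 : ((2 : ℝ≥0∞) ^ l) ^ (2 * s) ≠ ⊤ :=
        ENNReal.rpow_ne_top_of_nonneg (by linarith) (two_zpow_ne_top l)
      rw [lintegral_const_mul' _ _ (ENNReal.mul_ne_top hc hc2), mul_assoc]
      congr 1
      simp only [t]
      rw [mul_pow, sq_rpow_half, ENNReal.rpow_one, ← ENNReal.rpow_natCast, ← ENNReal.rpow_mul]
      congr 2; push_cast; ring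
  refine (lintegral_le_tsum_annulus hd _).trans ((ENNReal.tsum_le_tsum hblock).trans ?_)
  rw [ENNReal.tsum_mul_left]
  gcongr
  rw [sq, ← ENNReal.tsum_mul_left]
  refine ENNReal.tsum_le_tsum fun l => ?_
  rw [sq]
  gcongr
  exact ENNReal.le_tsum l

theorem TemperedPair.ae_lt_top {A B : Eu d → ℂ} (h : TemperedPair A B) (hA : Measurable A)
    (hB : Measurable B) : ∀ᵐ z, ∫⁻ y, ‖A (z - y)‖ₑ * ‖B y‖ₑ < ⊤ := by
  obtain ⟨N, hN⟩ := h
  have hm := measurable_conv hA.enorm hB.enorm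
  filter_upwards [MeasureTheory.ae_lt_top (by fun_prop) hN.ne] with z hz
  refine lt_top_iff_ne_top.2 fun hcon => hz.ne ?_
  rw [hcon, ENNReal.mul_top]
  rw [Ne, ENNReal.ofReal_eq_zero, not_le]
  positivity

/-- `eLpNorm_conv_le` with the bounded function `S_{j-2} b` as multiplier. Finiteness is assumed in
weighted form because it is read off from a term of a convergent series. -/
theorem lintegral_conv_shell_sq_le {χ : Eu d → ℂ} (hχ : ContDiff ℝ ∞ χ)
    (h0 : ∀ ξ, 2 < ‖ξ‖ → χ ξ = 0) {M C : ℝ≥0} (hM : ∀ ξ, ‖χ ξ‖ ≤ M)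
    (hC : ∀ (b : Lp ℂ ∞ (volume : Measure (Eu d))) (B : Eu d → ℂ),
      IsGivenBy (𝓕 (b : 𝓢'(Eu d, ℂ))) B → ∀ (l : ℤ) (x : Eu d),
      ‖𝓕⁻ (fun ξ => χ (((2 : ℝ) ^ (-l)) • ξ) * B ξ) x‖ ≤ C * ‖b‖)
    {b : Lp ℂ ∞ (volume : Measure (Eu d))} {A B : Eu d → ℂ} (hA : Measurable A) (hB : Measurable B)
    (hbB : IsGivenBy (𝓕 (b : 𝓢'(Eu d, ℂ))) B) (hpair : TemperedPair A B) {j : ℤ} {p : ℝ}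
    (hj : ((2 : ℝ≥0∞) ^ j) ^ p * ∫⁻ x, ‖(shell j).indicator A x‖ₑ ^ 2 ≠ ⊤) :
    ∫⁻ z, ‖conv ((shell j).indicator A) (fun y => χ (((2 : ℝ) ^ (-(j - 2))) • y) * B y) z‖ₑ ^ 2 ≤
      (C * ‖b‖ₑ) ^ 2 * ∫⁻ x, ‖(shell j).indicator A x‖ₑ ^ 2 := by
  have hAj : Measurable ((shell j).indicator A) := hA.indicator (measurableSet_shell j)
  have hBj : Measurable fun y => χ (((2 : ℝ) ^ (-(j - 2))) • y) * B y :=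
    (hχ.continuous.measurable.comp (measurable_const_smul _)).mul hB
  have hfin : ∫⁻ x, ‖(shell j).indicator A x‖ₑ ^ 2 ≠ ⊤ := fun h => hj (by
    rw [h, ENNReal.mul_top]
    exact (ENNReal.rpow_pos (pos_iff_ne_zero.2 (two_zpow_ne_zero j)) (two_zpow_ne_top j)).ne')
  have hAj2 : MemLp ((shell j).indicator A) 2 volume := by
    refine ⟨hAj.aestronglyMeasurable, ?_⟩
    rw [eLpNorm_two_eq_lintegral]
    exact ENNReal.rpow_lt_top_of_nonneg (by norm_num) hfin
  have hp : TemperedPair ((shell j).indicator A)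
      (fun y => χ (((2 : ℝ) ^ (-(j - 2))) • y) * B y) := by
    refine hpair.mono (c := 1 + M) (fun x => ?_) fun x => ?_
    · refine (norm_indicator_le_norm_self A x).trans (le_mul_of_one_le_left (norm_nonneg _) ?_)
      simp
    · rw [norm_mul]
      gcongr
      refine (hM _).trans ?_
      simp
  have hgB := hbB.fourierMultiplier (hasTemperateGrowth_scaled hχ h0 (j - 2))
  have key := eLpNorm_conv_le hAj hBj hp hAj2
    (isGivenBy_fourierInv hgB (integrable_cutoff_mul hχ h0 hbB.1 (j - 2))) hgB
    (Eventually.of_forall (hC b B hbB (j - 2)))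
  rw [ENNReal.ofReal_mul C.coe_nonneg, ENNReal.ofReal_coe_nnreal, ofReal_norm,
    eLpNorm_two_eq_lintegral, eLpNorm_two_eq_lintegral] at key
  have hs2 : ∀ x : ℝ≥0∞, (x ^ (1 / 2 : ℝ)) ^ 2 = x := fun x => by
    rw [sq_rpow_half, ENNReal.rpow_one]
  have := pow_le_pow_left' key 2
  rwa [mul_pow, hs2, hs2] at this

theorem exists_weighted_conv_le (hd : 1 ≤ d) {s : ℝ} (hs : 0 < s) : ∃ C : ℝ≥0,
    ∀ (b : Lp ℂ ∞ (volume : Measure (Eu d))) (A B : Eu d → ℂ), Measurable A → Measurable B →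
    IsGivenBy (𝓕 (b : 𝓢'(Eu d, ℂ))) B → TemperedPair A B →
    MemLp (fun ξ => ((‖ξ‖ ^ s : ℝ) : ℂ) * A ξ) 2 volume →
    eLpNorm (fun ξ => ((‖ξ‖ ^ s : ℝ) : ℂ) * conv A B ξ) 2 volume ≤
      C * (eLpNorm (fun ξ => ((‖ξ‖ ^ (((d : ℝ) - 1) / 2) : ℝ) : ℂ) * A ξ) 2 volume *
        eLpNorm (fun ξ => ((‖ξ‖ ^ (s + 1 / 2) : ℝ) : ℂ) * B ξ) 2 volume +
        eLpNorm (fun ξ => ((‖ξ‖ ^ s : ℝ) : ℂ) * A ξ) 2 volume * ‖b‖ₑ) := by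
  obtain ⟨χ, hχ, h1, h0⟩ := exists_cutoff (d := d)
  obtain ⟨M, hM⟩ := exists_bound_cutoff hχ h0
  obtain ⟨C₀, hC₀⟩ := exists_norm_lowFreq_le hχ h0
  -- The exponent `(d-1)/2` is below `d/2`, `s + 1/2` may be arbitrarily large, and the resulting
  -- regularity `s₁ + s₂ - d/2` is exactly `s`.
  obtain ⟨C₁, hC₁, hpara⟩ := exists_tsum_paraConv_le hd (s₁ := ((d : ℝ) - 1) / 2)
    (s₂ := s + 1 / 2) (by linarith) (by
      have : (1 : ℝ) ≤ d := by exact_mod_cast hd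
      linarith)
  rw [show ((d : ℝ) - 1) / 2 + (s + 1 / 2) - d / 2 = s by ring] at hpara
  have hχm : Measurable χ := hχ.continuous.measurable
  have h4 : (4 : ℝ≥0∞) ^ (2 * s) ≠ ⊤ := ENNReal.rpow_ne_top_of_nonneg (by linarith) (by norm_num)
  set K₁ : ℝ≥0∞ := 2 * (4 * 4 ^ (2 * s) * (C₀ : ℝ≥0∞) ^ 2) with hK₁
  set K₂ : ℝ≥0∞ := 2 * ((1 + M) ^ 2 * (4 ^ (2 * s) * C₁ ^ 2)) with hK₂
  have hK₁t : K₁ ^ (1 / 2 : ℝ) ≠ ⊤ :=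
    ENNReal.rpow_ne_top_of_nonneg (by norm_num) (by finiteness)
  have hK₂t : K₂ ^ (1 / 2 : ℝ) ≠ ⊤ :=
    ENNReal.rpow_ne_top_of_nonneg (by norm_num) (by finiteness)
  refine ⟨(K₁ ^ (1 / 2 : ℝ) + K₂ ^ (1 / 2 : ℝ)).toNNReal, fun b A B hA hB hbB hpair hA2 => ?_⟩
  rw [ENNReal.coe_toNNReal (ENNReal.add_ne_top.2 ⟨hK₁t, hK₂t⟩)]
  set U : ℤ → Eu d → ℂ := fun j =>
    conv ((shell j).indicator A) (fun y => χ (((2 : ℝ) ^ (-(j - 2))) • y) * B y) with hU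
  have hAj : ∀ j : ℤ, Measurable ((shell j).indicator A) := fun j =>
    hA.indicator (measurableSet_shell j)
  have hBj : ∀ j : ℤ, Measurable fun y => χ (((2 : ℝ) ^ (-(j - 2))) • y) * B y := fun j =>
    (hχm.comp (measurable_const_smul _)).mul hB
  have hUm : ∀ j, Measurable fun z => ‖U j z‖ₑ := fun j =>
    (stronglyMeasurable_conv (hAj j) (hBj j)).enorm
  set W := ∫⁻ x, ‖x‖ₑ ^ (2 * s) * ‖A x‖ₑ ^ 2 with hW
  have hWeq : eLpNorm (fun ξ => ((‖ξ‖ ^ s : ℝ) : ℂ) * A ξ) 2 volume = W ^ (1 / 2 : ℝ) :=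
    weighted_eLpNorm_eq hd s A
  have hWt : W ≠ ⊤ := fun h => by
    have := hA2.2
    rw [hWeq, h] at this
    simp at this
  have hshell : ∑' j : ℤ, ((2 : ℝ≥0∞) ^ j) ^ (2 * s) * ∫⁻ x, ‖(shell j).indicator A x‖ₑ ^ 2 ≤ W := by
    simpa only [enorm_indicator_eq_indicator_enorm] using tsum_lintegral_shell_le hs.le hA.enorm
  have hUj : ∀ j, ∫⁻ z, ‖U j z‖ₑ ^ 2 ≤
      (C₀ * ‖b‖ₑ) ^ 2 * ∫⁻ x, ‖(shell j).indicator A x‖ₑ ^ 2 := fun j =>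
    lintegral_conv_shell_sq_le hχ h0 hM hC₀ hA hB hbB hpair
      (ne_top_of_le_ne_top hWt ((ENNReal.le_tsum j).trans hshell))
  have hX : ∫⁻ z, ‖z‖ₑ ^ (2 * s) * (∑' j, ‖U j z‖ₑ) ^ 2 ≤
      4 * 4 ^ (2 * s) * ((C₀ * ‖b‖ₑ) ^ 2 * W) := by
    refine (lintegral_sq_tsum_le hd hs.le hUm fun j z hz =>
      enorm_mem_of_conv_shell_ne_zero h0 (A := A) (B := B) (enorm_ne_zero.1 hz)).trans ?_
    refine mul_le_mul_right ?_ _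
    calc _ ≤ ∑' j : ℤ, (C₀ * ‖b‖ₑ) ^ 2 *
          (((2 : ℝ≥0∞) ^ j) ^ (2 * s) * ∫⁻ x, ‖(shell j).indicator A x‖ₑ ^ 2) := by
          refine ENNReal.tsum_le_tsum fun j => (mul_le_mul_right (hUj j) _).trans (le_of_eq ?_)
          ring
      _ ≤ _ := by rw [ENNReal.tsum_mul_left]; gcongr
  set P := paraConv (fun x => ‖A x‖ₑ) (fun x => ‖B x‖ₑ) with hP
  have hPm : Measurable P := measurable_paraConv hA.enorm hB.enorm
  have hY := (lintegral_weight_sq_le hd hs.le P).trans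
    (mul_le_mul_right (pow_le_pow_left' (hpara _ _ hA.enorm hB.enorm) 2) _)
  rw [← weighted_eLpNorm_eq hd, ← weighted_eLpNorm_eq hd] at hY
  set n₁ := eLpNorm (fun ξ => ((‖ξ‖ ^ (((d : ℝ) - 1) / 2) : ℝ) : ℂ) * A ξ) 2 volume
  set n₂ := eLpNorm (fun ξ => ((‖ξ‖ ^ (s + 1 / 2) : ℝ) : ℂ) * B ξ) 2 volume
  have htotal : ∫⁻ z, ‖z‖ₑ ^ (2 * s) * ‖conv A B z‖ₑ ^ 2 ≤
      K₁ * (‖b‖ₑ ^ 2 * W) + K₂ * (n₁ * n₂) ^ 2 := by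
    calc _ ≤ ∫⁻ z, (2 * (‖z‖ₑ ^ (2 * s) * (∑' j, ‖U j z‖ₑ) ^ 2) +
          2 * (1 + M) ^ 2 * (‖z‖ₑ ^ (2 * s) * P z ^ 2)) := by
          refine lintegral_mono_ae ?_
          filter_upwards [hpair.ae_lt_top hA hB] with z hz
          have h5 := pow_le_pow_left' (enorm_conv_le hd hχm h1 hM hA hB hz) 2
          have h6 := ENNReal.rpow_add_le_mul_rpow_add_rpow (∑' j, ‖U j z‖ₑ) ((1 + M) * P z)
            (p := 2) (by norm_num)
          rw [ENNReal.rpow_two, ENNReal.rpow_two, ENNReal.rpow_two,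
            show (2 : ℝ) - 1 = 1 by norm_num, ENNReal.rpow_one] at h6
          refine (mul_le_mul_right (h5.trans h6) _).trans (le_of_eq ?_)
          ring
      _ = 2 * (∫⁻ z, ‖z‖ₑ ^ (2 * s) * (∑' j, ‖U j z‖ₑ) ^ 2) +
          2 * (1 + M) ^ 2 * ∫⁻ z, ‖z‖ₑ ^ (2 * s) * P z ^ 2 := by
          rw [lintegral_add_right _ (by fun_prop), lintegral_const_mul' _ _ (by norm_num),
            lintegral_const_mul _ (by fun_prop)]
      _ ≤ 2 * (4 * 4 ^ (2 * s) * ((C₀ * ‖b‖ₑ) ^ 2 * W)) +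
          2 * (1 + M) ^ 2 * (4 ^ (2 * s) * (C₁ * (n₁ * n₂)) ^ 2) := by gcongr
      _ = _ := by rw [hK₁, hK₂]; ring
  have hs2 : ∀ x : ℝ≥0∞, (x ^ 2) ^ (1 / 2 : ℝ) = x := fun x => by
    rw [← ENNReal.rpow_natCast, ← ENNReal.rpow_mul]; simp
  clear_value K₁ K₂
  rw [weighted_eLpNorm_eq hd s (conv A B), hWeq]
  refine (ENNReal.rpow_le_rpow htotal (by norm_num)).trans
    ((ENNReal.rpow_add_le_add_rpow _ _ (by norm_num) (by norm_num)).trans ?_)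
  rw [ENNReal.mul_rpow_of_nonneg _ _ (by norm_num), ENNReal.mul_rpow_of_nonneg _ _ (by norm_num),
    ENNReal.mul_rpow_of_nonneg _ _ (by norm_num), hs2, hs2, add_mul, add_comm (n₁ * n₂),
    mul_comm ‖b‖ₑ]
  gcongr
  · exact le_self_add
  · exact le_add_self

/-! ### The product law in Sobolev spaces -/

/-- A distribution whose Fourier transform is the sum of an integrable and a square integrable
function is the sum of a bounded and a square integrable function. -/
theorem isGivenBy_fourierInv_add {a : 𝓢'(Eu d, ℂ)} {A A₁ A₂ : Eu d → ℂ} (ha : IsGivenBy (𝓕 a) A)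
    (h₁ : Integrable A₁) (h₂ : MemLp A₂ 2 volume) (hA : ∀ x, A x = A₁ x + A₂ x) :
    IsGivenBy a (fun x => 𝓕⁻ A₁ x +
      (𝓕⁻ (h₂.toLp A₂) : Lp ℂ 2 (volume : Measure (Eu d))) x) := by
  have e1 : IsGivenBy (𝓕 (𝓕⁻ ((memLp_one_iff_integrable.2 h₁).toLp A₁ : 𝓢'(Eu d, ℂ)))) A₁ := by
    rw [fourier_fourierInv_eq]
    exact isGivenBy_of_integrable h₁
  have e2 : IsGivenBy (𝓕 (𝓕⁻ (h₂.toLp A₂ : 𝓢'(Eu d, ℂ)))) A₂ := by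
    rw [fourier_fourierInv_eq]
    exact (isGivenBy_Lp _).congr h₂.coeFn_toLp
  have e3 := e1.add e2
  rw [← FourierTransform.fourier_add, ← funext hA] at e3
  have e4 := congrArg (fun T : 𝓢'(Eu d, ℂ) => 𝓕⁻ T) (ha.eq_of e3)
  simp only [fourierInv_fourier_eq] at e4
  rw [e4]
  refine (isGivenBy_fourierInv e1 h₁).add ?_
  rw [Lp.fourierInv_toTemperedDistribution_eq]
  exact isGivenBy_Lp _

/-- Here `a` is a bounded function plus an `L^2` function, so its products with the bounded `b` are
of moderate growth and define distributions. -/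
theorem exists_isPointwiseProduct {a : 𝓢'(Eu d, ℂ)} {b : Lp ℂ ∞ (volume : Measure (Eu d))}
    {A A₁ A₂ B : Eu d → ℂ} (hAm : Measurable A) (hBm : Measurable B) (ha : IsGivenBy (𝓕 a) A)
    (hb : IsGivenBy (𝓕 (b : 𝓢'(Eu d, ℂ))) B) (h₁ : Integrable A₁) (h₂ : MemLp A₂ 2 volume)
    (hA : ∀ x, A x = A₁ x + A₂ x) (hpair : TemperedPair A B) :
    ∃ T : 𝓢'(Eu d, ℂ), IsPointwiseProduct a b T ∧ IsGivenBy (𝓕 T) (conv A B) := by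
  set f₁ : Eu d → ℂ := 𝓕⁻ A₁
  set f₂ : Lp ℂ 2 (volume : Measure (Eu d)) := 𝓕⁻ (h₂.toLp A₂)
  have hbm := Lp.aestronglyMeasurable b
  have hbb := ae_norm_le_norm b
  have hf₁m : AEStronglyMeasurable f₁ volume := (continuous_fourierInv h₁).aestronglyMeasurable
  have hm₁ : Moderate fun x => f₁ x * b x := by
    refine moderate_of_bounded (hf₁m.mul hbm) (M := (∫ ξ, ‖A₁ ξ‖) * ‖b‖) ?_
    filter_upwards [hbb] with x hx
    rw [norm_mul]
    exact mul_le_mul (norm_fourierInv_le A₁ x) hx (norm_nonneg _)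
      (integral_nonneg fun _ => norm_nonneg _)
  have hm₂ : Moderate fun x => f₂ x * b x := by
    refine moderate_of_memLp_two ((Lp.memLp f₂).of_le_mul (c := ‖b‖)
      ((Lp.aestronglyMeasurable f₂).mul hbm) ?_)
    filter_upwards [hbb] with x hx
    rw [norm_mul, mul_comm]
    gcongr
  obtain ⟨T₁, hT₁⟩ := hm₁.exists_isGivenBy
  obtain ⟨T₂, hT₂⟩ := hm₂.exists_isGivenBy
  have hT := hT₁.add hT₂
  simp only [← add_mul] at hT
  have hinv := (isInverseTransform_of_integrable h₁).add (isInverseTransform_of_memLp h₂)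
  rw [← funext hA] at hinv
  exact ⟨T₁ + T₂, ⟨_, b, isGivenBy_fourierInv_add ha h₁ h₂ hA, isGivenBy_Lp b, hT⟩,
    hpair.isGivenBy_conv hAm hBm hinv (isGivenBy_Lp b) hb hbb hT⟩

theorem exists_product_memSobolevHom (hd : 1 ≤ d) {s : ℝ} (hs : 0 < s) : ∃ C : ℝ≥0,
    ∀ (a : 𝓢'(Eu d, ℂ)) (b : Lp ℂ ∞ (volume : Measure (Eu d))),
      MemSobolevHom (((d : ℝ) - 1) / 2) a → MemSobolevHom s a →
      MemSobolevHom (s + 1 / 2) (b : 𝓢'(Eu d, ℂ)) →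
      ∃ ab : 𝓢'(Eu d, ℂ), IsPointwiseProduct a (b : 𝓢'(Eu d, ℂ)) ab ∧ MemSobolevHom s ab ∧
        sobolevNorm s ab ≤ C * (sobolevNorm (((d : ℝ) - 1) / 2) a *
          sobolevNorm (s + 1 / 2) (b : 𝓢'(Eu d, ℂ)) + sobolevNorm s a * ‖b‖ₑ) := by
  obtain ⟨C, hC⟩ := exists_weighted_conv_le hd hs
  refine ⟨C, fun a b ha ha' hb => ?_⟩
  obtain ⟨A, hAm, hA, hA2⟩ := ha'.exists_measurable
  obtain ⟨B, hBm, hB, hB2⟩ := hb.exists_measurable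
  have hA1 : MemLp (fun ξ => ((‖ξ‖ ^ (((d : ℝ) - 1) / 2) : ℝ) : ℂ) * A ξ) 2 volume := by
    obtain ⟨A', hA', h⟩ := ha
    refine (memLp_congr_ae ?_).1 h
    filter_upwards [hA'.ae_eq hA] with x hx
    rw [hx]
  -- Both transforms are locally integrable, hence in `L^1` on the unit ball, and lie in `L^2`
  -- outside it because `s` and `s + 1/2` are nonnegative.
  have hpair : TemperedPair A B := temperedPair_of_split hAm hBm (integrable_low hA.1)
    (memLp_high hs.le hAm hA2) (integrable_low hB.1) (memLp_high (by positivity) hBm hB2)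
  obtain ⟨T, hT, hTc⟩ := exists_isPointwiseProduct hAm hBm hA hB (integrable_low hA.1)
    (memLp_high hs.le hAm hA2) (fun x => (Set.indicator_self_add_compl_apply _ A x).symm) hpair
  have key := hC b A B hAm hBm hB hpair hA2
  refine ⟨T, hT, ⟨_, hTc, ?_, key.trans_lt ?_⟩, ?_⟩
  · have := (stronglyMeasurable_conv hAm hBm).aestronglyMeasurable (μ := volume)
    exact (by fun_prop : Measurable fun ξ : Eu d =>
      ((‖ξ‖ ^ s : ℝ) : ℂ)).aestronglyMeasurable.mul this
  · refine ENNReal.mul_lt_top ENNReal.coe_lt_top (ENNReal.add_lt_top.2 ⟨?_, ?_⟩)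
    · exact ENNReal.mul_lt_top hA1.2 hB2.2
    · exact ENNReal.mul_lt_top hA2.2 enorm_lt_top
  · rwa [sobolevNorm_eq hTc, sobolevNorm_eq hA, sobolevNorm_eq hA, sobolevNorm_eq hB]

end ProductLaws

end

theorem mainTheorem9 (d : ℕ) (hd : 1 ≤ d) :
    (∀ s : ℝ, 0 < s → ∃ C : ℝ≥0,
      ∀ (a : 𝓢'(ProductLaws.Eu d, ℂ)) (b : Lp ℂ ∞ (volume : Measure (ProductLaws.Eu d))),
        ProductLaws.MemSobolevHom (((d : ℝ) - 1) / 2) a →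
        ProductLaws.MemSobolevHom s a →
        ProductLaws.MemSobolevHom (s + 1 / 2) (b : 𝓢'(ProductLaws.Eu d, ℂ)) →
        ∃ ab : 𝓢'(ProductLaws.Eu d, ℂ),
          ProductLaws.IsPointwiseProduct a (b : 𝓢'(ProductLaws.Eu d, ℂ)) ab ∧
          ProductLaws.MemSobolevHom s ab ∧
          ProductLaws.sobolevNorm s ab ≤
            C * (ProductLaws.sobolevNorm (((d : ℝ) - 1) / 2) a *
                  ProductLaws.sobolevNorm (s + 1 / 2) (b : 𝓢'(ProductLaws.Eu d, ℂ)) +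
                ProductLaws.sobolevNorm s a * ‖b‖ₑ)) ∧
    (∀ χ : ProductLaws.Eu d → ℂ, ProductLaws.IsCutoff χ →
      ∀ s₁ s₂ : ℝ, 0 < s₁ + s₂ → s₁ < (d : ℝ) / 2 → s₂ < (d : ℝ) / 2 → ∃ C : ℝ≥0,
      ∀ a b : 𝓢'(ProductLaws.Eu d, ℂ),
        ProductLaws.MemSobolevHom s₁ a →
        ProductLaws.MemSobolevHom s₂ b →
        ∃ ab : 𝓢'(ProductLaws.Eu d, ℂ),
          ProductLaws.IsProduct a b ab ∧
          ProductLaws.MemBesov χ (s₁ + s₂ - (d : ℝ) / 2) ab ∧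
          ProductLaws.besovNorm χ (s₁ + s₂ - (d : ℝ) / 2) ab ≤
            C * (ProductLaws.sobolevNorm s₁ a * ProductLaws.sobolevNorm s₂ b)) :=
  ⟨fun _ hs => ProductLaws.exists_product_memSobolevHom hd hs,
    fun _ hχ _ _ h₁₂ h₁ h₂ => ProductLaws.exists_product_memBesov hd hχ h₁₂ h₁ h₂⟩
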